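/- Let $K$ be a field and let $R=K[x_1,\dots,x_n]/I$, where $\deg x_i=1$ and $I$ is generated by quadrics (homogeneous polynomials of degree $2$). Write $R=\bigoplus_j R_j$, and assume that $R$ is Artinian and that $\dim_K R_2=3$. Then: (1) $R$ is Koszul, i.e. in the minimal graded free resolution of $K=R/\bigoplus_{j>0}R_j$ over $R$ the generators of the $i$-th free module all have degree $i$, for every $i$. (2) Assume that $K$ is algebraically closed of characteristic $\neq 2$. Then $R$ is G-quadratic (i.e. after a linear change of coordinates $I$ has a Gröbner basis of quadrics with respect to some term order) if and only if $R$ is not, up to trivial extension, a complete intersection of three general quadrics in three variables. Precisely: $R$ fails to be G-quadratic if and only if, after a linear change of coordinates, $R=K[y_1,y_2,y_3,t_1,\dots,t_r]/\big((q_1,q_2,q_3)+(t_iy_j,\,t_it_j)_{i,j}\big)$ for some $r\ge 0$, where $q_1,q_2,q_3\in K[y_1,y_2,y_3]$ is a regular sequence of quadrics such that the ideal $(q_1,q_2,q_3)$ contains no square of a nonzero linear form. The latter conditions on $(q_1,q_2,q_3)$ are satisfied by general triples of quadrics: there is a nonzero polynomial $F$ over $K$ in the $18$ coefficients of three quadrics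 in three variables such that every triple at which $F$ does not vanish satisfies them. -/

import Mathlib

/-- `I` is generated by quadrics, i.e. the standard graded algebra `K[x₁,…,xₙ]/I` is quadratic. -/
def IsQuadraticIdeal {K : Type*} [Field K] {n : ℕ} (I : Ideal (MvPolynomial (Fin n) K)) : Prop :=
  ∃ G : Set (MvPolynomial (Fin n) K), (∀ g ∈ G, g.IsHomogeneous 2) ∧ I = Ideal.span G

/-- The component `R_j` of the standard graded algebra `R = K[x₁,…,xₙ]/I`: the space of classes of
forms of degree `j`. -/
noncomputable def gradedPiece {K : Type*} [Field K] {n : ℕ}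
    (I : Ideal (MvPolynomial (Fin n) K)) (j : ℕ) : Submodule K (MvPolynomial (Fin n) K ⧸ I) :=
  (MvPolynomial.homogeneousSubmodule (Fin n) K j).map (Ideal.Quotient.mkₐ K I).toLinearMap

/-- The homogeneous maximal ideal `R₊ = ⊕_{j>0} R_j` of `R = K[x₁,…,xₙ]/I`. -/
noncomputable def irrelevantIdeal {K : Type*} [Field K] {n : ℕ}
    (I : Ideal (MvPolynomial (Fin n) K)) : Ideal (MvPolynomial (Fin n) K ⧸ I) :=
  Ideal.span (Set.range fun i : Fin n => Ideal.Quotient.mk I (MvPolynomial.X i))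

/-- The data `b, a, d` form a minimal graded free resolution
`⋯ → F₂ → F₁ → F₀ → K → 0` of the residue field `K = R/R₊` over `R = K[x₁,…,xₙ]/I`:
`F_i` is free of rank `b i` on generators of degrees `a i p`, and `d i : F_{i+1} → F_i` is
given by its matrix. -/
structure IsMinimalResidueResolution {K : Type*} [Field K] {n : ℕ}
    (I : Ideal (MvPolynomial (Fin n) K)) (b : ℕ → ℕ) (a : (i : ℕ) → Fin (b i) → ℕ)
    (d : (i : ℕ) → Matrix (Fin (b i)) (Fin (b (i + 1))) (MvPolynomial (Fin n) K ⧸ I)) : Prop where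
  rank_zero : b 0 = 1
  degree_zero : ∀ p, a 0 p = 0
  /-- The differentials preserve degrees. -/
  homogeneous : ∀ i p q, d i p q = 0 ∨ ∃ e, a (i + 1) q = a i p + e ∧ d i p q ∈ gradedPiece I e
  /-- Minimality. -/
  minimal : ∀ i p q, d i p q ∈ irrelevantIdeal I
  /-- Exactness at `F₀`, where `F₀ = R → K = R/R₊` is the canonical projection. -/
  exact_zero : ∀ v : Fin (b 0) → MvPolynomial (Fin n) K ⧸ I,
    v ∈ LinearMap.range (d 0).mulVecLin ↔ ∀ p, v p ∈ irrelevantIdeal I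
  /-- Exactness at `F_{i+1}`. -/
  exact_succ : ∀ i, LinearMap.range (d (i + 1)).mulVecLin = LinearMap.ker (d i).mulVecLin

/-- `R = K[x₁,…,xₙ]/I` is Koszul: in the (essentially unique) minimal graded free resolution of
`K` over `R`, the generators of the `i`-th free module have degree `i`. -/
def IsKoszul {K : Type*} [Field K] {n : ℕ} (I : Ideal (MvPolynomial (Fin n) K)) : Prop :=
  ∃ (b : ℕ → ℕ) (a : (i : ℕ) → Fin (b i) → ℕ)
    (d : (i : ℕ) → Matrix (Fin (b i)) (Fin (b (i + 1))) (MvPolynomial (Fin n) K ⧸ I)),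
    IsMinimalResidueResolution I b a d ∧ ∀ i p, a i p = i

/-- `G` is a Gröbner basis of `I` with respect to the term order `m`: `G ⊆ I`, and the leading
monomial of every nonzero element of `I` is divisible by that of some nonzero element of `G`. -/
def IsGroebnerBasisOf {K : Type*} [Field K] {σ : Type*} (m : MonomialOrder σ)
    (G : Set (MvPolynomial σ K)) (I : Ideal (MvPolynomial σ K)) : Prop :=
  G ⊆ (I : Set (MvPolynomial σ K)) ∧
    ∀ f ∈ I, f ≠ 0 → ∃ g ∈ G, g ≠ 0 ∧ m.degree g ≤ m.degree f

/-- `R = K[x₁,…,xₙ]/I` is G-quadratic: after a linear change of coordinates `φ`, the ideal has a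
Gröbner basis of quadrics with respect to some term order. -/
def IsGQuadratic {K : Type*} [Field K] {n : ℕ} (I : Ideal (MvPolynomial (Fin n) K)) : Prop :=
  ∃ (φ : MvPolynomial (Fin n) K ≃ₐ[K] MvPolynomial (Fin n) K) (m : MonomialOrder.{0, 0} (Fin n))
    (G : Set (MvPolynomial (Fin n) K)),
    (∀ i, (φ (MvPolynomial.X i)).IsHomogeneous 1) ∧
    (∀ g ∈ G, g.IsHomogeneous 2) ∧
    IsGroebnerBasisOf m G (I.map (φ : MvPolynomial (Fin n) K →+* MvPolynomial (Fin n) K))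

/-- The defining ideal of the trivial extension `K[x, t₁,…,t_r]/(J, t_i x_j, t_i t_j)` of
`K[x]/J` by `r` new variables of degree one. -/
noncomputable def trivialExtensionIdeal {K : Type*} [Field K] {k : ℕ}
    (J : Ideal (MvPolynomial (Fin k) K)) (r : ℕ) : Ideal (MvPolynomial (Fin k ⊕ Fin r) K) :=
  J.map (MvPolynomial.rename (R := K) (Sum.inl : Fin k → Fin k ⊕ Fin r)).toRingHom ⊔
    Ideal.span {f | ∃ (i : Fin r) (j : Fin k ⊕ Fin r),
      f = MvPolynomial.X (Sum.inr i) * MvPolynomial.X j}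

/-- Up to a linear change of coordinates, `K[x₁,…,xₙ]/I` is a trivial extension of
`K[x₁,…,x_k]/J` (by `n - k ≥ 0` variables). -/
def IsTrivialExtensionOf {K : Type*} [Field K] {n k : ℕ}
    (I : Ideal (MvPolynomial (Fin n) K)) (J : Ideal (MvPolynomial (Fin k) K)) : Prop :=
  ∃ (r : ℕ) (φ : MvPolynomial (Fin n) K ≃ₐ[K] MvPolynomial (Fin k ⊕ Fin r) K),
    (∀ i, (φ (MvPolynomial.X i)).IsHomogeneous 1) ∧
    I.map (φ : MvPolynomial (Fin n) K →+* MvPolynomial (Fin k ⊕ Fin r) K) =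
      trivialExtensionIdeal J r

/-- Three quadrics in three variables that form a complete intersection (a regular sequence) and
are general in the sense that the ideal they generate contains no square of a nonzero linear
form. -/
structure IsGeneralCompleteIntersection {K : Type*} [Field K]
    (q : Fin 3 → MvPolynomial (Fin 3) K) : Prop where
  quadric : ∀ k, (q k).IsHomogeneous 2
  regular : RingTheory.Sequence.IsRegular (MvPolynomial (Fin 3) K) [q 0, q 1, q 2]
  no_square : ∀ l : MvPolynomial (Fin 3) K, l.IsHomogeneous 1 → l ≠ 0 →
    l ^ 2 ∉ Ideal.span (Set.range q)

/-! ### Koszul filtrations and linear resolutions -/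

/-! Almost everything is linear algebra of the commutative product `V × V → W` with `V = R₁`, `W =
R₂`, `dim W = 3`. The Artinian hypothesis enters through one fact, `map₂_linMul_eq_top`: every
hyperplane `U` of `V` satisfies `U·V = W`, since a functional on `W` killing `U·V` would be, up to a
scalar, evaluation at a nonzero common zero of the quadrics. Let `T` be the annihilator of `V` in
`V`. Over an algebraically closed field its codimension is at least three.

Koszulness descends from the algebraic closure (`IsKoszul.of_extIdeal`), and there a Koszul
filtration is constructed: a family of ideals generated by linear forms, each obtained from a
smaller member by adding one form, with colon ideal again in the family. Such a family yields a
linear resolution of `K` by computing syzygies coordinate by coordinate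
(`IsFiltered.exists_matrix`). If the degree-one part `L` of a colon ideal satisfies `L·V = W`, then
all forms of degree at least two lie in `(L)`, so colon ideals can be computed in degree one. Spaces
of linear forms inside `T` cost nothing.

If `codim T ≥ 4`, a dimension count gives `x ∉ T` with `x² = 0`. The filtration is easy to write
down unless `x` is exceptional, that is, `xV` is a plane containing `Ann(x)V`. If all square-zero
elements outside `T` are exceptional, one constructs explicitly `p`, `z` with `pz = 0` and `Ann(p)V
= Ann(z)V = W`. If `codim T = 3`, then `R` is a trivial extension of an algebra defined by three
ternary quadrics, so `R₃ ≠ 0` because `9 < 10`. Two forms with `uv = 0` then generate each other's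
annihilators modulo `T`.

For G-quadraticity one takes a basis `e₁, e₂, …` of `V` with `eᵢ² ∈ (e₁, …, eᵢ₋₁)V` and the reverse
lexicographic order in which `e₁` is smallest. All squares of variables are then leading monomials,
and a monomial that avoids the quadratic leading monomials is squarefree. In characteristic
different from two and `codim T ≥ 4` there is a nonexceptional `x`, and a careful choice of the
vectors after `x` leaves no such monomial of degree three. If `codim T = 3` and some `x ∉ T` has `x²
= 0`, at most one cubic monomial is left, and it must be standard because `R₃ ≠ 0`. If no such `x`
exists, `R` is a trivial extension of three quadrics without squares in their ideal, and these form
a regular sequence. Conversely, a quadratic Gröbner basis of an Artinian algebra has all `Xᵢ²` among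
its leading monomials. When square-zero forms annihilate `V`, induction from the smallest variable
upwards shows that every variable annihilates `V`, so `R₂ = 0`.

Generality of the last condition is expressed by determinants of Macaulay type in degree four. -/

/-- A chain of generators `x₁, …, x_m` of the ideal `J`, lying in `V`, all of whose successive
colon ideals `(x₁, …, x_{j-1}) : x_j` belong to `F`. -/
def HasFlag {A : Type*} [CommRing A] (F : Set (Ideal A)) (V : Set A) (J : Ideal A) : Prop :=
  ∃ (m : ℕ) (x : Fin m → A), (∀ j, x j ∈ V) ∧ Ideal.span (Set.range x) = J ∧
    ∀ j, ∃ L ∈ F, ∀ r, (∃ c : Fin m → A, (∀ i, j ≤ i → c i = 0) ∧ r * x j = ∑ i, c i * x i) ↔ r ∈ L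

/-- A Koszul filtration: every nonzero member is obtained from a smaller one by adding one
generator from `V`, and the corresponding colon ideal is again a member. -/
def IsKoszulFiltration {A : Type*} [CommRing A] (V : Set A) (F : Set (Ideal A)) : Prop :=
  ∀ J ∈ F, J ≠ ⊥ → ∃ J' ∈ F, ∃ x ∈ V, J' < J ∧ J = J' ⊔ Ideal.span {x} ∧
    ∃ L ∈ F, ∀ r, r * x ∈ J' ↔ r ∈ L

/-- Generators are removed one at a time, passing each time to a strictly smaller member of the
filtration. In an Artinian ring this descent stops, and it can stop only at zero. -/
theorem IsKoszulFiltration.hasFlag {A : Type*} [CommRing A] [IsArtinianRing A] {V : Set A}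
    {F : Set (Ideal A)} (hF : IsKoszulFiltration V F) (J : Ideal A) (hJ : J ∈ F) :
    HasFlag F V J := by
  induction J using WellFoundedLT.induction with
  | ind J ih =>
    by_cases h0 : J = ⊥
    · exact ⟨0, Fin.elim0, fun j => j.elim0, by simp [h0], fun j => j.elim0⟩
    obtain ⟨J', hJ', x, hx, hlt, hJx, L, hL, hLr⟩ := hF J hJ h0
    obtain ⟨m, y, hyV, hys, hy⟩ := ih J' hlt hJ'
    refine ⟨m + 1, Fin.snoc y x, ?_, ?_, ?_⟩
    · intro j
      refine Fin.lastCases ?_ (fun i => ?_) j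
      · simpa using hx
      · simpa using hyV i
    · rw [Fin.range_snoc, Ideal.span_insert, hys, hJx, sup_comm]
    · intro j
      refine Fin.lastCases ?_ (fun i => ?_) j
      · refine ⟨L, hL, fun r => ?_⟩
        rw [← hLr, ← hys, Ideal.mem_span_range_iff_exists_fun]
        constructor
        · rintro ⟨c, hc, h⟩
          refine ⟨fun i => c i.castSucc, ?_⟩
          rw [Fin.sum_univ_castSucc] at h
          simp only [Fin.snoc_last, Fin.snoc_castSucc, hc (Fin.last m) le_rfl, zero_mul,
            add_zero] at h
          exact h.symm
        · rintro ⟨c, h⟩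
          refine ⟨Fin.snoc c 0, ?_, ?_⟩
          · intro i hi
            rw [Fin.last_le_iff.1 hi, Fin.snoc_last]
          · rw [Fin.sum_univ_castSucc]
            simp [h]
      · obtain ⟨L', hL', h'⟩ := hy i
        refine ⟨L', hL', fun r => ?_⟩
        rw [← h']
        constructor
        · rintro ⟨c, hc, h⟩
          refine ⟨fun i => c i.castSucc, fun k hk => hc _ (by simpa using hk), ?_⟩
          rw [Fin.sum_univ_castSucc] at h
          simp only [Fin.snoc_last, Fin.snoc_castSucc, hc (Fin.last m) (Fin.le_last _), zero_mul,
            add_zero] at h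
          exact h
        · rintro ⟨c, hc, h⟩
          refine ⟨Fin.snoc c 0, ?_, ?_⟩
          · intro k
            refine Fin.lastCases (fun _ => by simp) (fun k hk => ?_) k
            simpa using hc k (by simpa using hk)
          · rw [Fin.sum_univ_castSucc]
            simp [h]

/-- A submodule `U` of a free module that is stable under taking components of degree one and all
of whose successive ideals of last coordinates lie in `F`. -/
structure IsFiltered {A : Type*} [CommRing A] (F : Set (Ideal A)) (π : A → A) {b : ℕ}
    (U : Submodule A (Fin b → A)) : Prop where
  closed : ∀ v ∈ U, (fun k => π (v k)) ∈ U
  init : ∀ k, ∃ L ∈ F, ∀ r, (∃ u ∈ U, u k = r ∧ ∀ k', k < k' → u k' = 0) ↔ r ∈ L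

/-- Elimination from the last coordinate downwards, as in division by a Gröbner basis of a module.
The vectors `u k j` realise generators of the ideal of `k`-th coordinates of vectors vanishing
beyond `k`, so the last nonzero coordinate can always be cancelled. The induction variable `t`
counts the coordinates still allowed to be nonzero. -/
theorem exists_combination {A : Type*} [CommRing A] {b : ℕ} {U : Submodule A (Fin b → A)}
    {m : Fin b → ℕ} {x : (k : Fin b) → Fin (m k) → A} {u : (k : Fin b) → Fin (m k) → Fin b → A}
    (huU : ∀ k j, u k j ∈ U) (hux : ∀ k j, u k j k = x k j)
    (hu0 : ∀ k j k', k < k' → u k j k' = 0)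
    (hx : ∀ v ∈ U, ∀ k, (∀ k', k < k' → v k' = 0) → v k ∈ Ideal.span (Set.range (x k)))
    (t : ℕ) : ∀ v ∈ U, (∀ k : Fin b, t ≤ k → v k = 0) →
      ∃ c : (k : Fin b) → Fin (m k) → A, (∀ k : Fin b, t ≤ k → ∀ j, c k j = 0) ∧
        v = ∑ k, ∑ j, c k j • u k j := by
  induction t with
  | zero =>
    intro v _ h
    refine ⟨fun _ _ => 0, by simp, ?_⟩
    ext k
    simp [h k (Nat.zero_le _)]
  | succ t ih =>
    intro v hv h
    by_cases htb : t < b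
    · set k₀ : Fin b := ⟨t, htb⟩ with hk₀
      obtain ⟨c₀, hc₀⟩ := Ideal.mem_span_range_iff_exists_fun.1
        (hx v hv k₀ (fun k' hk' => h k' (by rw [Fin.lt_def] at hk'; exact hk')))
      obtain ⟨c, hc, hvc⟩ := ih (v - ∑ j, c₀ j • u k₀ j)
        (U.sub_mem hv (U.sum_mem fun j _ => U.smul_mem _ (huU _ _))) (by
          intro k hk
          rcases Nat.eq_or_lt_of_le hk with hk | hk
          · have : k = k₀ := Fin.ext hk.symm
            subst this
            simp [hux, hc₀]
          · have hk' : k₀ < k := hk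
            simp [h k hk, hu0 _ _ _ hk'])
      refine ⟨fun k j => c k j + if hk : k = k₀ then c₀ (hk ▸ j) else 0, ?_, ?_⟩
      · intro k hk j
        have : k ≠ k₀ := fun hkk => by simp [hkk, hk₀] at hk
        simp [this, hc k (by omega)]
      · rw [sub_eq_iff_eq_add] at hvc
        conv_lhs => rw [hvc]
        simp only [add_smul, Finset.sum_add_distrib]
        congr 1
        rw [Finset.sum_eq_single k₀]
        · simp
        · intro k _ hk
          simp [hk]
        · simp
    · obtain ⟨c, hc, hvc⟩ := ih v hv (fun k hk => by have := k.2; omega)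
      exact ⟨c, fun k hk => by have := k.2; omega, hvc⟩

/-- A Schreyer-type argument. The columns of the matrix are lifts of the flag generators of the
ideals of last coordinates. A syzygy whose last nonzero entry belongs to `x k j` has as that entry
an element of the colon ideal of `x k j` by the preceding generators, and such colon ideals lie in
`F`. The kernel therefore inherits the property of `U`, and the construction can be iterated. -/
theorem IsFiltered.exists_matrix {A : Type*} [CommRing A] {F : Set (Ideal A)} {V : Set A}
    {π₁ π₂ : A →+ A} (h1V : ∀ a, π₁ a ∈ V) (h1 : ∀ l ∈ V, π₁ l = l)
    (h2 : ∀ l ∈ V, ∀ a, π₂ (l * a) = l * π₁ a) (hF : ∀ J ∈ F, HasFlag F V J) {b : ℕ}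
    {U : Submodule A (Fin b → A)} (hU : IsFiltered F π₁ U) :
    ∃ (b' : ℕ) (B : Matrix (Fin b) (Fin b') A), (∀ p q, B p q ∈ V) ∧
      LinearMap.range B.mulVecLin = U ∧ IsFiltered F π₁ (LinearMap.ker B.mulVecLin) := by
  choose L hLF hL using hU.init
  choose m x hxV hxs hxc using fun k => hF _ (hLF k)
  -- Replacing a lift by its degree-one components makes all entries linear and leaves the
  -- coordinate `x k j`, already linear, unchanged.
  have hlift : ∀ k j, ∃ u ∈ U, u k = x k j ∧ (∀ k', k < k' → u k' = 0) ∧ ∀ p, u p ∈ V := by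
    intro k j
    obtain ⟨u, huU, huk, hu0⟩ := (hL k (x k j)).2 (by
      rw [← hxs k]; exact Ideal.subset_span ⟨j, rfl⟩)
    exact ⟨_, hU.closed u huU, by simp only [huk, h1 _ (hxV k j)],
      fun k' hk' => by simp only [hu0 k' hk', map_zero], fun p => h1V _⟩
  choose u huU hux hu0 huV using hlift
  have hcomb := exists_combination huU hux hu0 (fun v hv k hk => by
    rw [hxs k]; exact (hL k _).1 ⟨v, hv, rfl, hk⟩)
  -- Columns are ordered lexicographically, first by the coordinate `k`, then by the position in the
  -- flag. This order makes the ideals of last coordinates of the kernel equal to the colon ideals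
  -- of the flags.
  obtain ⟨N, ⟨e⟩⟩ : ∃ N, Nonempty (Fin N ≃o (Σₗ k : Fin b, Fin (m k))) :=
    ⟨_, ⟨Fintype.orderIsoFinOfCardEq (Σₗ k : Fin b, Fin (m k)) rfl⟩⟩
  have hval : ∀ (D : (k : Fin b) → Fin (m k) → A) k j,
      D (ofLex (e (e.symm (toLex ⟨k, j⟩)))).1 (ofLex (e (e.symm (toLex ⟨k, j⟩)))).2 = D k j :=
    fun D k j => congrArg (fun s : Σₗ k : Fin b, Fin (m k) => D (ofLex s).1 (ofLex s).2)
      (e.apply_symm_apply (toLex ⟨k, j⟩))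
  let w : (Σₗ k : Fin b, Fin (m k)) → Fin b → A := fun q => u (ofLex q).1 (ofLex q).2
  let B : Matrix (Fin b) (Fin N) A :=
    Matrix.of fun p q => w (e q) p
  have hB : ∀ c, B.mulVec c = ∑ k, ∑ j, c (e.symm (toLex ⟨k, j⟩)) • u k j := by
    intro c
    rw [Finset.sum_sigma' Finset.univ (fun _ => Finset.univ)
      (fun k j => c (e.symm (toLex ⟨k, j⟩)) • u k j)]
    ext p
    rw [Matrix.mulVec, dotProduct, Finset.sum_apply]
    refine Finset.sum_bij (fun q _ => (ofLex (e q) : Σ k : Fin b, Fin (m k))) (by simp)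
      (fun a _ a' _ h => e.injective (ofLex.injective h))
      (fun q _ => ⟨e.symm (toLex q), by simp, by simp⟩) ?_
    intro q _
    simp [B, w, mul_comm]
  have hBV : ∀ p q, B p q ∈ V := fun p q => huV _ _ _
  refine ⟨_, B, hBV, ?_, ?_, ?_⟩
  · apply le_antisymm
    · rintro _ ⟨c, rfl⟩
      rw [Matrix.mulVecLin_apply, hB]
      exact U.sum_mem fun k _ => U.sum_mem fun j _ => U.smul_mem _ (huU _ _)
    · intro v hv
      obtain ⟨c, -, hc⟩ := hcomb b v hv (fun k hk => by have := k.2; omega)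
      refine ⟨fun q => c (ofLex (e q)).1 (ofLex (e q)).2, ?_⟩
      rw [Matrix.mulVecLin_apply, hB, hc]
      simp only [hval c]
  · intro c hc
    rw [LinearMap.mem_ker, Matrix.mulVecLin_apply] at hc ⊢
    ext p
    have := congrArg π₂ (congrFun hc p)
    simpa only [Matrix.mulVec, dotProduct, map_sum, h2 _ (hBV _ _), Pi.zero_apply, map_zero]
      using this
  · intro q
    obtain ⟨⟨k, j⟩, rfl⟩ : ∃ s : Σ k : Fin b, Fin (m k), q = e.symm (toLex s) :=
      ⟨ofLex (e q), by simp⟩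
    obtain ⟨L', hL', hr⟩ := hxc k j
    refine ⟨L', hL', fun r => ?_⟩
    rw [← hr]
    constructor
    · rintro ⟨c, hc, rfl, hc0⟩
      rw [LinearMap.mem_ker, Matrix.mulVecLin_apply, hB] at hc
      have hc1 : ∀ i, j < i → c (e.symm (toLex ⟨k, i⟩)) = 0 := fun i h =>
        hc0 _ (e.symm.lt_iff_lt.2 (Sigma.Lex.right _ _ h))
      have hc2 : ∀ k', k < k' → ∀ i, c (e.symm (toLex ⟨k', i⟩)) = 0 := fun k' h i =>
        hc0 _ (e.symm.lt_iff_lt.2 (Sigma.Lex.left _ _ h))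
      have hk := congrFun hc k
      simp only [Finset.sum_apply, Pi.smul_apply, smul_eq_mul, Pi.zero_apply] at hk
      rw [Finset.sum_eq_single k] at hk
      · refine ⟨fun i => if i < j then - c (e.symm (toLex ⟨k, i⟩)) else 0, ?_, ?_⟩
        · intro i hi
          simp [not_lt.2 hi]
        · simp only [hux] at hk
          rw [← Finset.add_sum_erase _ _ (Finset.mem_univ j)] at hk ⊢
          beta_reduce
          rw [if_neg (lt_irrefl j), zero_mul, zero_add, eq_neg_of_add_eq_zero_left hk,
            ← Finset.sum_neg_distrib]
          refine Finset.sum_congr rfl fun i hi => ?_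
          rcases lt_or_gt_of_ne (Finset.ne_of_mem_erase hi) with h | h
          · simp [h]
          · simp [hc1 i h, not_lt.2 h.le]
      · intro k' _ hk'
        refine Finset.sum_eq_zero fun i _ => ?_
        rcases lt_or_gt_of_ne hk' with h | h
        · rw [hu0 _ _ _ h, mul_zero]
        · rw [hc2 _ h, zero_mul]
      · simp
    -- A relation `r x_j = ∑ c_i x_i` with earlier generators gives `r u_j - ∑ c_i u_i`, which
    -- vanishes from the coordinate `k` on. It is thus a combination of columns from earlier blocks,
    -- and subtracting that combination yields a syzygy ending in `r`.
    · rintro ⟨c, hc0, hc⟩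
      obtain ⟨c', hc'0, hc'⟩ := hcomb k (r • u k j - ∑ i, c i • u k i)
        (U.sub_mem (U.smul_mem _ (huU _ _)) (U.sum_mem fun i _ => U.smul_mem _ (huU _ _))) (by
          intro k' hk'
          rcases Nat.eq_or_lt_of_le hk' with h | h
          · have : k' = k := Fin.ext h.symm
            subst this
            simp [hux, hc]
          · have h : k < k' := h
            simp [hu0 _ _ _ h])
      let d : (k : Fin b) → Fin (m k) → A := fun k' i =>
        (if hk : k' = k then (if hk ▸ i = j then r else 0) - c (hk ▸ i) else 0) - c' k' i
      refine ⟨fun q => d (ofLex (e q)).1 (ofLex (e q)).2, ?_, ?_, ?_⟩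
      · rw [LinearMap.mem_ker, Matrix.mulVecLin_apply, hB]
        simp only [hval d]
        simp only [d, sub_smul, Finset.sum_sub_distrib]
        rw [sub_eq_zero, ← hc', Finset.sum_eq_single k]
        · simp [sub_smul, Finset.sum_sub_distrib]
        · intro k' _ hk'
          simp [hk']
        · simp
      · refine (hval d k j).trans ?_
        simp [d, hc0 j le_rfl, hc'0 k le_rfl]
      · intro q hq
        obtain ⟨⟨k', i⟩, rfl⟩ : ∃ s : Σ k : Fin b, Fin (m k), q = e.symm (toLex s) :=
          ⟨ofLex (e q), by simp⟩
        have hlt := e.symm.lt_iff_lt.1 hq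
        refine (hval d k' i).trans ?_
        simp only [d]
        rcases Sigma.lex_iff.1 hlt with h | ⟨h, h'⟩
        · have h : k < k' := h
          simp [h.ne', hc'0 k' h.le]
        · have h : k = k' := h
          subst h
          have h' : j < i := h'
          simp [h'.ne', hc0 i h'.le, hc'0 k le_rfl]

/-! ### The graded structure of a quadratic algebra -/

namespace MvPolynomial

theorem homogeneousComponent_add_mul {σ R : Type*} [CommSemiring R] {g : MvPolynomial σ R} {d : ℕ}
    (hg : g.IsHomogeneous d) (j : ℕ) (f : MvPolynomial σ R) :
    homogeneousComponent (d + j) (g * f) = g * homogeneousComponent j f := by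
  conv_lhs => rw [← sum_homogeneousComponent f, Finset.mul_sum, map_sum]
  have h : ∀ i, homogeneousComponent (d + j) (g * homogeneousComponent i f) =
      if j = i then g * homogeneousComponent i f else 0 := by
    intro i
    rw [homogeneousComponent_of_mem (hg.mul (homogeneousComponent_isHomogeneous i f))]
    simp
  simp only [h, Finset.sum_ite_eq, Finset.mem_range]
  split_ifs with hj
  · rfl
  · rw [homogeneousComponent_eq_zero _ _ (by omega), mul_zero]

theorem homogeneousComponent_mul_of_lt {σ R : Type*} [CommSemiring R] {g : MvPolynomial σ R}
    {d j : ℕ} (hg : g.IsHomogeneous d) (hj : j < d) (f : MvPolynomial σ R) :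
    homogeneousComponent j (g * f) = 0 := by
  conv_lhs => rw [← sum_homogeneousComponent f, Finset.mul_sum, map_sum]
  refine Finset.sum_eq_zero fun i _ => ?_
  rw [homogeneousComponent_of_mem (hg.mul (homogeneousComponent_isHomogeneous i f)),
    if_neg (by omega)]

theorem homogeneousComponent_mem_span {σ R : Type*} [CommRing R] {d : ℕ}
    {G : Set (MvPolynomial σ R)} (hG : ∀ g ∈ G, g.IsHomogeneous d) {f : MvPolynomial σ R}
    (hf : f ∈ Ideal.span G) (j : ℕ) : homogeneousComponent j f ∈ Ideal.span G := by
  induction hf using Submodule.closure_induction with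
  | zero => simp
  | add x y _ _ hx hy => rw [map_add]; exact add_mem hx hy
  | smul_mem a g hg =>
    rw [smul_eq_mul, mul_comm]
    by_cases hj : j < d
    · rw [homogeneousComponent_mul_of_lt (hG g hg) hj]
      exact zero_mem _
    · obtain ⟨i, rfl⟩ := Nat.exists_eq_add_of_le (not_lt.1 hj)
      rw [homogeneousComponent_add_mul (hG g hg)]
      exact Ideal.mul_mem_right _ _ (Ideal.subset_span hg)

theorem homogeneousComponent_eq_zero_of_mem_span {σ R : Type*} [CommRing R] {d j : ℕ}
    {G : Set (MvPolynomial σ R)} (hG : ∀ g ∈ G, g.IsHomogeneous d) (hj : j < d)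
    {f : MvPolynomial σ R} (hf : f ∈ Ideal.span G) : homogeneousComponent j f = 0 := by
  induction hf using Submodule.closure_induction with
  | zero => simp
  | add x y _ _ hx hy => rw [map_add, hx, hy, add_zero]
  | smul_mem a g hg => rw [smul_eq_mul, mul_comm, homogeneousComponent_mul_of_lt (hG g hg) hj]

end MvPolynomial

open MvPolynomial in
theorem IsQuadraticIdeal.homogeneousComponent_mem {K : Type*} [Field K] {n : ℕ}
    {I : Ideal (MvPolynomial (Fin n) K)} (hI : IsQuadraticIdeal I) {f : MvPolynomial (Fin n) K}
    (hf : f ∈ I) (j : ℕ) : homogeneousComponent j f ∈ I := by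
  obtain ⟨G, hG, rfl⟩ := hI
  exact homogeneousComponent_mem_span hG hf j

open MvPolynomial in
theorem IsQuadraticIdeal.homogeneousComponent_eq_zero {K : Type*} [Field K] {n : ℕ}
    {I : Ideal (MvPolynomial (Fin n) K)} (hI : IsQuadraticIdeal I) {f : MvPolynomial (Fin n) K}
    (hf : f ∈ I) {j : ℕ} (hj : j < 2) : homogeneousComponent j f = 0 := by
  obtain ⟨G, hG, rfl⟩ := hI
  exact homogeneousComponent_eq_zero_of_mem_span hG hj hf

/-- The projection of the quadratic algebra `R` onto its component of degree `j`. -/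
theorem IsQuadraticIdeal.exists_proj {K : Type*} [Field K] {n : ℕ}
    {I : Ideal (MvPolynomial (Fin n) K)} (hI : IsQuadraticIdeal I) :
    ∃ π : ℕ → (MvPolynomial (Fin n) K ⧸ I) →+ (MvPolynomial (Fin n) K ⧸ I),
      ∀ j f, π j (Ideal.Quotient.mk I f) =
        Ideal.Quotient.mk I (MvPolynomial.homogeneousComponent j f) := by
  refine ⟨fun j => QuotientAddGroup.map I.toAddSubgroup I.toAddSubgroup
    (MvPolynomial.homogeneousComponent j).toAddMonoidHom
    (fun f hf => hI.homogeneousComponent_mem hf j), fun j f => rfl⟩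

/-! ### Linear forms of `R` and their products -/

/-- The linear form with coefficients `v`. -/
noncomputable def linPoly {K : Type*} [Field K] {σ : Type*} [Fintype σ] :
    (σ → K) →ₗ[K] MvPolynomial σ K :=
  Fintype.linearCombination K MvPolynomial.X

theorem linPoly_apply {K : Type*} [Field K] {σ : Type*} [Fintype σ] (v : σ → K) :
    linPoly v = ∑ i, MvPolynomial.C (v i) * MvPolynomial.X i := by
  simp [linPoly, Fintype.linearCombination_apply, MvPolynomial.smul_eq_C_mul]

theorem linPoly_isHomogeneous {K : Type*} [Field K] {σ : Type*} [Fintype σ] (v : σ → K) :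
    (linPoly v).IsHomogeneous 1 := by
  rw [linPoly_apply]
  exact MvPolynomial.IsHomogeneous.sum _ _ _ fun i _ => MvPolynomial.isHomogeneous_C_mul_X _ _

theorem range_linPoly {K : Type*} [Field K] {σ : Type*} [Fintype σ] :
    LinearMap.range (linPoly (K := K) (σ := σ)) = MvPolynomial.homogeneousSubmodule σ K 1 := by
  rw [linPoly, Fintype.range_linearCombination, MvPolynomial.homogeneousSubmodule_one_eq_span_X]

theorem linPoly_injective {K : Type*} [Field K] {σ : Type*} [Fintype σ] :
    Function.Injective (linPoly (K := K) (σ := σ)) := by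
  classical
  intro v w h
  ext i
  have := congrArg (MvPolynomial.coeff (Finsupp.single i 1)) h
  simpa [linPoly_apply, MvPolynomial.coeff_sum, MvPolynomial.coeff_C_mul, MvPolynomial.coeff_X,
    Finsupp.single_left_inj] using this

theorem linPoly_single {K : Type*} [Field K] {σ : Type*} [Fintype σ] [DecidableEq σ] (i : σ) :
    linPoly (Pi.single i (1 : K)) = MvPolynomial.X i := by
  simp [linPoly]

theorem quotient_smul_def {K : Type*} [Field K] {σ : Type*} {I : Ideal (MvPolynomial σ K)} (c : K)
    (r : MvPolynomial σ K ⧸ I) : c • r = algebraMap K (MvPolynomial σ K ⧸ I) c * r :=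
  Algebra.smul_def c r

/-- The class in `R` of the linear form with coefficients `v`. -/
noncomputable def linForm {K : Type*} [Field K] {n : ℕ} (I : Ideal (MvPolynomial (Fin n) K)) :
    (Fin n → K) →ₗ[K] MvPolynomial (Fin n) K ⧸ I :=
  (Ideal.Quotient.mkₐ K I).toLinearMap ∘ₗ linPoly

theorem linForm_apply {K : Type*} [Field K] {n : ℕ} (I : Ideal (MvPolynomial (Fin n) K))
    (v : Fin n → K) : linForm I v = Ideal.Quotient.mk I (linPoly v) := rfl

theorem range_linForm {K : Type*} [Field K] {n : ℕ} (I : Ideal (MvPolynomial (Fin n) K)) :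
    LinearMap.range (linForm I) = gradedPiece I 1 := by
  rw [linForm, LinearMap.range_comp, range_linPoly, gradedPiece]

theorem linForm_mem {K : Type*} [Field K] {n : ℕ} (I : Ideal (MvPolynomial (Fin n) K))
    (v : Fin n → K) : linForm I v ∈ gradedPiece I 1 := by
  rw [← range_linForm]; exact ⟨v, rfl⟩

theorem linForm_injective {K : Type*} [Field K] {n : ℕ} {I : Ideal (MvPolynomial (Fin n) K)}
    (hI : IsQuadraticIdeal I) : Function.Injective (linForm I) := by
  rw [injective_iff_map_eq_zero]
  intro v hv
  rw [linForm_apply, Ideal.Quotient.eq_zero_iff_mem] at hv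
  have := hI.homogeneousComponent_eq_zero hv one_lt_two
  rw [MvPolynomial.homogeneousComponent_eq_self (linPoly_isHomogeneous v)] at this
  exact linPoly_injective (by simpa using this)

/-- Multiplication of linear forms, with values in `R₂`. -/
noncomputable def linMul {K : Type*} [Field K] {n : ℕ} (I : Ideal (MvPolynomial (Fin n) K)) :
    (Fin n → K) →ₗ[K] (Fin n → K) →ₗ[K] gradedPiece I 2 :=
  LinearMap.mk₂ K (fun u v => ⟨linForm I u * linForm I v, ⟨linPoly u * linPoly v,
      (linPoly_isHomogeneous u).mul (linPoly_isHomogeneous v), by simp [linForm_apply]⟩⟩)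
    (fun _ _ _ => Subtype.ext (by simp [add_mul])) (fun _ _ _ => Subtype.ext (by simp
      [smul_mul_assoc]))
    (fun _ _ _ => Subtype.ext (by simp [mul_add]))
    (fun _ _ _ => Subtype.ext (by simp [mul_smul_comm]))

theorem coe_linMul {K : Type*} [Field K] {n : ℕ} (I : Ideal (MvPolynomial (Fin n) K))
    (u v : Fin n → K) : (linMul I u v : MvPolynomial (Fin n) K ⧸ I) = linForm I u * linForm I v :=
  rfl

theorem linMul_comm {K : Type*} [Field K] {n : ℕ} (I : Ideal (MvPolynomial (Fin n) K))
    (u v : Fin n → K) : linMul I u v = linMul I v u :=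
  Subtype.ext (by simp [coe_linMul, mul_comm])

theorem gradedPiece_mul_mem {K : Type*} [Field K] {n : ℕ} {I : Ideal (MvPolynomial (Fin n) K)}
    {i j : ℕ} {a b : MvPolynomial (Fin n) K ⧸ I} (ha : a ∈ gradedPiece I i)
    (hb : b ∈ gradedPiece I j) : a * b ∈ gradedPiece I (i + j) := by
  obtain ⟨f, hf, rfl⟩ := ha
  obtain ⟨g, hg, rfl⟩ := hb
  exact ⟨f * g, MvPolynomial.IsHomogeneous.mul hf hg, by simp⟩

/-- Every form of degree `i + j` is a combination of products of forms of degrees `i` and `j`. -/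
theorem gradedPiece_add {K : Type*} [Field K] {n : ℕ} (I : Ideal (MvPolynomial (Fin n) K))
    (i j : ℕ) : gradedPiece I (i + j) = gradedPiece I i * gradedPiece I j := by
  simp only [gradedPiece]
  have h : ∀ k, MvPolynomial.homogeneousSubmodule (Fin n) K k =
      MvPolynomial.homogeneousSubmodule (Fin n) K 1 ^ k := fun k =>
    (MvPolynomial.homogeneousSubmodule_one_pow _ k).symm
  rw [← Submodule.map_mul, h (i + j), pow_add, ← h i, ← h j]

theorem map₂_linMul_top {K : Type*} [Field K] {n : ℕ} (I : Ideal (MvPolynomial (Fin n) K)) :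
    Submodule.map₂ (linMul I) ⊤ ⊤ = ⊤ := by
  rw [eq_top_iff]
  rintro ⟨w, hw⟩ -
  have hw' := hw
  rw [show 2 = 1 + 1 from rfl, gradedPiece_add] at hw'
  suffices h : ∃ w' ∈ Submodule.map₂ (linMul I) ⊤ ⊤, (w' : MvPolynomial (Fin n) K ⧸ I) = w by
    obtain ⟨w', h1, h2⟩ := h
    rwa [show (⟨w, hw⟩ : gradedPiece I 2) = w' from Subtype.ext h2.symm]
  clear hw
  induction hw' using Submodule.mul_induction_on' with
  | mem_mul_mem a ha b hb =>
    rw [← range_linForm] at ha hb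
    obtain ⟨u, rfl⟩ := ha
    obtain ⟨v, rfl⟩ := hb
    exact ⟨linMul I u v, Submodule.apply_mem_map₂ _ trivial trivial, rfl⟩
  | add a _ b _ ha hb =>
    obtain ⟨a', h1, rfl⟩ := ha
    obtain ⟨b', h2, rfl⟩ := hb
    exact ⟨a' + b', add_mem h1 h2, rfl⟩

/-- The powers of the irrelevant ideal stabilise. A form of degree `j` is then congruent modulo `I`
to a polynomial without terms of degree at most `j`, and taking components of degree `j` shows that
the form lies in `I`. -/
theorem IsQuadraticIdeal.exists_homogeneous_mem {K : Type*} [Field K] {n : ℕ}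
    {I : Ideal (MvPolynomial (Fin n) K)} (hI : IsQuadraticIdeal I)
    [IsArtinianRing (MvPolynomial (Fin n) K ⧸ I)] :
    ∃ N, ∀ j, N ≤ j → ∀ f : MvPolynomial (Fin n) K, f.IsHomogeneous j → f ∈ I := by
  set M := (MvPolynomial.idealOfVars (Fin n) K).map (Ideal.Quotient.mk I)
  obtain ⟨N, hN⟩ := IsArtinian.monotone_stabilizes (R := MvPolynomial (Fin n) K ⧸ I)
    (M := MvPolynomial (Fin n) K ⧸ I)
    ⟨fun j => OrderDual.toDual (M ^ j), fun i j hij => Ideal.pow_le_pow_right hij⟩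
  refine ⟨N, fun j hj f hf => ?_⟩
  have h1 : f ∈ MvPolynomial.idealOfVars (Fin n) K ^ j := by
    rw [MvPolynomial.mem_pow_idealOfVars_iff']
    intro d hd
    exact hf.coeff_eq_zero hd.ne
  have h2 : Ideal.Quotient.mk I f ∈ M ^ j := by
    rw [← Ideal.map_pow]
    exact Ideal.mem_map_of_mem _ h1
  have h3 : M ^ j = M ^ (j + 1) := ((hN j hj).symm.trans (hN (j + 1) (by omega)) : _)
  rw [h3, ← Ideal.map_pow, Ideal.mem_map_iff_of_surjective _ Ideal.Quotient.mk_surjective] at h2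
  obtain ⟨g, hg, hgf⟩ := h2
  rw [Ideal.Quotient.eq] at hgf
  have h4 := hI.homogeneousComponent_mem hgf j
  rw [map_sub, MvPolynomial.homogeneousComponent_eq_self hf,
    MvPolynomial.homogeneousComponent_eq_zero', zero_sub, neg_mem_iff] at h4
  · exact h4
  · intro d hd hdj
    rw [MvPolynomial.mem_pow_idealOfVars_iff'] at hg
    exact MvPolynomial.mem_support_iff.1 hd (hg d (by omega))

/-- Otherwise a nonzero functional `w` on `R₂` kills `U·R₁`. With `U = ker φ`, this forces `w(uv) =
c φ(u) φ(v)` with `c ≠ 0`, so on quadrics `w` is `c` times evaluation at the point `p` corresponding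
to `φ`. All quadrics of `I` vanish at `p ≠ 0`, although `I` contains a power of each variable. -/
theorem map₂_linMul_eq_top {K : Type*} [Field K] {n : ℕ} {I : Ideal (MvPolynomial (Fin n) K)}
    (hI : IsQuadraticIdeal I) [IsArtinianRing (MvPolynomial (Fin n) K ⧸ I)]
    {U : Submodule K (Fin n → K)} (hU : Module.finrank K (Fin n → K) ≤ Module.finrank K U + 1) :
    Submodule.map₂ (linMul I) U ⊤ = ⊤ := by
  by_contra hne
  have hUtop : U ≠ ⊤ := by
    rintro rfl
    exact hne (map₂_linMul_top I)
  obtain ⟨w, hw0, hw⟩ := Submodule.exists_le_ker_of_lt_top _ (lt_top_iff_ne_top.2 hne)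
  obtain ⟨φ, hφ0, hφ⟩ := Submodule.exists_le_ker_of_lt_top _ (lt_top_iff_ne_top.2 hUtop)
  have hker : U = LinearMap.ker φ := by
    refine Submodule.eq_of_le_of_finrank_le hφ ?_
    have h1 := LinearMap.finrank_range_add_finrank_ker φ
    have h2 : LinearMap.range φ = ⊤ := LinearMap.range_eq_top.2 (LinearMap.surjective_of_ne_zero
      hφ0)
    rw [h2, finrank_top, Module.finrank_self] at h1
    omega
  obtain ⟨e, he⟩ := LinearMap.surjective_of_ne_zero hφ0 1
  have hwU : ∀ u ∈ U, ∀ v, w (linMul I u v) = 0 := fun u hu v =>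
    hw (Submodule.apply_mem_map₂ _ hu trivial)
  -- Decompose `u` and `v` along `V = U + K e`, where `φ e = 1`. All terms involving `U` disappear.
  have hform : ∀ u v, w (linMul I u v) = w (linMul I e e) * (φ u * φ v) := by
    intro u v
    have hd : ∀ v, v - φ v • e ∈ U := by
      intro v
      rw [hker, LinearMap.mem_ker, map_sub, map_smul, he]
      simp
    have h1 := hwU _ (hd u) v
    have h2 := hwU _ (hd v) e
    rw [linMul_comm] at h2
    simp only [map_sub, map_smul, LinearMap.sub_apply, LinearMap.smul_apply, smul_eq_mul] at h1 h2
    linear_combination h1 + φ u * h2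
  have hc : w (linMul I e e) ≠ 0 := by
    intro hc
    apply hw0
    have : (⊤ : Submodule K (gradedPiece I 2)) ≤ LinearMap.ker w := by
      rw [← map₂_linMul_top I, Submodule.map₂_le]
      intro u _ v _
      rw [LinearMap.mem_ker, hform, hc, zero_mul]
    ext x
    exact this trivial
  -- The point at which every linear form takes the value prescribed by `φ`.
  let p : Fin n → K := fun i => φ (Pi.single i 1)
  have hp : ∀ v, MvPolynomial.eval p (linPoly v) = φ v := by
    intro v
    rw [linPoly_apply]
    conv_rhs => rw [pi_eq_sum_univ' v]
    simp [p, map_sum]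
  have hev : ∀ f : MvPolynomial (Fin n) K, f ∈ MvPolynomial.homogeneousSubmodule (Fin n) K 2 →
      ∃ hf : Ideal.Quotient.mk I f ∈ gradedPiece I 2,
        w ⟨Ideal.Quotient.mk I f, hf⟩ = w (linMul I e e) * MvPolynomial.eval p f := by
    intro f hf
    rw [← MvPolynomial.homogeneousSubmodule_one_pow, pow_two] at hf
    induction hf using Submodule.mul_induction_on' with
    | mem_mul_mem a ha b hb =>
      rw [← range_linPoly] at ha hb
      obtain ⟨u, rfl⟩ := ha
      obtain ⟨v, rfl⟩ := hb
      refine ⟨(linMul I u v).2, ?_⟩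
      rw [map_mul (MvPolynomial.eval p), hp, hp, ← hform]
      rfl
    | add a _ b _ ha hb =>
      obtain ⟨h1, h1'⟩ := ha
      obtain ⟨h2, h2'⟩ := hb
      refine ⟨by rw [map_add]; exact add_mem h1 h2, ?_⟩
      rw [map_add (MvPolynomial.eval p), mul_add, ← h1', ← h2', ← map_add w]
      exact congrArg w (Subtype.ext (map_add _ _ _))
  have hIp : I ≤ RingHom.ker (MvPolynomial.eval p) := by
    obtain ⟨G, hG, hIG⟩ := hI
    rw [hIG, Ideal.span_le]
    intro g hg
    obtain ⟨h1, h2⟩ := hev g (hG g hg)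
    have h3 : (⟨Ideal.Quotient.mk I g, h1⟩ : gradedPiece I 2) = 0 := by
      refine Subtype.ext (Ideal.Quotient.eq_zero_iff_mem.2 ?_)
      rw [hIG]
      exact Ideal.subset_span hg
    rw [h3, map_zero, eq_comm, mul_eq_zero] at h2
    exact h2.resolve_left hc
  obtain ⟨N, hN⟩ := hI.exists_homogeneous_mem
  obtain ⟨i, hi⟩ : ∃ i, p i ≠ 0 := by
    by_contra! h
    apply hφ0
    ext i
    simpa [p] using h i
  have := hIp (hN N le_rfl (MvPolynomial.X i ^ N) (by
    simpa using (MvPolynomial.isHomogeneous_X K i).pow N))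
  rw [RingHom.mem_ker, map_pow, MvPolynomial.eval_X] at this
  exact hi (eq_zero_of_pow_eq_zero this)

/-! ### Ideals generated by linear forms and their colon ideals -/

/-- The ideal of `R` generated by a space of linear forms. -/
noncomputable def linIdeal {K : Type*} [Field K] {n : ℕ} (I : Ideal (MvPolynomial (Fin n) K))
    (U : Submodule K (Fin n → K)) : Ideal (MvPolynomial (Fin n) K ⧸ I) :=
  Ideal.span (linForm I '' U)

theorem linIdeal_mono {K : Type*} [Field K] {n : ℕ} (I : Ideal (MvPolynomial (Fin n) K))
    {U U' : Submodule K (Fin n → K)} (h : U ≤ U') : linIdeal I U ≤ linIdeal I U' :=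
  Ideal.span_mono (Set.image_mono h)

theorem linForm_mem_linIdeal {K : Type*} [Field K] {n : ℕ} {I : Ideal (MvPolynomial (Fin n) K)}
    {U : Submodule K (Fin n → K)} {u : Fin n → K} (hu : u ∈ U) : linForm I u ∈ linIdeal I U :=
  Ideal.subset_span ⟨u, hu, rfl⟩

theorem linIdeal_bot {K : Type*} [Field K] {n : ℕ} (I : Ideal (MvPolynomial (Fin n) K)) :
    linIdeal I ⊥ = ⊥ := by
  simp [linIdeal]

theorem linIdeal_sup {K : Type*} [Field K] {n : ℕ} (I : Ideal (MvPolynomial (Fin n) K))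
    (U U' : Submodule K (Fin n → K)) : linIdeal I (U ⊔ U') = linIdeal I U ⊔ linIdeal I U' := by
  apply le_antisymm
  · rw [linIdeal, Ideal.span_le]
    rintro _ ⟨v, hv, rfl⟩
    obtain ⟨a, ha, b, hb, rfl⟩ := Submodule.mem_sup.1 hv
    rw [map_add]
    exact add_mem (Ideal.mem_sup_left (linForm_mem_linIdeal ha))
      (Ideal.mem_sup_right (linForm_mem_linIdeal hb))
  · exact sup_le (linIdeal_mono I le_sup_left) (linIdeal_mono I le_sup_right)

theorem linIdeal_span_singleton {K : Type*} [Field K] {n : ℕ} (I : Ideal (MvPolynomial (Fin n) K))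
    (x : Fin n → K) : linIdeal I (K ∙ x) = Ideal.span {linForm I x} := by
  apply le_antisymm
  · rw [linIdeal, Ideal.span_le]
    rintro _ ⟨v, hv, rfl⟩
    obtain ⟨c, rfl⟩ := Submodule.mem_span_singleton.1 hv
    rw [map_smul, quotient_smul_def]
    exact Ideal.mul_mem_left _ _ (Ideal.subset_span rfl)
  · rw [Ideal.span_singleton_le_iff_mem]
    exact linForm_mem_linIdeal (Submodule.mem_span_singleton_self x)

theorem linIdeal_top {K : Type*} [Field K] {n : ℕ} (I : Ideal (MvPolynomial (Fin n) K)) :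
    linIdeal I ⊤ = irrelevantIdeal I := by
  apply le_antisymm
  · rw [linIdeal, Ideal.span_le]
    rintro _ ⟨v, -, rfl⟩
    rw [linForm_apply, linPoly_apply, map_sum]
    refine sum_mem fun i _ => ?_
    rw [map_mul]
    exact Ideal.mul_mem_left _ _ (Ideal.subset_span ⟨i, rfl⟩)
  · rw [irrelevantIdeal, Ideal.span_le]
    rintro _ ⟨i, rfl⟩
    simp only [SetLike.mem_coe]
    rw [← linPoly_single, ← linForm_apply]
    exact linForm_mem_linIdeal trivial

/-- The projections of the quadratic algebra `R` onto its components. -/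
structure IsGradedProj {K : Type*} [Field K] {n : ℕ} (I : Ideal (MvPolynomial (Fin n) K))
    (π : ℕ → (MvPolynomial (Fin n) K ⧸ I) →+ (MvPolynomial (Fin n) K ⧸ I)) : Prop where
  mem : ∀ j r, π j r ∈ gradedPiece I j
  of_mem : ∀ j, ∀ r ∈ gradedPiece I j, π j r = r
  of_mem_ne : ∀ i j, ∀ r ∈ gradedPiece I j, i ≠ j → π i r = 0
  zero_linForm_mul : ∀ v r, π 0 (linForm I v * r) = 0
  succ_linForm_mul : ∀ j v r, π (j + 1) (linForm I v * r) = linForm I v * π j r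
  sum : ∀ r, ∃ N, r = ∑ j ∈ Finset.range N, π j r

theorem IsQuadraticIdeal.exists_isGradedProj {K : Type*} [Field K] {n : ℕ}
    {I : Ideal (MvPolynomial (Fin n) K)} (hI : IsQuadraticIdeal I) : ∃ π, IsGradedProj I π := by
  obtain ⟨π, hπ⟩ := hI.exists_proj
  refine ⟨π, ?_, ?_, ?_, ?_, ?_, ?_⟩
  · intro j r
    obtain ⟨f, rfl⟩ := Ideal.Quotient.mk_surjective r
    exact hπ j f ▸ ⟨_, MvPolynomial.homogeneousComponent_isHomogeneous j f, rfl⟩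
  · rintro j _ ⟨f, hf, rfl⟩
    exact (hπ j f).trans (congrArg _ (MvPolynomial.homogeneousComponent_eq_self hf))
  · rintro i j _ ⟨f, hf, rfl⟩ hij
    refine (hπ i f).trans ?_
    rw [MvPolynomial.homogeneousComponent_of_mem hf, if_neg hij, map_zero]
  · intro v r
    obtain ⟨f, rfl⟩ := Ideal.Quotient.mk_surjective r
    rw [linForm_apply, ← map_mul, hπ,
      MvPolynomial.homogeneousComponent_mul_of_lt (linPoly_isHomogeneous v) one_pos, map_zero]
  · intro j v r
    obtain ⟨f, rfl⟩ := Ideal.Quotient.mk_surjective r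
    rw [linForm_apply, ← map_mul, hπ, hπ, add_comm j 1,
      MvPolynomial.homogeneousComponent_add_mul (linPoly_isHomogeneous v), map_mul]
  · intro r
    obtain ⟨f, rfl⟩ := Ideal.Quotient.mk_surjective r
    refine ⟨f.totalDegree + 1, ?_⟩
    simp only [hπ]
    rw [← map_sum, MvPolynomial.sum_homogeneousComponent]

namespace IsGradedProj

variable {K : Type*} [Field K] {n : ℕ} {I : Ideal (MvPolynomial (Fin n) K)}
  {π : ℕ → (MvPolynomial (Fin n) K ⧸ I) →+ (MvPolynomial (Fin n) K ⧸ I)}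

theorem zero_of_mem_linIdeal (hπ : IsGradedProj I π) {U : Submodule K (Fin n → K)}
    {r : MvPolynomial (Fin n) K ⧸ I} (hr : r ∈ linIdeal I U) : π 0 r = 0 := by
  induction hr using Submodule.closure_induction with
  | zero => simp
  | add x y _ _ hx hy => rw [map_add, hx, hy, add_zero]
  | smul_mem a g hg =>
    obtain ⟨v, -, rfl⟩ := hg
    rw [smul_eq_mul, mul_comm, hπ.zero_linForm_mul]

theorem exists_algebraMap (hπ : IsGradedProj I π) (r : MvPolynomial (Fin n) K ⧸ I) :
    ∃ c : K, π 0 r = algebraMap K _ c := by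
  have h := hπ.mem 0 r
  rw [gradedPiece, MvPolynomial.homogeneousSubmodule_zero] at h
  obtain ⟨f, hf, h⟩ := h
  obtain ⟨c, rfl⟩ := Submodule.mem_one.1 hf
  exact ⟨c, h.symm⟩

theorem one_of_mem_linIdeal (hπ : IsGradedProj I π) {U : Submodule K (Fin n → K)}
    {r : MvPolynomial (Fin n) K ⧸ I} (hr : r ∈ linIdeal I U) : ∃ u ∈ U, π 1 r = linForm I u := by
  induction hr using Submodule.closure_induction with
  | zero => exact ⟨0, zero_mem _, by simp⟩
  | add x y _ _ hx hy =>
    obtain ⟨u, hu, hux⟩ := hx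
    obtain ⟨v, hv, hvy⟩ := hy
    exact ⟨u + v, add_mem hu hv, by simp [hux, hvy]⟩
  | smul_mem a g hg =>
    obtain ⟨v, hv, rfl⟩ := hg
    obtain ⟨c, hc⟩ := hπ.exists_algebraMap a
    refine ⟨c • v, U.smul_mem c hv, ?_⟩
    rw [smul_eq_mul, mul_comm, hπ.succ_linForm_mul 0, hc, map_smul, quotient_smul_def, mul_comm]

theorem exists_linForm (hπ : IsGradedProj I π) (r : MvPolynomial (Fin n) K ⧸ I) :
    ∃ v, π 1 r = linForm I v := by
  have h := hπ.mem 1 r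
  rw [← range_linForm] at h
  obtain ⟨v, hv⟩ := h
  exact ⟨v, hv.symm⟩

theorem two_of_mem_linIdeal (hπ : IsGradedProj I π) {U : Submodule K (Fin n → K)}
    {r : MvPolynomial (Fin n) K ⧸ I} (hr : r ∈ linIdeal I U) :
    ∃ w ∈ Submodule.map₂ (linMul I) U ⊤, π 2 r = w := by
  induction hr using Submodule.closure_induction with
  | zero => exact ⟨0, zero_mem _, by simp⟩
  | add x y _ _ hx hy =>
    obtain ⟨u, hu, hux⟩ := hx
    obtain ⟨v, hv, hvy⟩ := hy
    exact ⟨u + v, add_mem hu hv, by simp [hux, hvy]⟩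
  | smul_mem a g hg =>
    obtain ⟨v, hv, rfl⟩ := hg
    obtain ⟨u, hu⟩ := hπ.exists_linForm a
    refine ⟨linMul I v u, Submodule.apply_mem_map₂ _ hv trivial, ?_⟩
    rw [smul_eq_mul, mul_comm, hπ.succ_linForm_mul 1, hu, coe_linMul]

theorem mem_linIdeal_of_forall (hπ : IsGradedProj I π) {U : Submodule K (Fin n → K)}
    {r : MvPolynomial (Fin n) K ⧸ I} (h : ∀ j, π j r ∈ linIdeal I U) : r ∈ linIdeal I U := by
  obtain ⟨N, hN⟩ := hπ.sum r
  rw [hN]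
  exact sum_mem fun j _ => h j

theorem two_le_mem_linIdeal {U : Submodule K (Fin n → K)}
    (hU : Submodule.map₂ (linMul I) U ⊤ = ⊤) {j : ℕ} (hj : 2 ≤ j)
    {r : MvPolynomial (Fin n) K ⧸ I} (hr : r ∈ gradedPiece I j) : r ∈ linIdeal I U := by
  obtain ⟨i, rfl⟩ := Nat.exists_eq_add_of_le hj
  rw [gradedPiece_add] at hr
  induction hr using Submodule.mul_induction_on' with
  | mem_mul_mem a ha b _ =>
    refine Ideal.mul_mem_right _ _ ?_
    have h : (⟨a, ha⟩ : gradedPiece I 2) ∈ Submodule.map₂ (linMul I) U ⊤ := hU ▸ trivial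
    have h2 : Submodule.map₂ (linMul I) U ⊤ ≤
        ((linIdeal I U).restrictScalars K).comap (gradedPiece I 2).subtype := by
      rw [Submodule.map₂_le]
      intro u hu v _
      exact Ideal.mul_mem_right _ _ (linForm_mem_linIdeal hu)
    exact h2 h
  | add a _ b _ ha hb => exact add_mem ha hb

/-- Colon ideals of linear forms are computed in degree one when the result is large enough. -/
theorem mul_mem_linIdeal_iff (hπ : IsGradedProj I π) (hI : IsQuadraticIdeal I)
    {U L : Submodule K (Fin n → K)} {x : Fin n → K} (hx : x ∉ U)
    (hL : L = (Submodule.map₂ (linMul I) U ⊤).comap (linMul I x))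
    (hLtop : Submodule.map₂ (linMul I) L ⊤ = ⊤) (r : MvPolynomial (Fin n) K ⧸ I) :
    r * linForm I x ∈ linIdeal I U ↔ r ∈ linIdeal I L := by
  constructor
  · intro h
    rw [mul_comm] at h
    refine hπ.mem_linIdeal_of_forall fun j => ?_
    -- In degree zero a nonzero scalar would force `x ∈ U`. Degree one is the definition of `L`.
    -- From degree two on, the ideal generated by `L` contains everything.
    match j with
    | 0 =>
      obtain ⟨c, hc⟩ := hπ.exists_algebraMap r
      obtain ⟨u, hu, hu'⟩ := hπ.one_of_mem_linIdeal h
      rw [hπ.succ_linForm_mul 0, hc, mul_comm, ← quotient_smul_def, ← map_smul] at hu'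
      have := linForm_injective hI hu'
      by_cases hc0 : c = 0
      · rw [hc, hc0, map_zero]
        exact zero_mem _
      · refine absurd ?_ hx
        rwa [← Submodule.smul_mem_iff U hc0, this]
    | 1 =>
      obtain ⟨v, hv⟩ := hπ.exists_linForm r
      obtain ⟨w, hw, hw'⟩ := hπ.two_of_mem_linIdeal h
      rw [hπ.succ_linForm_mul 1, hv] at hw'
      rw [hv]
      refine linForm_mem_linIdeal ?_
      rw [hL, Submodule.mem_comap]
      convert hw
      exact Subtype.ext hw'
    | j + 2 => exact two_le_mem_linIdeal hLtop (by omega) (hπ.mem _ _)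
  · intro h
    induction h using Submodule.closure_induction with
    | zero => simp
    | add a b _ _ ha hb => rw [add_mul]; exact add_mem ha hb
    | smul_mem a g hg =>
      obtain ⟨v, hv, rfl⟩ := hg
      rw [smul_eq_mul, mul_assoc]
      refine Ideal.mul_mem_left _ _ ?_
      rw [hL] at hv
      have h2 : Submodule.map₂ (linMul I) U ⊤ ≤
          ((linIdeal I U).restrictScalars K).comap (gradedPiece I 2).subtype := by
        rw [Submodule.map₂_le]
        intro u hu v _
        exact Ideal.mul_mem_right _ _ (linForm_mem_linIdeal hu)
      rw [mul_comm]
      exact h2 hv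

end IsGradedProj

/-! ### Linear resolutions -/

/-- A submodule of a finite free `R`-module has a linear resolution. -/
def HasLinearResolution {K : Type*} [Field K] {n : ℕ} (I : Ideal (MvPolynomial (Fin n) K)) {b : ℕ}
    (U : Submodule (MvPolynomial (Fin n) K ⧸ I) (Fin b → MvPolynomial (Fin n) K ⧸ I)) : Prop :=
  ∃ S : Set (Σ b, Submodule (MvPolynomial (Fin n) K ⧸ I) (Fin b → MvPolynomial (Fin n) K ⧸ I)),
    ⟨b, U⟩ ∈ S ∧ ∀ s ∈ S, ∃ s' ∈ S, ∃ B : Matrix (Fin s.1) (Fin s'.1) (MvPolynomial (Fin n) K ⧸ I),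
      (∀ p q, B p q ∈ gradedPiece I 1) ∧ LinearMap.range B.mulVecLin = s.2 ∧
        LinearMap.ker B.mulVecLin = s'.2

/-- The set `S` is a coinductive certificate: it is closed under passing to syzygies, so the same
`S` also certifies the kernel. -/
theorem HasLinearResolution.exists_matrix {K : Type*} [Field K] {n : ℕ}
    {I : Ideal (MvPolynomial (Fin n) K)} {b : ℕ}
    {U : Submodule (MvPolynomial (Fin n) K ⧸ I) (Fin b → MvPolynomial (Fin n) K ⧸ I)}
    (h : HasLinearResolution I U) :
    ∃ (c : ℕ) (D : Matrix (Fin b) (Fin c) (MvPolynomial (Fin n) K ⧸ I)),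
      (∀ p q, D p q ∈ gradedPiece I 1) ∧ LinearMap.range D.mulVecLin = U ∧
        HasLinearResolution I (LinearMap.ker D.mulVecLin) := by
  obtain ⟨S, hS, step⟩ := h
  obtain ⟨⟨c, U'⟩, hs', D, h1, h2, h3⟩ := step _ hS
  refine ⟨c, D, h1, h2, S, ?_, step⟩
  rwa [h3]

theorem HasLinearResolution.of_matrix {K : Type*} [Field K] {n : ℕ}
    {I : Ideal (MvPolynomial (Fin n) K)} {b c : ℕ}
    {U : Submodule (MvPolynomial (Fin n) K ⧸ I) (Fin b → MvPolynomial (Fin n) K ⧸ I)}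
    {D : Matrix (Fin b) (Fin c) (MvPolynomial (Fin n) K ⧸ I)}
    (h1 : ∀ p q, D p q ∈ gradedPiece I 1) (h2 : LinearMap.range D.mulVecLin = U)
    (h : HasLinearResolution I (LinearMap.ker D.mulVecLin)) : HasLinearResolution I U := by
  obtain ⟨S, hS, step⟩ := h
  refine ⟨insert ⟨b, U⟩ S, Or.inl rfl, ?_⟩
  rintro _ (rfl | hs)
  · exact ⟨_, Or.inr hS, D, h1, h2, rfl⟩
  · obtain ⟨s', hs', h⟩ := step _ hs
    exact ⟨s', Or.inr hs', h⟩

theorem gradedPiece_one_le_irrelevantIdeal {K : Type*} [Field K] {n : ℕ}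
    {I : Ideal (MvPolynomial (Fin n) K)} {r : MvPolynomial (Fin n) K ⧸ I}
    (hr : r ∈ gradedPiece I 1) : r ∈ irrelevantIdeal I := by
  rw [← range_linForm] at hr
  obtain ⟨v, rfl⟩ := hr
  rw [← linIdeal_top]
  exact linForm_mem_linIdeal trivial

/-- A successor is chosen for every member of the certificate, and the choice is iterated from the
irrelevant ideal. The kernel of each matrix is the range of the next, so the matrices fit into an
exact complex. -/
theorem isKoszul_of_hasLinearResolution {K : Type*} [Field K] {n : ℕ}
    {I : Ideal (MvPolynomial (Fin n) K)}
    (h : HasLinearResolution I (Submodule.pi Set.univ fun _ : Fin 1 => irrelevantIdeal I)) :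
    IsKoszul I := by
  obtain ⟨S, hS, step⟩ := h
  have step' : ∀ s : S, ∃ (s' : S)
      (B : Matrix (Fin s.1.1) (Fin s'.1.1) (MvPolynomial (Fin n) K ⧸ I)),
      (∀ p q, B p q ∈ gradedPiece I 1) ∧ LinearMap.range B.mulVecLin = s.1.2 ∧
          LinearMap.ker B.mulVecLin = s'.1.2 := by
    rintro ⟨s, hs⟩
    obtain ⟨s', hs', B, hB⟩ := step s hs
    exact ⟨⟨s', hs'⟩, B, hB⟩
  choose nxt B hBV hBr hBk using step'
  let s : ℕ → S := fun i => Nat.rec ⟨_, hS⟩ (fun _ t => nxt t) i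
  refine ⟨fun i => (s i).1.1, fun i _ => i, fun i => B (s i), ⟨rfl, fun _ => rfl, ?_, ?_, ?_, ?_⟩,
    fun _ _ => rfl⟩
  · intro i p q
    exact Or.inr ⟨1, rfl, hBV _ p q⟩
  · intro i p q
    exact gradedPiece_one_le_irrelevantIdeal (hBV (s i) p q)
  · intro v
    rw [hBr (s 0)]
    exact ⟨fun h p => h p trivial, fun h p _ => h p⟩
  · intro i
    rw [hBr (s (i + 1)), hBk (s i)]

theorem IsKoszul.hasLinearResolution {K : Type*} [Field K] {n : ℕ}
    {I : Ideal (MvPolynomial (Fin n) K)} (h : IsKoszul I) :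
    HasLinearResolution I (Submodule.pi Set.univ fun _ : Fin 1 => irrelevantIdeal I) := by
  obtain ⟨b, a, d, hd, ha⟩ := h
  have hlin : ∀ i p q, d i p q ∈ gradedPiece I 1 := by
    intro i p q
    rcases hd.homogeneous i p q with h | ⟨e, he, h⟩
    · rw [h]
      exact zero_mem _
    · rw [ha, ha] at he
      rwa [show e = 1 by omega] at h
  refine ⟨{⟨b 0, Submodule.pi Set.univ fun _ => irrelevantIdeal I⟩} ∪
    Set.range fun i => ⟨b (i + 1), LinearMap.ker (d i).mulVecLin⟩, Or.inl ?_, ?_⟩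
  · rw [Set.mem_singleton_iff, hd.rank_zero]
  · rintro _ (rfl | ⟨i, rfl⟩)
    · refine ⟨_, Or.inr ⟨0, rfl⟩, d 0, hlin 0, ?_, rfl⟩
      ext v
      rw [hd.exact_zero]
      exact ⟨fun h p _ => h p, fun h p => h p trivial⟩
    · exact ⟨_, Or.inr ⟨i + 1, rfl⟩, d (i + 1), hlin _, hd.exact_succ i, rfl⟩

/-- The algebra is Koszul as soon as it has a Koszul filtration. -/
theorem isKoszul_of_filtration {K : Type*} [Field K] {n : ℕ} {I : Ideal (MvPolynomial (Fin n) K)}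
    (hI : IsQuadraticIdeal I) [IsArtinianRing (MvPolynomial (Fin n) K ⧸ I)]
    {F : Set (Submodule K (Fin n → K))} (htop : ⊤ ∈ F)
    (hF : ∀ U ∈ F, U ≠ ⊥ → ∃ U' ∈ F, ∃ x, x ∉ U' ∧ U = U' ⊔ K ∙ x ∧ ∃ L ∈ F,
      ∀ r, r * linForm I x ∈ linIdeal I U' ↔ r ∈ linIdeal I L) :
    IsKoszul I := by
  obtain ⟨π, hπ⟩ := hI.exists_isGradedProj
  set V : Set (MvPolynomial (Fin n) K ⧸ I) := ↑(gradedPiece I 1) with hV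
  have hFil : IsKoszulFiltration V (linIdeal I '' F) := by
    rintro _ ⟨U, hU, rfl⟩ hne
    obtain ⟨U', hU', x, hx, hUx, L, hL, hr⟩ := hF U hU (by
      rintro rfl
      exact hne (linIdeal_bot I))
    refine ⟨_, ⟨U', hU', rfl⟩, linForm I x, linForm_mem I x, ?_, ?_, _, ⟨L, hL, rfl⟩, hr⟩
    · refine lt_of_le_of_ne (linIdeal_mono I (hUx ▸ le_sup_left)) fun h => hx ?_
      have hxU : linForm I x ∈ linIdeal I U' := by
        rw [h, hUx]
        exact linForm_mem_linIdeal (Submodule.mem_sup_right (Submodule.mem_span_singleton_self x))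
      obtain ⟨u, hu, h'⟩ := hπ.one_of_mem_linIdeal hxU
      rw [hπ.of_mem 1 _ (linForm_mem I x)] at h'
      rwa [linForm_injective hI h']
    · rw [hUx, linIdeal_sup, linIdeal_span_singleton]
  have hflag := hFil.hasFlag
  have h0 : IsFiltered (linIdeal I '' F) (π 1)
      (Submodule.pi Set.univ fun _ : Fin 1 => irrelevantIdeal I) := by
    refine ⟨?_, ?_⟩
    · intro v _ k _
      obtain ⟨u, hu⟩ := hπ.exists_linForm (v k)
      simp only [hu]
      rw [← linIdeal_top]
      exact linForm_mem_linIdeal trivial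
    · intro k
      refine ⟨_, ⟨⊤, htop, rfl⟩, fun r => ?_⟩
      rw [linIdeal_top]
      constructor
      · rintro ⟨u, hu, rfl, -⟩
        exact hu k trivial
      · intro hr
        refine ⟨fun _ => r, fun _ _ => hr, rfl, fun k' hk' => ?_⟩
        exact absurd hk' (by simp [Subsingleton.elim k k'])
  -- The certificate consists of all filtered submodules. It is closed under syzygies by
  -- `IsFiltered.exists_matrix`.
  refine isKoszul_of_hasLinearResolution ⟨{s | IsFiltered (linIdeal I '' F) (π 1) s.2}, h0, ?_⟩
  rintro ⟨b, U⟩ hU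
  obtain ⟨b', B, h1, h2, h3⟩ := IsFiltered.exists_matrix (π₂ := π 2) (hπ.mem 1) (hπ.of_mem 1)
    (fun l hl a => by
      rw [SetLike.mem_coe, ← range_linForm] at hl
      obtain ⟨v, rfl⟩ := hl
      exact hπ.succ_linForm_mul 1 v a) hflag hU
  exact ⟨⟨b', _⟩, h3, B, h1, h2, rfl⟩

/-! ### Descent of the Koszul property along field extensions -/

section Descent

variable {K L : Type*} [Field K] [Field L] [Algebra K L]

/-- Apply a `K`-linear functional of `L` to all coefficients. -/
noncomputable def coeffMap {σ : Type*} (f : L →ₗ[K] K) : MvPolynomial σ L →+ MvPolynomial σ K :=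
  ((MvPolynomial.basisMonomials σ K).repr.symm.toLinearMap.toAddMonoidHom.comp
    (Finsupp.mapRange.addMonoidHom f.toAddMonoidHom)).comp
      (MvPolynomial.basisMonomials σ L).repr.toLinearMap.toAddMonoidHom

theorem coeff_coeffMap {σ : Type*} (f : L →ₗ[K] K) (g : MvPolynomial σ L) (d : σ →₀ ℕ) :
    (coeffMap f g).coeff d = f (g.coeff d) := by
  rfl

/-- A projection formula, valid because `f` is `K`-linear. It makes `extCoeff` linear over `R`, so
that when `f 1 = 1` one obtains an `R`-linear retraction of the base change map. -/
theorem coeffMap_mul {σ : Type*} (f : L →ₗ[K] K) (a : MvPolynomial σ K) (g : MvPolynomial σ L) :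
    coeffMap f (g * MvPolynomial.map (algebraMap K L) a) = coeffMap f g * a := by
  classical
  ext d
  rw [coeff_coeffMap, MvPolynomial.coeff_mul, MvPolynomial.coeff_mul, map_sum]
  refine Finset.sum_congr rfl fun x _ => ?_
  rw [MvPolynomial.coeff_map, mul_comm, ← Algebra.smul_def, map_smul, coeff_coeffMap, smul_eq_mul,
    mul_comm]

theorem coeffMap_mem {σ : Type*} {I : Ideal (MvPolynomial σ K)} (f : L →ₗ[K] K)
    {g : MvPolynomial σ L} (hg : g ∈ I.map (MvPolynomial.map (algebraMap K L))) :
    coeffMap f g ∈ I := by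
  rw [Ideal.map] at hg
  induction hg using Submodule.closure_induction with
  | zero => simp
  | add x y _ _ hx hy => rw [map_add]; exact add_mem hx hy
  | smul_mem a g hg =>
    obtain ⟨v, hv, rfl⟩ := hg
    rw [smul_eq_mul, coeffMap_mul]
    exact Ideal.mul_mem_left _ _ hv

/-- The ideal generated by `I` after extension of the base field. -/
noncomputable abbrev extIdeal (L : Type*) [Field L] [Algebra K L] {σ : Type*}
    (I : Ideal (MvPolynomial σ K)) : Ideal (MvPolynomial σ L) :=
  I.map (MvPolynomial.map (algebraMap K L))

theorem IsQuadraticIdeal.extIdeal {n : ℕ} {I : Ideal (MvPolynomial (Fin n) K)}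
    (hI : IsQuadraticIdeal I) : IsQuadraticIdeal (extIdeal L I) := by
  obtain ⟨G, hG, rfl⟩ := hI
  refine ⟨MvPolynomial.map (algebraMap K L) '' G, ?_, Ideal.map_span _ _⟩
  rintro _ ⟨g, hg, rfl⟩
  exact (hG g hg).map _

variable {n : ℕ} (I : Ideal (MvPolynomial (Fin n) K))

/-- The base change map `R → R ⊗ L`. -/
noncomputable def extMap (L : Type*) [Field L] [Algebra K L] :
    MvPolynomial (Fin n) K ⧸ I →+* MvPolynomial (Fin n) L ⧸ extIdeal L I :=
  Ideal.quotientMap _ (MvPolynomial.map (algebraMap K L)) Ideal.le_comap_map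

/-- Apply a `K`-linear functional of `L` to the coefficients of an element of `R ⊗ L`. -/
noncomputable def extCoeff (f : L →ₗ[K] K) :
    MvPolynomial (Fin n) L ⧸ extIdeal L I →+ MvPolynomial (Fin n) K ⧸ I :=
  QuotientAddGroup.map (extIdeal L I).toAddSubgroup I.toAddSubgroup (coeffMap f)
    (fun _ hg => coeffMap_mem f hg)

variable {I}

theorem extCoeff_mk (f : L →ₗ[K] K) (g : MvPolynomial (Fin n) L) :
    extCoeff I f (Ideal.Quotient.mk _ g) = Ideal.Quotient.mk _ (coeffMap f g) := rfl

theorem extMap_mk (g : MvPolynomial (Fin n) K) :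
    extMap I L (Ideal.Quotient.mk _ g) = Ideal.Quotient.mk _ (MvPolynomial.map (algebraMap K L) g)
      :=
  rfl

theorem extCoeff_mul (f : L →ₗ[K] K) (c : MvPolynomial (Fin n) L ⧸ extIdeal L I)
    (a : MvPolynomial (Fin n) K ⧸ I) : extCoeff I f (c * extMap I L a) = extCoeff I f c * a := by
  obtain ⟨g, rfl⟩ := Ideal.Quotient.mk_surjective c
  obtain ⟨h, rfl⟩ := Ideal.Quotient.mk_surjective a
  rw [extMap_mk, ← map_mul, extCoeff_mk, coeffMap_mul, map_mul]
  rfl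

theorem extCoeff_algebraMap (f : L →ₗ[K] K) (t : L) :
    extCoeff I f (algebraMap L _ t) = algebraMap K _ (f t) := by
  classical
  have h : coeffMap (σ := Fin n) f (MvPolynomial.C t) = MvPolynomial.C (f t) := by
    ext d
    rw [coeff_coeffMap, MvPolynomial.coeff_C, MvPolynomial.coeff_C]
    split_ifs <;> simp
  exact congrArg (Ideal.Quotient.mk I) h

theorem extMap_linForm (v : Fin n → K) :
    extMap I L (linForm I v) = linForm (extIdeal L I) (fun i => algebraMap K L (v i)) := by
  rw [linForm_apply, extMap_mk, linForm_apply, linPoly_apply, linPoly_apply]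
  simp

theorem extCoeff_linForm (f : L →ₗ[K] K) (v : Fin n → L) :
    extCoeff I f (linForm (extIdeal L I) v) = linForm I (fun i => f (v i)) := by
  have h : ∀ i, linForm (extIdeal L I) (Pi.single i 1) = extMap I L (linForm I (Pi.single i 1)) :=
      by
    intro i
    rw [extMap_linForm]
    congr 1
    ext j
    by_cases hj : j = i
    · subst hj; simp
    · simp [hj]
  conv_lhs => rw [pi_eq_sum_univ' v, map_sum, map_sum]
  simp only [map_smul, quotient_smul_def, h, extCoeff_mul, extCoeff_algebraMap]
  simp only [← quotient_smul_def, ← map_smul]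
  rw [← map_sum]
  congr 1
  ext j
  simp [Finset.sum_apply, Pi.single_apply, Finset.sum_ite_eq]

theorem algebraMap_quotient_injective (hI : IsQuadraticIdeal I) :
    Function.Injective (algebraMap K (MvPolynomial (Fin n) K ⧸ I)) := by
  rw [injective_iff_map_eq_zero]
  intro c hc
  have h := hI.homogeneousComponent_eq_zero (Ideal.Quotient.eq_zero_iff_mem.1 hc) (j := 0) two_pos
  erw [MvPolynomial.homogeneousComponent_eq_self (MvPolynomial.isHomogeneous_C _ c)] at h
  simpa using h

/-- A family over `L` all of whose `K`-linear images lie in the span of `β` is in the `L`-span. -/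
theorem exists_coeff_of_forall_functional {ι κ : Type*} [Finite ι] [Fintype κ] (β : κ → ι → K)
    (w : ι → L) (hw : ∀ f : L →ₗ[K] K, (fun i => f (w i)) ∈ Submodule.span K (Set.range β)) :
    ∃ g : κ → L, ∀ i, w i = ∑ j, g j * algebraMap K L (β j i) := by
  classical
  cases nonempty_fintype ι
  -- Expand the family in a `K`-basis of `L`. Each coordinate functional supplies coefficients with
  -- respect to `β`, and only finitely many basis vectors occur because `ι` is finite.
  let e := Module.Basis.ofVectorSpace K L
  have h : ∀ k, ∃ c : κ → K, ∑ j, c j • β j = fun i => e.coord k (w i) := fun k =>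
    (Submodule.mem_span_range_iff_exists_fun K).1 (hw (e.coord k))
  choose c hc using h
  let s := Finset.univ.biUnion fun i => (e.repr (w i)).support
  refine ⟨fun j => ∑ k ∈ s, c k j • e k, fun i => ?_⟩
  have h1 : w i = ∑ k ∈ s, e.coord k (w i) • e k := by
    conv_lhs => rw [← e.linearCombination_repr (w i), Finsupp.linearCombination_apply]
    refine Finsupp.sum_of_support_subset _ (Finset.subset_biUnion_of_mem
      (fun i => (e.repr (w i)).support) (Finset.mem_univ i)) _ (by simp)
  rw [h1]
  simp only [Finset.sum_mul]
  rw [Finset.sum_comm]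
  refine Finset.sum_congr rfl fun k _ => ?_
  have h2 := congrFun (hc k) i
  simp only [Finset.sum_apply, Pi.smul_apply, smul_eq_mul] at h2
  rw [← h2, Finset.sum_smul]
  refine Finset.sum_congr rfl fun j _ => ?_
  rw [smul_mul_assoc, mul_comm (e k), ← Algebra.smul_def, smul_smul]

set_option maxHeartbeats 1000000 in
-- The columns of `B` form a `K`-basis of the linear vectors in `U`. Over `L` the matrix `B` and the
-- first matrix `D` of the given resolution of `U'` generate the same module in degree one, so they
-- differ by scalar matrices `G` and `G'`. These are inverse to each other, hence the syzygies of
-- `B` over `L` are isomorphic to those of `D`.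
theorem HasLinearResolution.descent_step (hI : IsQuadraticIdeal I) {b : ℕ}
    {U : Submodule (MvPolynomial (Fin n) K ⧸ I) (Fin b → MvPolynomial (Fin n) K ⧸ I)}
    {U' : Submodule (MvPolynomial (Fin n) L ⧸ extIdeal L I)
      (Fin b → MvPolynomial (Fin n) L ⧸ extIdeal L I)}
    (h1 : ∀ u ∈ U, (fun p => extMap I L (u p)) ∈ U')
    (h2 : ∀ f : L →ₗ[K] K, ∀ u ∈ U', (fun p => extCoeff I f (u p)) ∈ U)
    (hU' : HasLinearResolution (extIdeal L I) U') :
    ∃ (b' : ℕ) (B : Matrix (Fin b) (Fin b') (MvPolynomial (Fin n) K ⧸ I)),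
      (∀ p q, B p q ∈ gradedPiece I 1) ∧ LinearMap.range B.mulVecLin = U ∧
      HasLinearResolution (extIdeal L I) (LinearMap.ker (B.map (extMap I L)).mulVecLin) := by
  obtain ⟨c, D, hD, hDr, hDk⟩ := hU'.exists_matrix
  obtain ⟨c', D₁, hD₁, hD₁r, hD₁k⟩ := hDk.exists_matrix
  have hIL := hI.extIdeal (L := L)
  obtain ⟨π, hπ⟩ := hIL.exists_isGradedProj
  have hδ : ∀ p q, ∃ δ, D p q = linForm (extIdeal L I) δ := by
    intro p q
    have := hD p q
    rw [← range_linForm] at this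
    obtain ⟨δ, h⟩ := this
    exact ⟨δ, h.symm⟩
  choose δ hδ using hδ
  -- Linear vectors are encoded by the coefficients of their entries. `N` consists of the
  -- coefficient arrays whose class lies in `U`.
  let N : Submodule K (Fin b × Fin n → K) :=
    (U.restrictScalars K).comap (LinearMap.pi fun p => linForm I ∘ₗ
      LinearMap.pi fun i => LinearMap.proj (p, i))
  let β := Module.finBasis K N
  let B : Matrix (Fin b) (Fin (Module.finrank K N)) (MvPolynomial (Fin n) K ⧸ I) :=
    Matrix.of fun p q => linForm I fun i => (β q : Fin b × Fin n → K) (p, i)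
  have hBU : ∀ q, (fun p => B p q) ∈ U := fun q => (β q).2
  let A' := MvPolynomial (Fin n) L ⧸ extIdeal L I
  have hBL : ∀ p q, extMap I L (B p q) =
      linForm (extIdeal L I) fun i => algebraMap K L ((β q : Fin b × Fin n → K) (p, i)) :=
    fun p q => extMap_linForm _
  have hDU : ∀ q, (fun p => D p q) ∈ U' := by
    intro q
    have h : D.mulVecLin (Pi.single q 1) ∈ U' := by
      rw [← hDr]
      exact ⟨_, rfl⟩
    convert h using 1
    ext p
    simp
  -- the scalar matrices relating the two systems of generators
  have hg : ∀ q, ∃ g : Fin (Module.finrank K N) → L, ∀ x : Fin b × Fin n,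
      δ x.1 q x.2 = ∑ j, g j * algebraMap K L ((β j : Fin b × Fin n → K) x) := by
    intro q
    refine exists_coeff_of_forall_functional (fun j => (β j : Fin b × Fin n → K)) _ fun f => ?_
    have hmem : (fun x : Fin b × Fin n => f (δ x.1 q x.2)) ∈ N := by
      have := h2 f _ (hDU q)
      simp only [hδ, extCoeff_linForm] at this
      exact this
    have hspan := congrArg (Submodule.map N.subtype) β.span_eq
    rw [Submodule.map_span, ← Set.range_comp, Submodule.map_subtype_top] at hspan
    exact (Submodule.ext_iff.1 hspan _).2 hmem
  choose g hg using hg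
  let G : Matrix (Fin (Module.finrank K N)) (Fin c) L := Matrix.of fun j q => g q j
  have hDG : D = B.map (extMap I L) * G.map (algebraMap L A') := by
    ext p q
    rw [Matrix.mul_apply, hδ]
    simp only [Matrix.map_apply, hBL]
    have : δ p q = ∑ j, g q j • fun i => algebraMap K L ((β j : Fin b × Fin n → K) (p, i)) := by
      ext i
      simp [hg q (p, i)]
    rw [this, map_sum]
    refine Finset.sum_congr rfl fun j _ => ?_
    rw [map_smul, quotient_smul_def, mul_comm]
    rfl
  have hg' : ∀ q, ∃ g' : Fin c → L, ∀ p,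
      extMap I L (B p q) = ∑ k, D p k * algebraMap L A' (g' k) := by
    intro q
    have h := h1 _ (hBU q)
    rw [← hDr] at h
    obtain ⟨d, hd⟩ := h
    choose g' hg' using fun k => hπ.exists_algebraMap (d k)
    refine ⟨g', fun p => ?_⟩
    have hmem : extMap I L (B p q) ∈ gradedPiece (extIdeal L I) 1 := by
      rw [hBL]
      exact linForm_mem _ _
    have h' := (congrArg (π 1) (congrFun hd p)).trans (hπ.of_mem 1 _ hmem)
    rw [← h', Matrix.mulVecLin_apply, Matrix.mulVec, dotProduct, map_sum]
    refine Finset.sum_congr rfl fun k _ => ?_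
    rw [hδ, hπ.succ_linForm_mul 0, hg']
  choose g' hg' using hg'
  let G' : Matrix (Fin c) (Fin (Module.finrank K N)) L := Matrix.of fun k q => g' q k
  have hBG : B.map (extMap I L) = D * G'.map (algebraMap L A') := by
    ext p q
    rw [Matrix.mul_apply]
    exact hg' q p
  -- `K`-independent columns stay independent over `L`: a nonzero entry of `GG' - 1` would be
  -- detected by a functional `f : L → K`, producing a relation over `K` among the `β j`.
  have hGG' : G * G' = 1 := by
    rw [← sub_eq_zero]
    set M := G * G' - 1 with hM
    have hBM : B.map (extMap I L) * M.map (algebraMap L A') = 0 := by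
      have : M.map (algebraMap L A') = G.map (algebraMap L A') * G'.map (algebraMap L A') - 1 := by
        rw [← Matrix.map_mul, hM, Matrix.map_sub _ (map_sub _)]
        simp
      rw [this, Matrix.mul_sub, ← Matrix.mul_assoc, ← hDG, ← hBG, Matrix.mul_one, sub_self]
    ext k q
    by_contra hne
    obtain ⟨f, hf⟩ := Module.Projective.exists_dual_eq_one K hne
    have hlin : ∑ j, f (M j q) • β j = 0 := by
      ext x
      have h := congrFun (congrFun hBM x.1) q
      rw [Matrix.mul_apply] at h
      simp only [Matrix.map_apply, hBL, Matrix.zero_apply] at h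
      have h' : linForm (extIdeal L I) (∑ j, M j q • fun i =>
          algebraMap K L ((β j : Fin b × Fin n → K) (x.1, i))) = 0 := by
        rw [← h, map_sum]
        refine Finset.sum_congr rfl fun j _ => ?_
        rw [map_smul, quotient_smul_def, mul_comm]
      have h'' := congrFun (linForm_injective hIL (h'.trans (map_zero _).symm)) x.2
      have h3 := congrArg f h''
      simp only [Finset.sum_apply, Pi.smul_apply, smul_eq_mul, map_sum, Pi.zero_apply,
        map_zero] at h3
      simp only [Submodule.coe_sum, Finset.sum_apply, Submodule.coe_smul, Pi.smul_apply,
        smul_eq_mul,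
        Submodule.coe_zero, Pi.zero_apply]
      rw [← h3]
      refine Finset.sum_congr rfl fun j _ => ?_
      rw [mul_comm (M j q), ← Algebra.smul_def, map_smul, smul_eq_mul, mul_comm]
    have := Fintype.linearIndependent_iff.1 β.linearIndependent _ hlin k
    rw [hf] at this
    exact one_ne_zero this
  -- This uses minimality. The columns of `G'G - 1` are scalar syzygies of `D`, but the syzygies are
  -- the range of the linear matrix `D₁` and have all entries in the irrelevant ideal.
  have hG'G : G' * G = 1 := by
    rw [← sub_eq_zero]
    set M := G' * G - 1 with hM
    have hDM : D * M.map (algebraMap L A') = 0 := by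
      have : M.map (algebraMap L A') = G'.map (algebraMap L A') * G.map (algebraMap L A') - 1 := by
        rw [← Matrix.map_mul, hM, Matrix.map_sub _ (map_sub _)]
        simp
      rw [this, Matrix.mul_sub, ← Matrix.mul_assoc, ← hBG, ← hDG, Matrix.mul_one, sub_self]
    ext k q
    have hker : (fun j => algebraMap L A' (M j q)) ∈ LinearMap.range D₁.mulVecLin := by
      rw [hD₁r]
      ext p
      simpa [Matrix.mul_apply, Matrix.mulVec, dotProduct] using congrFun (congrFun hDM p) q
    obtain ⟨d, hd⟩ := hker
    have hirr : algebraMap L A' (M k q) ∈ linIdeal (extIdeal L I) ⊤ := by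
      rw [← congrFun hd k, linIdeal_top, Matrix.mulVecLin_apply, Matrix.mulVec, dotProduct]
      exact sum_mem fun j _ => Ideal.mul_mem_right _ _
        (gradedPiece_one_le_irrelevantIdeal (hD₁ k j))
    have h0 := hπ.zero_of_mem_linIdeal hirr
    have hmem : algebraMap L A' (M k q) ∈ gradedPiece (extIdeal L I) 0 :=
      ⟨MvPolynomial.C (M k q), MvPolynomial.isHomogeneous_C _ _, rfl⟩
    rw [hπ.of_mem 0 _ hmem] at h0
    exact algebraMap_quotient_injective hIL (h0.trans (map_zero _).symm)
  have hGGA : G.map (algebraMap L A') * G'.map (algebraMap L A') = 1 := by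
    rw [← Matrix.map_mul, hGG']
    simp
  have hGGA' : G'.map (algebraMap L A') * G.map (algebraMap L A') = 1 := by
    rw [← Matrix.map_mul, hG'G]
    simp
  refine ⟨_, B, fun p q => linForm_mem _ _, ?_, .of_matrix
    (D := G.map (algebraMap L A') * D₁) ?_ ?_ ?_⟩
  · apply le_antisymm
    · rintro _ ⟨v, rfl⟩
      have : B.mulVecLin v = ∑ q, v q • fun p => B p q := by
        ext p
        rw [Finset.sum_apply, Matrix.mulVecLin_apply, Matrix.mulVec, dotProduct]
        exact Finset.sum_congr rfl fun q _ => mul_comm _ _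
      rw [this]
      exact U.sum_mem fun q _ => U.smul_mem _ (hBU q)
    · intro u hu
      have h := h1 u hu
      rw [← hDr] at h
      obtain ⟨d, hd⟩ := h
      -- A functional with `f 1 = 1` turns a solution over `L` into one over `R`.
      obtain ⟨f, hf⟩ := Module.Projective.exists_dual_eq_one K (one_ne_zero (α := L))
      refine ⟨fun q => extCoeff I f ((G.map (algebraMap L A')).mulVec d q), ?_⟩
      ext p
      have h' := congrArg (extCoeff I f) (congrFun hd p)
      rw [Matrix.mulVecLin_apply, hDG, ← Matrix.mulVec_mulVec] at h'
      rw [show extMap I L (u p) = algebraMap L A' 1 * extMap I L (u p) by simp, extCoeff_mul,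
        extCoeff_algebraMap, hf, map_one, one_mul] at h'
      rw [← h', Matrix.mulVecLin_apply, Matrix.mulVec, Matrix.mulVec, dotProduct, dotProduct,
        map_sum]
      refine Finset.sum_congr rfl fun q _ => ?_
      rw [Matrix.map_apply, mul_comm (extMap I L (B p q)), extCoeff_mul, mul_comm]
  · intro p q
    rw [Matrix.mul_apply]
    refine sum_mem fun j _ => ?_
    rw [Matrix.map_apply, ← quotient_smul_def]
    exact Submodule.smul_mem _ _ (hD₁ j q)
  · apply le_antisymm
    · rintro _ ⟨d, rfl⟩
      have hd : D₁.mulVecLin d ∈ LinearMap.ker D.mulVecLin := by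
        rw [← hD₁r]
        exact ⟨d, rfl⟩
      rw [LinearMap.mem_ker, Matrix.mulVecLin_apply, Matrix.mulVecLin_apply] at hd
      rw [LinearMap.mem_ker, Matrix.mulVecLin_apply, Matrix.mulVecLin_apply,
        ← Matrix.mulVec_mulVec, Matrix.mulVec_mulVec, ← hDG, hd]
    · intro v hv
      rw [LinearMap.mem_ker, Matrix.mulVecLin_apply, hBG, ← Matrix.mulVec_mulVec] at hv
      have : (G'.map (algebraMap L A')).mulVec v ∈ LinearMap.range D₁.mulVecLin := by
        rw [hD₁r]
        exact hv
      obtain ⟨d, hd⟩ := this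
      refine ⟨d, ?_⟩
      rw [Matrix.mulVecLin_apply] at hd ⊢
      rw [← Matrix.mulVec_mulVec, hd, Matrix.mulVec_mulVec, hGGA, Matrix.one_mulVec]
  · convert hD₁k using 1
    ext d
    simp only [LinearMap.mem_ker, Matrix.mulVecLin_apply]
    constructor
    · intro h
      rw [← Matrix.one_mulVec (D₁.mulVec d), ← hGGA', ← Matrix.mulVec_mulVec,
        Matrix.mulVec_mulVec (M := G.map _), h, Matrix.mulVec_zero]
    · intro h
      rw [← Matrix.mulVec_mulVec, h, Matrix.mulVec_zero]

/-- The Koszul property descends along field extensions. -/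
theorem IsKoszul.of_extIdeal (L : Type*) [Field L] [Algebra K L] (hI : IsQuadraticIdeal I)
    (h : IsKoszul (extIdeal L I)) : IsKoszul I := by
  -- The certificate consists of the submodules `U` that have a companion `U'` over `L` with a
  -- linear resolution, where `U` maps into `U'` under base change and `U'` maps back into `U` under
  -- every coefficient functional. The kernels of `B` and of its base change are companions in the
  -- same way.
  refine isKoszul_of_hasLinearResolution ⟨{s | ∃ U' : Submodule
    (MvPolynomial (Fin n) L ⧸ extIdeal L I) (Fin s.1 → MvPolynomial (Fin n) L ⧸ extIdeal L I),
    (∀ u ∈ s.2, (fun p => extMap I L (u p)) ∈ U') ∧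
    (∀ f : L →ₗ[K] K, ∀ u ∈ U', (fun p => extCoeff I f (u p)) ∈ s.2) ∧
    HasLinearResolution (extIdeal L I) U'}, ?_, ?_⟩
  · refine ⟨_, ?_, ?_, h.hasLinearResolution⟩
    · intro u hu p _
      have hp : u p ∈ irrelevantIdeal I := hu p trivial
      change extMap I L (u p) ∈ irrelevantIdeal (extIdeal L I)
      refine Ideal.mem_comap.1 ((Ideal.map_le_iff_le_comap (f := extMap I L)).1 ?_ hp)
      rw [irrelevantIdeal]
      rw [Ideal.map_span, Ideal.span_le]
      rintro _ ⟨_, ⟨i, rfl⟩, rfl⟩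
      rw [extMap_mk, MvPolynomial.map_X]
      exact Ideal.subset_span ⟨i, rfl⟩
    · intro f u hu p _
      have hp : u p ∈ irrelevantIdeal (extIdeal L I) := hu p trivial
      change extCoeff I f (u p) ∈ irrelevantIdeal I
      generalize u p = r at hp
      rw [irrelevantIdeal] at hp
      induction hp using Submodule.closure_induction with
      | zero => simp
      | add x y _ _ hx hy => rw [map_add]; exact add_mem hx hy
      | smul_mem a g hg =>
        obtain ⟨i, rfl⟩ := hg
        have : Ideal.Quotient.mk (extIdeal L I) (MvPolynomial.X i) =
            extMap I L (Ideal.Quotient.mk I (MvPolynomial.X i)) := by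
          rw [extMap_mk, MvPolynomial.map_X]
        rw [smul_eq_mul]
        simp only
        rw [this, extCoeff_mul]
        exact Ideal.mul_mem_left _ _ (Ideal.subset_span ⟨i, rfl⟩)
  · rintro ⟨b, U⟩ ⟨U', h1, h2, h3⟩
    obtain ⟨b', B, hB, hBr, hBk⟩ := HasLinearResolution.descent_step hI h1 h2 h3
    refine ⟨⟨b', LinearMap.ker B.mulVecLin⟩, ⟨_, ?_, ?_, hBk⟩, B, hB, hBr, rfl⟩
    · intro u hu
      rw [LinearMap.mem_ker, Matrix.mulVecLin_apply] at hu ⊢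
      ext p
      have := congrArg (extMap I L) (congrFun hu p)
      simpa only [Matrix.mulVec, dotProduct, map_sum, map_mul, Matrix.map_apply, Pi.zero_apply,
        map_zero] using this
    · intro f u hu
      simp only [LinearMap.mem_ker, Matrix.mulVecLin_apply] at hu ⊢
      ext p
      have := congrArg (extCoeff I f) (congrFun hu p)
      simpa only [Matrix.mulVec, dotProduct, map_sum, Matrix.map_apply, mul_comm (extMap I L _),
        extCoeff_mul, Pi.zero_apply, map_zero, mul_comm (B p _)] using this

theorem extMap_smul (c : K) (r : MvPolynomial (Fin n) K ⧸ I) :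
    extMap I L (c • r) = algebraMap K L c • extMap I L r := by
  obtain ⟨f, rfl⟩ := Ideal.Quotient.mk_surjective r
  rw [quotient_smul_def, quotient_smul_def, map_mul]
  congr 1
  change extMap I L (Ideal.Quotient.mk I (MvPolynomial.C c)) = _
  rw [extMap_mk, MvPolynomial.map_C]
  rfl

theorem extCoeff_smul_extMap (f : L →ₗ[K] K) (c : L) (r : MvPolynomial (Fin n) K ⧸ I) :
    extCoeff I f (c • extMap I L r) = f c • r := by
  rw [quotient_smul_def, extCoeff_mul, extCoeff_algebraMap, quotient_smul_def]

/-- A `K`-basis of `R_j` becomes an `L`-basis. Independence is tested by functionals `L → K`, and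
generation holds because monomials are already defined over `K`. -/
theorem finrank_gradedPiece_extIdeal (L : Type*) [Field L] [Algebra K L]
    (I : Ideal (MvPolynomial (Fin n) K)) (j : ℕ) [Module.Finite K (gradedPiece I j)] :
    Module.finrank L (gradedPiece (extIdeal L I) j) = Module.finrank K (gradedPiece I j) := by
  let b := Module.finBasis K (gradedPiece I j)
  have hli : LinearIndependent L fun i => extMap I L (b i) := by
    rw [Fintype.linearIndependent_iff]
    intro c hc i
    by_contra hne
    obtain ⟨f, hf⟩ := Module.Projective.exists_dual_eq_one K hne
    have h := congrArg (extCoeff I f) hc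
    simp only [map_sum, map_zero, extCoeff_smul_extMap] at h
    have h' : ∑ i, f (c i) • b i = 0 := by
      ext
      simpa using h
    have := Fintype.linearIndependent_iff.1 b.linearIndependent _ h' i
    rw [hf] at this
    exact one_ne_zero this
  have hspan : Submodule.span L (Set.range fun i => extMap I L (b i)) =
      gradedPiece (extIdeal L I) j := by
    apply le_antisymm
    · rw [Submodule.span_le]
      rintro _ ⟨i, rfl⟩
      obtain ⟨g, hg, hgb⟩ := (b i).2
      refine ⟨MvPolynomial.map (algebraMap K L) g, MvPolynomial.IsHomogeneous.map hg _, ?_⟩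
      simp only
      rw [← hgb]
      rfl
    · rintro _ ⟨g, hg, rfl⟩
      rw [MvPolynomial.as_sum g, map_sum]
      refine sum_mem fun d hd => ?_
      have hmono : MvPolynomial.monomial d (g.coeff d) =
          g.coeff d • MvPolynomial.map (algebraMap K L) (MvPolynomial.monomial d 1) := by
        rw [MvPolynomial.map_monomial, MvPolynomial.smul_monomial]
        simp
      rw [hmono, map_smul]
      refine Submodule.smul_mem _ _ ?_
      have hmem : Ideal.Quotient.mk I (MvPolynomial.monomial d 1) ∈ gradedPiece I j := by
        refine ⟨MvPolynomial.monomial d 1, MvPolynomial.isHomogeneous_monomial _ ?_, rfl⟩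
        have h := MvPolynomial.IsHomogeneous.coeff_eq_zero (d := d) hg
        by_contra hne
        exact MvPolynomial.mem_support_iff.1 hd (h hne)
      have hr : _ = Ideal.Quotient.mk I (MvPolynomial.monomial d 1) :=
        congrArg Subtype.val (b.sum_repr ⟨_, hmem⟩)
      have : (Ideal.Quotient.mkₐ L (extIdeal L I)).toLinearMap
          (MvPolynomial.map (algebraMap K L) (MvPolynomial.monomial d 1)) =
          extMap I L (Ideal.Quotient.mk I (MvPolynomial.monomial d 1)) := rfl
      rw [this, ← hr, Submodule.coe_sum, map_sum]
      refine sum_mem fun i _ => ?_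
      rw [Submodule.coe_smul, extMap_smul]
      exact Submodule.smul_mem _ _ (Submodule.subset_span ⟨i, rfl⟩)
  rw [← hspan, finrank_span_eq_card hli, Fintype.card_fin]

/-- All forms of large degree over `K` lie in `I`, so the extended algebra is spanned over `L` by
finitely many monomials. -/
theorem isArtinianRing_extIdeal (L : Type*) [Field L] [Algebra K L] (hI : IsQuadraticIdeal I)
    [IsArtinianRing (MvPolynomial (Fin n) K ⧸ I)] :
    IsArtinianRing (MvPolynomial (Fin n) L ⧸ extIdeal L I) := by
  obtain ⟨N, hN⟩ := hI.exists_homogeneous_mem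
  have hfin : {d : Fin n →₀ ℕ | d.degree < N}.Finite := by
    refine (Set.finite_Iic (Finsupp.equivFunOnFinite.symm fun _ : Fin n => N)).subset ?_
    intro d hd i
    exact (Finsupp.le_degree i d).trans hd.le
  have : Module.Finite L (MvPolynomial (Fin n) L ⧸ extIdeal L I) := by
    refine ⟨⟨(hfin.image fun d => Ideal.Quotient.mk (extIdeal L I)
      (MvPolynomial.monomial d 1)).toFinset, ?_⟩⟩
    rw [eq_top_iff]
    rintro r -
    obtain ⟨g, rfl⟩ := Ideal.Quotient.mk_surjective r
    rw [MvPolynomial.as_sum g, map_sum]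
    refine sum_mem fun d _ => ?_
    have hmono : MvPolynomial.monomial d (g.coeff d) =
        g.coeff d • (MvPolynomial.monomial d 1 : MvPolynomial (Fin n) L) := by
      rw [MvPolynomial.smul_monomial]
      simp
    rw [hmono]
    change Ideal.Quotient.mkₐ L (extIdeal L I) _ ∈ _
    rw [map_smul]
    refine Submodule.smul_mem _ _ ?_
    by_cases hd : d.degree < N
    · refine Submodule.subset_span ?_
      rw [Set.Finite.coe_toFinset]
      exact ⟨d, hd, rfl⟩
    · have h := hN d.degree (not_lt.1 hd) (MvPolynomial.monomial d 1)
        (MvPolynomial.isHomogeneous_monomial _ rfl)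
      have h' := Ideal.mem_map_of_mem (MvPolynomial.map (algebraMap K L)) h
      rw [MvPolynomial.map_monomial, map_one] at h'
      rw [Ideal.Quotient.mkₐ_eq_mk, Ideal.Quotient.eq_zero_iff_mem.2 h']
      exact zero_mem _
  exact IsArtinianRing.of_finite L _

end Descent

/-! ### Common zeros of polynomials -/

/-- The polynomials vanishing where all but the last `n - i` coordinates vanish. -/
theorem le_height_ker_killFirst (K : Type*) [Field K] (n i : ℕ) (hi : i ≤ n) :
    (i : ℕ∞) ≤ (RingHom.ker (MvPolynomial.aeval (R := K) fun j : Fin n =>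
      if (j : ℕ) < i then (0 : MvPolynomial (Fin n) K) else MvPolynomial.X j)).height := by
  induction i with
  | zero => simp
  | succ i ih =>
    set f : ℕ → MvPolynomial (Fin n) K →ₐ[K] MvPolynomial (Fin n) K := fun i =>
      MvPolynomial.aeval (R := K) fun j : Fin n =>
        if (j : ℕ) < i then (0 : MvPolynomial (Fin n) K) else MvPolynomial.X j with hf
    have hprime : ∀ i, (RingHom.ker (f i)).IsPrime := fun i => RingHom.ker_isPrime _
    have hcomp : (f (i + 1)).comp (f i) = f (i + 1) := by
      apply MvPolynomial.algHom_ext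
      intro j
      simp only [hf, AlgHom.comp_apply, MvPolynomial.aeval_X]
      split_ifs with h1 h2 h2
      · simp
      · omega
      · rw [MvPolynomial.aeval_X, if_pos h2]
      · rw [MvPolynomial.aeval_X, if_neg h2]
    have hlt : RingHom.ker (f i) < RingHom.ker (f (i + 1)) := by
      refine lt_of_le_of_ne ?_ ?_
      · intro p hp
        rw [RingHom.mem_ker] at hp ⊢
        rw [← hcomp, AlgHom.comp_apply, hp, map_zero]
      · intro h
        have h1 : MvPolynomial.X ⟨i, hi⟩ ∈ RingHom.ker (f (i + 1)) := by
          simp [hf, RingHom.mem_ker]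
        rw [← h, RingHom.mem_ker] at h1
        simp [hf] at h1
    have := hprime i
    have := hprime (i + 1)
    have h := Ideal.height_add_one_le_of_lt_of_isPrime hlt
    refine le_trans ?_ h
    push_cast
    gcongr
    exact ih (by omega)

/-- Fewer polynomials without constant term than variables have a nonzero common zero. -/
theorem exists_ne_zero_forall_eval_eq_zero {K : Type*} [Field K] [IsAlgClosed K] {n k : ℕ}
    (hkn : k < n) (p : Fin k → MvPolynomial (Fin n) K) (hp : ∀ j, MvPolynomial.eval 0 (p j) = 0) :
    ∃ x : Fin n → K, x ≠ 0 ∧ ∀ j, MvPolynomial.eval x (p j) = 0 := by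
  classical
  by_contra! hcon
  set I := Ideal.span (Set.range p)
  set M := RingHom.ker (MvPolynomial.aeval (R := K) fun j : Fin n =>
      if (j : ℕ) < n then (0 : MvPolynomial (Fin n) K) else MvPolynomial.X j) with hM
  have hMeval : ∀ q, q ∈ M ↔ MvPolynomial.eval 0 q = 0 := by
    intro q
    rw [hM, RingHom.mem_ker]
    simp only [Fin.is_lt, if_true]
    have : MvPolynomial.aeval (fun _ : Fin n => (0 : MvPolynomial (Fin n) K)) q =
        MvPolynomial.C (MvPolynomial.eval 0 q) := by
      have h : MvPolynomial.aeval (R := K) (fun _ : Fin n => (0 : MvPolynomial (Fin n) K)) =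
          (Algebra.ofId K _).comp (MvPolynomial.aeval (0 : Fin n → K)) := by
        apply MvPolynomial.algHom_ext
        simp
      rw [h]
      rfl
    rw [this, MvPolynomial.C_eq_zero]
  have hIM : I ≤ M := by
    rw [Ideal.span_le]
    rintro _ ⟨j, rfl⟩
    exact (hMeval _).2 (hp j)
  have hMprime : M.IsPrime := RingHom.ker_isPrime _
  -- By the Nullstellensatz: if the origin is the only common zero, the radical is the maximal ideal
  -- `M` of the origin.
  have hrad : I.radical = M := by
    apply le_antisymm
    · exact (hMprime.isRadical.radical_le_iff).2 hIM
    · intro q hq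
      rw [← MvPolynomial.vanishingIdeal_zeroLocus_eq_radical (K := K) I,
        MvPolynomial.mem_vanishingIdeal_iff]
      intro x hx
      have hx0 : x = 0 := by
        by_contra hne
        obtain ⟨j, hj⟩ := hcon x hne
        apply hj
        have := MvPolynomial.mem_zeroLocus_iff.1 hx (p j) (Ideal.subset_span ⟨j, rfl⟩)
        simpa [MvPolynomial.aeval_eq_eval] using this
      subst hx0
      simpa [MvPolynomial.aeval_eq_eval] using (hMeval q).1 hq
  have hmin : M ∈ I.minimalPrimes := by
    refine ⟨⟨hMprime, hIM⟩, fun Q hQ _ => ?_⟩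
    rw [← hrad]
    exact (hQ.1.isRadical.radical_le_iff).2 hQ.2
  have h1 := le_height_ker_killFirst K n n le_rfl
  -- By Krull's height theorem: `M` is minimal over an ideal with `k` generators, while its height
  -- is at least `n`.
  have h2 := Ideal.height_le_card_of_mem_minimalPrimes_span_finset (s := Finset.univ.image p)
    (p := M) (by simpa using hmin)
  have h3 : (n : ℕ∞) ≤ (k : ℕ∞) := by
    refine (h1.trans h2).trans ?_
    exact_mod_cast Finset.card_image_le.trans (by simp)
  exact absurd (by exact_mod_cast h3) (not_le.2 hkn)

/-! ### Solving quadratic and bilinear equations over an algebraically closed field -/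

section Bilinear

variable {K V W : Type*} [Field K] [AddCommGroup V] [Module K V] [AddCommGroup W] [Module K W]
  [FiniteDimensional K V] [FiniteDimensional K W] (μ : V →ₗ[K] V →ₗ[K] W)

variable {μ} in
/-- A space of vectors contains a nonzero vector whose square lies in a given subspace, provided
that this subspace has small codimension in one containing all squares. -/
theorem exists_sq_mem [IsAlgClosed K] {V₁ : Submodule K V} {D₀ D₁ : Submodule K W} (hD : D₀ ≤ D₁)
    (hsq : ∀ v ∈ V₁, μ v v ∈ D₁)
    (hlt : Module.finrank K D₁ < Module.finrank K D₀ + Module.finrank K V₁) :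
    ∃ v ∈ V₁, v ≠ 0 ∧ μ v v ∈ D₀ := by
  set Q := D₁.map D₀.mkQ with hQ
  have hfin : Module.finrank K Q + Module.finrank K D₀ = Module.finrank K D₁ := by
    have h := LinearMap.finrank_range_add_finrank_ker (D₀.mkQ.domRestrict D₁)
    have h2 : Module.finrank K (LinearMap.ker (D₀.mkQ.domRestrict D₁)) = Module.finrank K D₀ := by
      have : LinearMap.ker (D₀.mkQ.domRestrict D₁) = D₀.submoduleOf D₁ := by
        ext; simp [Submodule.submoduleOf]
      rw [this]
      exact (Submodule.submoduleOfEquivOfLe hD).finrank_eq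
    rwa [LinearMap.range_domRestrict, h2] at h
  let e := Module.finBasis K Q
  let b := Module.finBasis K V₁
  have hφ : ∀ j, ∃ φ : (W ⧸ D₀) →ₗ[K] K, φ ∘ₗ Q.subtype = e.coord j := fun j =>
    LinearMap.exists_extend _
  choose φ hφ using hφ
  -- In terms of bases, the class of `v²` in `D₁/D₀` is given by `dim Q` quadrics in `dim V₁`
  -- variables, and the hypothesis says there are fewer equations than variables.
  let p : Fin (Module.finrank K Q) → MvPolynomial (Fin (Module.finrank K V₁)) K := fun j =>
    ∑ s, ∑ t, MvPolynomial.C (φ j (D₀.mkQ (μ (b s) (b t)))) * (MvPolynomial.X s * MvPolynomial.X t)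
  obtain ⟨x, hx, hxp⟩ := exists_ne_zero_forall_eval_eq_zero (by omega) p (by simp [p])
  refine ⟨(∑ s, x s • b s : V₁), Submodule.coe_mem _, ?_, ?_⟩
  · intro h
    rw [ZeroMemClass.coe_eq_zero] at h
    apply hx
    ext s
    exact Fintype.linearIndependent_iff.1 b.linearIndependent x h s
  · set v : V₁ := ∑ s, x s • b s with hv
    have hvQ : D₀.mkQ (μ v v) ∈ Q := Submodule.mem_map_of_mem (hsq v v.2)
    have hz : (⟨_, hvQ⟩ : Q) = 0 := by
      apply e.ext_elem
      intro j
      have h1 : e.repr ⟨_, hvQ⟩ j = φ j (D₀.mkQ (μ v v)) := by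
        have := LinearMap.congr_fun (hφ j) ⟨_, hvQ⟩
        simpa using this.symm
      rw [h1, map_zero, Finsupp.zero_apply, ← hxp j]
      simp only [hv, p, Submodule.coe_sum, Submodule.coe_smul, map_sum, map_smul,
        LinearMap.sum_apply, LinearMap.smul_apply, MvPolynomial.eval_C, map_mul,
        MvPolynomial.eval_X, smul_eq_mul]
      rw [Finset.sum_comm]
      refine Finset.sum_congr rfl fun s _ => ?_
      rw [Finset.mul_sum]
      refine Finset.sum_congr rfl fun t _ => ?_
      ring
    have := congrArg Subtype.val hz
    simpa using this

variable {μ} in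
/-- A pencil of linear maps between spaces of the same dimension has a singular member. -/
theorem exists_mul_mem [IsAlgClosed K] {P Q : Submodule K V} {D : Submodule K W}
    (hP : 2 ≤ Module.finrank K P) (hQ : Module.finrank K W ≤ Module.finrank K D + Module.finrank K
      Q)
    (hQ0 : Q ≠ ⊥) :
    ∃ v ∈ P, v ≠ 0 ∧ ∃ w ∈ Q, w ≠ 0 ∧ μ v w ∈ D := by
  let f : P →ₗ[K] Q →ₗ[K] W ⧸ D :=
    (LinearMap.compr₂ μ D.mkQ).domRestrict₁₂ P Q
  have hf : ∀ v w, f v w = 0 ↔ μ v w ∈ D := fun v w => by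
    change D.mkQ (μ v w) = 0 ↔ _
    simp
  by_contra! hcon
  have hinj : ∀ v : P, v ≠ 0 → Function.Injective (f v) := by
    intro v hv
    rw [injective_iff_map_eq_zero]
    intro w hw
    by_contra hne
    exact hcon v v.2 (by simpa using hv) w w.2 (by simpa using hne) ((hf v w).1 hw)
  have hdim : Module.finrank K (W ⧸ D) + Module.finrank K D = Module.finrank K W :=
    D.finrank_quotient_add_finrank
  obtain ⟨v₁, v₂, hli⟩ : ∃ v₁ v₂ : P, LinearIndependent K ![v₁, v₂] := by
    obtain ⟨g, hg⟩ := exists_linearIndependent_of_le_finrank hP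
    refine ⟨g 0, g 1, ?_⟩
    convert hg
    ext i
    fin_cases i <;> rfl
  have h1 : v₁ ≠ 0 := hli.ne_zero 0
  have hQW : Module.finrank K Q = Module.finrank K (W ⧸ D) :=
    le_antisymm (LinearMap.finrank_le_finrank_of_injective (hinj v₁ h1)) (by omega)
  let e := LinearEquiv.ofInjectiveOfFinrankEq (f v₁) (hinj v₁ h1) hQW
  have : Nontrivial Q := Submodule.nontrivial_iff_ne_bot.2 hQ0
  -- If every nonzero member of the pencil were injective, `f v₁` would be invertible. An
  -- eigenvector of `(f v₁)⁻¹ f v₂` with eigenvalue `c` is killed by `v₂ - c v₁`, a contradiction.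
  obtain ⟨c, hc⟩ := Module.End.exists_eigenvalue (e.symm.toLinearMap ∘ₗ f v₂)
  obtain ⟨w, hw⟩ := hc.exists_hasEigenvector
  have hw' : f v₂ w = c • f v₁ w := by
    have := congrArg e hw.apply_eq_smul
    rw [map_smul, LinearMap.comp_apply, LinearEquiv.coe_coe, LinearEquiv.apply_symm_apply] at this
    exact this
  have hne : v₂ - c • v₁ ≠ 0 := by
    intro h
    have := LinearIndependent.pair_iff.1 hli (-c) 1 (by rw [← h]; module)
    exact one_ne_zero this.2
  refine hw.2 (hinj _ hne ?_)
  rw [map_sub, map_smul, LinearMap.sub_apply, LinearMap.smul_apply, hw', sub_self, map_zero]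

end Bilinear

theorem exists_compl_finrank {K V : Type*} [Field K] [AddCommGroup V] [Module K V]
    [FiniteDimensional K V] (U : Submodule K V) : ∃ P : Submodule K V, Disjoint U P ∧
    U ⊔ P = ⊤ ∧ Module.finrank K U + Module.finrank K P = Module.finrank K V := by
  obtain ⟨P, hP⟩ := U.exists_isCompl
  exact ⟨P, hP.disjoint, hP.sup_eq_top, Submodule.finrank_add_eq_of_isCompl hP⟩

theorem notMem_of_disjoint {K V : Type*} [Field K] [AddCommGroup V] [Module K V]
    {U P : Submodule K V} (h : Disjoint U P) {v : V} (hv : v ∈ P) (hv0 : v ≠ 0) : v ∉ U :=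
  fun hU => hv0 (Submodule.disjoint_def.1 h v hU hv)

/-! ### Multiplications into a three-dimensional space and relative filtrations -/

section Multiplication

variable {K V W : Type*} [Field K] [AddCommGroup V] [Module K V] [AddCommGroup W] [Module K W]

/-- The subspace `U · V` of `W`. -/
abbrev mulTop (μ : V →ₗ[K] V →ₗ[K] W) (U : Submodule K V) : Submodule K W :=
  Submodule.map₂ μ U ⊤

/-- The space of all `v` with `x v ∈ U · V`. -/
abbrev colon (μ : V →ₗ[K] V →ₗ[K] W) (U : Submodule K V) (x : V) : Submodule K V :=
  (mulTop μ U).comap (μ x)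

variable {μ : V →ₗ[K] V →ₗ[K] W}

theorem mul_mem_mulTop {U : Submodule K V} {u : V} (hu : u ∈ U) (v : V) : μ u v ∈ mulTop μ U :=
  Submodule.apply_mem_map₂ _ hu trivial

theorem mulTop_mono {U U' : Submodule K V} (h : U ≤ U') : mulTop μ U ≤ mulTop μ U' :=
  Submodule.map₂_le_map₂_left h

theorem mulTop_le {U : Submodule K V} {D : Submodule K W} :
    mulTop μ U ≤ D ↔ ∀ u ∈ U, ∀ v, μ u v ∈ D := by
  simp [Submodule.map₂_le]

theorem mulTop_span_singleton (x : V) : mulTop μ (K ∙ x) = LinearMap.range (μ x) := by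
  rw [mulTop, Submodule.map₂_span_singleton_eq_map, Submodule.map_top]

theorem mulTop_sup (U U' : Submodule K V) : mulTop μ (U ⊔ U') = mulTop μ U ⊔ mulTop μ U' :=
  Submodule.map₂_sup_left _ _ _ _

theorem mem_colon {U : Submodule K V} {x v : V} : v ∈ colon μ U x ↔ μ x v ∈ mulTop μ U := Iff.rfl

variable [FiniteDimensional K V] [FiniteDimensional K W]

/-- Rank-nullity for multiplication by `x` with values in `W/UV`, whose kernel is the colon space.
-/
theorem finrank_add_finrank_mulTop_le (U : Submodule K V) (x : V) :
    Module.finrank K V + Module.finrank K (mulTop μ U) ≤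
      Module.finrank K (colon μ U x) + Module.finrank K W := by
  have h1 := LinearMap.finrank_range_add_finrank_ker ((mulTop μ U).mkQ ∘ₗ μ x)
  have h2 : LinearMap.ker ((mulTop μ U).mkQ ∘ₗ μ x) = colon μ U x := by
    rw [LinearMap.ker_comp, Submodule.ker_mkQ]
  have h3 := Submodule.finrank_le (LinearMap.range ((mulTop μ U).mkQ ∘ₗ μ x))
  have h4 := (mulTop μ U).finrank_quotient_add_finrank
  rw [h2] at h1
  omega

/-- The extreme case of the preceding rank count: multiplication by `x` is then onto `W/UV`. -/
theorem mulTop_sup_eq_top {U : Submodule K V} {x : V}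
    (h : Module.finrank K (colon μ U x) + Module.finrank K W ≤
      Module.finrank K V + Module.finrank K (mulTop μ U)) : mulTop μ (U ⊔ K ∙ x) = ⊤ := by
  have h1 := LinearMap.finrank_range_add_finrank_ker ((mulTop μ U).mkQ ∘ₗ μ x)
  have h2 : LinearMap.ker ((mulTop μ U).mkQ ∘ₗ μ x) = colon μ U x := by
    rw [LinearMap.ker_comp, Submodule.ker_mkQ]
  rw [h2] at h1
  have h3 : LinearMap.range ((mulTop μ U).mkQ ∘ₗ μ x) = ⊤ := by
    apply Submodule.eq_top_of_finrank_eq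
    have h8 := (mulTop μ U).finrank_quotient_add_finrank
    have h9 := Submodule.finrank_le (LinearMap.range ((mulTop μ U).mkQ ∘ₗ μ x))
    omega
  rw [LinearMap.range_comp] at h3
  have := congrArg (Submodule.comap (mulTop μ U).mkQ) h3
  rw [Submodule.comap_map_mkQ, Submodule.comap_top] at this
  rw [mulTop_sup, mulTop_span_singleton, this]

theorem exists_eq_sup_span_singleton {U₁ U : Submodule K V} (h : U₁ < U) :
    ∃ U' x, U₁ ≤ U' ∧ x ∉ U' ∧ U = U' ⊔ K ∙ x := by
  obtain ⟨U', h1, h2⟩ := exists_le_covBy_of_lt h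
  obtain ⟨x, hx, hx'⟩ := SetLike.exists_of_lt h2.lt
  refine ⟨U', x, h1, hx', ?_⟩
  refine ((h2.eq_or_eq le_sup_left
    (sup_le h2.le ((Submodule.span_singleton_le_iff_mem _ _).2 hx))).resolve_left fun h => hx'
      ?_).symm
  rw [← h]
  exact Submodule.mem_sup_right (Submodule.mem_span_singleton_self x)

theorem finrank_sup_span_singleton_of_notMem {U : Submodule K V} {x : V} (hx : x ∉ U) :
    Module.finrank K (U ⊔ K ∙ x : Submodule K V) = Module.finrank K U + 1 := by
  have hx0 : x ≠ 0 := fun h => hx (h ▸ zero_mem _)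
  have hd : U ⊓ K ∙ x = ⊥ := by
    rw [← disjoint_iff]
    exact Submodule.disjoint_span_singleton_of_notMem hx
  have := Submodule.finrank_sup_add_finrank_inf_eq U (K ∙ x)
  rw [hd, finrank_bot, finrank_span_singleton hx0] at this
  exact this

variable (μ) in
/-- A commutative multiplication `V × V → W` with `dim W = 3` in which every hyperplane of `V`
generates `W`. -/
structure IsThreeMul : Prop where
  comm : ∀ u v, μ u v = μ v u
  finrank_eq : Module.finrank K W = 3
  mulTop_eq : ∀ U : Submodule K V, Module.finrank K V ≤ Module.finrank K U + 1 → mulTop μ U = ⊤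

variable (μ) in
/-- A linear-algebraic form of Koszul filtrations relative to a base space `U₀`. -/
structure IsRelFiltration (U₀ : Submodule K V) (F : Set (Submodule K V)) : Prop where
  base : U₀ ∈ F
  top : ⊤ ∈ F
  step : ∀ U ∈ F, U ≠ U₀ → ∃ U' ∈ F, ∃ x, x ∉ U' ∧ U = U' ⊔ K ∙ x ∧
    colon μ U' x ∈ F ∧ mulTop μ (colon μ U' x) = ⊤

omit [FiniteDimensional K V] [FiniteDimensional K W] in
-- Lowers the base of a filtration by one generator, at the price of a single colon condition.
theorem IsRelFiltration.insert {U₀ : Submodule K V} {F : Set (Submodule K V)} {y : V}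
    (hy : y ∉ U₀) (hF : IsRelFiltration μ (U₀ ⊔ K ∙ y) F) (hL : colon μ U₀ y ∈ F)
    (hLtop : mulTop μ (colon μ U₀ y) = ⊤) : IsRelFiltration μ U₀ (insert U₀ F) := by
  refine ⟨Set.mem_insert _ _, Set.mem_insert_of_mem _ hF.top, ?_⟩
  intro U hU hne
  rw [Set.mem_insert_iff, or_iff_right hne] at hU
  by_cases h : U = U₀ ⊔ K ∙ y
  · exact ⟨U₀, Set.mem_insert _ _, y, hy, h, Set.mem_insert_of_mem _ hL, hLtop⟩
  · obtain ⟨U', hU', x, h1, h2, h3, h4⟩ := hF.step U hU h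
    exact ⟨U', Set.mem_insert_of_mem _ hU', x, h1, h2, Set.mem_insert_of_mem _ h3, h4⟩

namespace IsThreeMul

variable (hμ : IsThreeMul μ)
include hμ

omit [FiniteDimensional K V] [FiniteDimensional K W] in
theorem le_colon (U : Submodule K V) (x : V) : U ≤ colon μ U x := by
  intro u hu
  rw [mem_colon, hμ.comm]
  exact mul_mem_mulTop hu x

/-- Above a space generating a hyperplane of `W`, all spaces fit into a filtration. -/
theorem exists_step {U₁ U : Submodule K V} (h2 : 2 ≤ Module.finrank K (mulTop μ U₁)) (h : U₁ < U) :
    ∃ U' x, U₁ ≤ U' ∧ x ∉ U' ∧ U = U' ⊔ K ∙ x ∧ U₁ ≤ colon μ U' x ∧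
      mulTop μ (colon μ U' x) = ⊤ := by
  obtain ⟨U', x, h1, hx, rfl⟩ := exists_eq_sup_span_singleton h
  refine ⟨U', x, h1, hx, rfl, h1.trans (hμ.le_colon _ _), hμ.mulTop_eq _ ?_⟩
  have h3 := finrank_add_finrank_mulTop_le (μ := μ) U' x
  have h4 := Submodule.finrank_mono (mulTop_mono (μ := μ) h1)
  have := hμ.finrank_eq
  omega

/-- Since `hh' ∈ U₀V`, the colon space of `h` over `U₀` contains `U₀ + K h'`, and conversely. Spaces
strictly above `U₀ + K h` or `U₀ + K h'` are handled by `exists_step`, because these two spaces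
already generate at least a plane. The case `h = h'` with `h² ∈ U₀V` is allowed. -/
theorem isRelFiltration_pair {U₀ : Submodule K V} {h h' : V} (hh : h ∉ U₀) (hh' : h' ∉ U₀)
    (hmul : μ h h' ∈ mulTop μ U₀) (h2 : 2 ≤ Module.finrank K (mulTop μ (U₀ ⊔ K ∙ h)))
    (h2' : 2 ≤ Module.finrank K (mulTop μ (U₀ ⊔ K ∙ h')))
    (hL : mulTop μ (colon μ U₀ h) = ⊤) (hL' : mulTop μ (colon μ U₀ h') = ⊤) :
    IsRelFiltration μ U₀ {U | U = U₀ ∨ U₀ ⊔ K ∙ h ≤ U ∨ U₀ ⊔ K ∙ h' ≤ U} := by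
  have hle : ∀ {a b : V}, μ a b ∈ mulTop μ U₀ → U₀ ⊔ K ∙ b ≤ colon μ U₀ a := fun hab =>
    sup_le (hμ.le_colon _ _) ((Submodule.span_singleton_le_iff_mem _ _).2 hab)
  refine ⟨Or.inl rfl, Or.inr (Or.inl le_top), ?_⟩
  rintro U hU hne
  rcases hU with hU | hU | hU
  · exact absurd hU hne
  · rcases hU.eq_or_lt with rfl | hlt
    · exact ⟨U₀, Or.inl rfl, h, hh, rfl, Or.inr (Or.inr (hle hmul)), hL⟩
    · obtain ⟨U', x, h1, h3, h4, h5, h6⟩ := hμ.exists_step h2 hlt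
      exact ⟨U', Or.inr (Or.inl h1), x, h3, h4, Or.inr (Or.inl h5), h6⟩
  · rcases hU.eq_or_lt with rfl | hlt
    · exact ⟨U₀, Or.inl rfl, h', hh', rfl, Or.inr (Or.inl (hle (hμ.comm h h' ▸ hmul))), hL'⟩
    · obtain ⟨U', x, h1, h3, h4, h5, h6⟩ := hμ.exists_step h2' hlt
      exact ⟨U', Or.inr (Or.inr h1), x, h3, h4, Or.inr (Or.inr h5), h6⟩

omit [FiniteDimensional K V] [FiniteDimensional K W] in
theorem mulTop_ne_top_of_finrank {U : Submodule K V} (h : Module.finrank K (mulTop μ U) ≤ 2) :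
    Module.finrank K U + 2 ≤ Module.finrank K V := by
  by_contra hcon
  have := hμ.mulTop_eq U (by omega)
  rw [this, finrank_top, hμ.finrank_eq] at h
  omega

/-- Suppose `UV` lies in a line `D`. Then `U` has codimension exactly two, and on a complement the
pencil argument gives `v`, `w` with `vw ∈ D`. Hence `(U + Kv)V` lies in `D` plus the span of a
single product `vp`. Its dimension is at most two, although `U + Kv` is a hyperplane. -/
theorem two_le_finrank_mulTop [IsAlgClosed K] {U : Submodule K V}
    (hU : Module.finrank K V ≤ Module.finrank K U + 2) :
    2 ≤ Module.finrank K (mulTop μ U) := by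
  by_contra! hlt
  have h0 := hμ.mulTop_ne_top_of_finrank (U := U) (by omega)
  obtain ⟨P, hd, hs, hf⟩ := exists_compl_finrank U
  have hW := hμ.finrank_eq
  obtain ⟨D, hUD, hD⟩ : ∃ D : Submodule K W, mulTop μ U ≤ D ∧ Module.finrank K D = 1 := by
    rcases Nat.lt_or_ge 0 (Module.finrank K (mulTop μ U)) with h | h
    · exact ⟨_, le_rfl, by omega⟩
    · have hbot : mulTop μ U = ⊥ := Submodule.finrank_eq_zero.1 (by omega)
      have : Nontrivial W := Module.nontrivial_of_finrank_pos (R := K) (by omega)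
      obtain ⟨w, hw⟩ := exists_ne (0 : W)
      exact ⟨K ∙ w, hbot ▸ bot_le, finrank_span_singleton hw⟩
  obtain ⟨v, hv, hv0, w, hw, hw0, hvw⟩ := exists_mul_mem (μ := μ) (P := P) (Q := P) (D := D)
    (by omega) (by omega) (by rintro rfl; rw [finrank_bot] at hf; omega)
  have hvU := notMem_of_disjoint hd hv hv0
  have hwU := notMem_of_disjoint hd hw hw0
  have h1 := hμ.mulTop_eq (U ⊔ K ∙ v) (by rw [finrank_sup_span_singleton_of_notMem hvU]; omega)
  have h1' : (U ⊔ K ∙ w) ⊔ (⊤ : Submodule K V) = ⊤ := sup_top_eq _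
  obtain ⟨p, hp⟩ : ∃ p : V, U ⊔ K ∙ w ⊔ K ∙ p = ⊤ := by
    by_cases hU' : U ⊔ K ∙ w = ⊤
    · exact ⟨0, by rw [hU', top_sup_eq]⟩
    · obtain ⟨p, -, hp⟩ := SetLike.exists_of_lt (lt_top_iff_ne_top.2 hU')
      refine ⟨p, Submodule.eq_top_of_finrank_eq ?_⟩
      have h3 := Submodule.finrank_le (U ⊔ K ∙ w ⊔ K ∙ p)
      rw [finrank_sup_span_singleton_of_notMem hp, finrank_sup_span_singleton_of_notMem hwU] at *
      omega
  have h2 : mulTop μ (U ⊔ K ∙ v) ≤ D ⊔ K ∙ μ v p := by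
    rw [mulTop_sup, mulTop_span_singleton]
    refine sup_le (hUD.trans le_sup_left) ?_
    rintro _ ⟨z, rfl⟩
    have hz : z ∈ U ⊔ K ∙ w ⊔ K ∙ p := hp ▸ trivial
    have hle : U ⊔ K ∙ w ⊔ K ∙ p ≤ (D ⊔ K ∙ μ v p).comap (μ v) := by
      refine sup_le (sup_le ?_ ?_) ?_
      · intro u hu
        rw [Submodule.mem_comap, hμ.comm v u]
        exact Submodule.mem_sup_left (hUD (mul_mem_mulTop hu v))
      · rw [Submodule.span_singleton_le_iff_mem]
        exact Submodule.mem_sup_left hvw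
      · rw [Submodule.span_singleton_le_iff_mem]
        exact Submodule.mem_sup_right (Submodule.mem_span_singleton_self _)
    exact hle hz
  have h3 := Submodule.finrank_mono h2
  have h4 := Submodule.finrank_add_le_finrank_add_finrank D (K ∙ μ v p)
  have h5 := finrank_span_le_card (R := K) ({μ v p} : Set W)
  rw [Set.toFinset_singleton, Finset.card_singleton] at h5
  rw [h1, finrank_top] at h3
  omega

/-- A space generating a line of `W`, together with a hyperplane above it, fits into a
filtration. -/
theorem exists_isRelFiltration_of_finrank_eq_one [IsAlgClosed K] {U₀ H : Submodule K V}
    (h1 : Module.finrank K (mulTop μ U₀) = 1) (hH : U₀ ≤ H)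
    (hHV : Module.finrank K V ≤ Module.finrank K H + 1) :
    ∃ F, IsRelFiltration μ U₀ F ∧ H ∈ F := by
  have hW := hμ.finrank_eq
  have hcodim : Module.finrank K U₀ + 3 ≤ Module.finrank K V := by
    by_contra hcon
    have := hμ.two_le_finrank_mulTop (U := U₀) (by omega)
    omega
  induction hk : Module.finrank K V - Module.finrank K U₀ using Nat.strong_induction_on
    generalizing U₀ with
  | _ k ih =>
  -- A form `y` that contributes nothing beyond the line `U₀V` is absorbed into the base. Its colon
  -- space is all of `V`, and the codimension drops.
  by_cases hrec : ∃ y ∈ H, y ∉ U₀ ∧ LinearMap.range (μ y) ≤ mulTop μ U₀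
  · obtain ⟨y, hyH, hy, hyle⟩ := hrec
    have heq : mulTop μ (U₀ ⊔ K ∙ y) = mulTop μ U₀ := by
      rw [mulTop_sup, mulTop_span_singleton, sup_eq_left.2 hyle]
    have hfin := finrank_sup_span_singleton_of_notMem hy
    have hle : U₀ ⊔ K ∙ y ≤ H := sup_le hH ((Submodule.span_singleton_le_iff_mem _ _).2 hyH)
    have hcol : colon μ U₀ y = ⊤ := by
      rw [eq_top_iff]
      intro v _
      exact hyle ⟨v, rfl⟩
    have hcodim' : Module.finrank K ↥(U₀ ⊔ K ∙ y) + 3 ≤ Module.finrank K V := by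
      by_contra hcon
      have := hμ.two_le_finrank_mulTop (U := U₀ ⊔ K ∙ y) (by omega)
      rw [heq] at this
      omega
    obtain ⟨F, hF, hHF⟩ := ih _ (by omega) (by rw [heq]; exact h1) hle hcodim' rfl
    refine ⟨insert U₀ F, hF.insert hy (hcol ▸ hF.top) ?_, Set.mem_insert_of_mem _ hHF⟩
    rw [hcol]
    exact hμ.mulTop_eq _ (by rw [finrank_top]; omega)
  push Not at hrec
  have hrank : ∀ y ∈ H, y ∉ U₀ → 2 ≤ Module.finrank K (mulTop μ (U₀ ⊔ K ∙ y)) := by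
    intro y hyH hy
    have hlt : mulTop μ U₀ < mulTop μ (U₀ ⊔ K ∙ y) := by
      refine lt_of_le_of_ne (mulTop_mono le_sup_left) fun h => hrec y hyH hy ?_
      rw [h, ← mulTop_span_singleton]
      exact mulTop_mono le_sup_right
    have := Submodule.finrank_lt_finrank_of_lt hlt
    omega
  by_cases h4 : Module.finrank K U₀ + 4 ≤ Module.finrank K V
  -- A complement of `U₀` meets `H` in dimension at least three, whereas `W/U₀V` has dimension two,
  -- so some square can be made to vanish there.
  · obtain ⟨y, hyH, hy, hysq⟩ : ∃ y ∈ H, y ∉ U₀ ∧ μ y y ∈ mulTop μ U₀ := by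
      obtain ⟨P, hd, hs, hf⟩ := exists_compl_finrank U₀
      have hPH : U₀ ⊔ (P ⊓ H) = H := by
        rw [← sup_inf_assoc_of_le _ hH, hs, top_inf_eq]
      have hfin := Submodule.finrank_add_le_finrank_add_finrank U₀ (P ⊓ H)
      rw [hPH] at hfin
      obtain ⟨v, hv, hv0, hvsq⟩ := exists_sq_mem (μ := μ) (V₁ := P ⊓ H) (D₀ := mulTop μ U₀)
        (D₁ := ⊤) le_top (fun _ _ => trivial) (by rw [finrank_top]; omega)
      exact ⟨v, hv.2, notMem_of_disjoint hd hv.1 hv0, hvsq⟩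
    have hL : mulTop μ (colon μ U₀ y) = ⊤ := by
      by_cases hc : Module.finrank K V ≤ Module.finrank K (colon μ U₀ y) + 1
      · exact hμ.mulTop_eq _ hc
      -- A colon space of codimension two means that multiplication by `y` is onto `W/U₀V`. Hence
      -- `U₀ + K y` generates `W`, and since `y² ∈ U₀V` it is contained in the colon space.
      · have hsub : U₀ ⊔ K ∙ y ≤ colon μ U₀ y :=
          sup_le (hμ.le_colon _ _) ((Submodule.span_singleton_le_iff_mem _ _).2 hysq)
        have hle := mulTop_mono (μ := μ) hsub
        rw [eq_top_iff, ← mulTop_sup_eq_top (μ := μ) (U := U₀) (x := y) (by omega)]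
        exact hle
    exact ⟨_, hμ.isRelFiltration_pair hy hy hysq (hrank y hyH hy) (hrank y hyH hy) hL hL,
      Or.inr (Or.inl (sup_le hH ((Submodule.span_singleton_le_iff_mem _ _).2 hyH)))⟩
  -- now `U₀` has codimension three
  have hrank' : ∀ y, y ∉ U₀ → 2 ≤ Module.finrank K (mulTop μ (U₀ ⊔ K ∙ y)) := by
    intro y hy
    refine hμ.two_le_finrank_mulTop ?_
    rw [finrank_sup_span_singleton_of_notMem hy]
    omega
  -- The colon space of a good `h` is at least a hyperplane, or else `h` has a partner `h'` such
  -- that the colon spaces of `h` and `h'` are `U₀ + K h'` and `U₀ + K h`. In both cases the colon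
  -- space is again a member of the filtration defined below.
  let good : V → Prop := fun h => h ∉ U₀ ∧ (Module.finrank K V ≤ Module.finrank K (colon μ U₀ h) + 1
      ∨
    ∃ h', h' ∉ U₀ ∧ colon μ U₀ h = U₀ ⊔ K ∙ h' ∧ colon μ U₀ h' = U₀ ⊔ K ∙ h ∧
      mulTop μ (U₀ ⊔ K ∙ h') = ⊤ ∧ mulTop μ (U₀ ⊔ K ∙ h) = ⊤)
  have hplane : ∀ U, U₀ ≤ U → Module.finrank K V ≤ Module.finrank K U + 1 →
      ∃ h ∈ U, good h := by
    intro U hU hUV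
    obtain ⟨P, hd, hs, hf⟩ := exists_compl_finrank U₀
    have hPU : U₀ ⊔ (P ⊓ U) = U := by
      rw [← sup_inf_assoc_of_le _ hU, hs, top_inf_eq]
    have hfin := Submodule.finrank_add_le_finrank_add_finrank U₀ (P ⊓ U)
    rw [hPU] at hfin
    obtain ⟨v, hv, hv0, w, hw, hw0, hvw⟩ := exists_mul_mem (μ := μ) (P := P ⊓ U) (Q := P ⊓ U)
      (D := mulTop μ U₀) (by omega) (by omega)
      (by intro h; rw [h, finrank_bot] at hfin; omega)
    have hvU := notMem_of_disjoint hd hv.1 hv0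
    have hwU := notMem_of_disjoint hd hw.1 hw0
    by_cases hvc : Module.finrank K V ≤ Module.finrank K (colon μ U₀ v) + 1
    · exact ⟨v, hv.2, hvU, Or.inl hvc⟩
    by_cases hwc : Module.finrank K V ≤ Module.finrank K (colon μ U₀ w) + 1
    · exact ⟨w, hw.2, hwU, Or.inl hwc⟩
    have key : ∀ a b, b ∉ U₀ → μ a b ∈ mulTop μ U₀ →
        ¬ Module.finrank K V ≤ Module.finrank K (colon μ U₀ a) + 1 →
        colon μ U₀ a = U₀ ⊔ K ∙ b ∧ mulTop μ (U₀ ⊔ K ∙ a) = ⊤ := by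
      intro a b hb hab hna
      have hsub : U₀ ⊔ K ∙ b ≤ colon μ U₀ a :=
        sup_le (hμ.le_colon _ _) ((Submodule.span_singleton_le_iff_mem _ _).2 hab)
      have hb' := finrank_sup_span_singleton_of_notMem hb
      have hb'' := Submodule.finrank_mono hsub
      refine ⟨(Submodule.eq_of_le_of_finrank_le hsub (by omega)).symm, ?_⟩
      exact mulTop_sup_eq_top (by omega)
    obtain ⟨hv1, hv2⟩ := key v w hwU hvw hvc
    obtain ⟨hw1, hw2⟩ := key w v hvU (hμ.comm v w ▸ hvw) hwc
    exact ⟨v, hv.2, hvU, Or.inr ⟨w, hwU, hv1, hw1, hw2, hv2⟩⟩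
  refine ⟨{U | U = U₀ ∨ (U₀ ≤ U ∧ Module.finrank K V ≤ Module.finrank K U + 1) ∨
    ∃ h, good h ∧ U = U₀ ⊔ K ∙ h}, ⟨Or.inl rfl, Or.inr (Or.inl ⟨le_top, ?_⟩), ?_⟩,
    Or.inr (Or.inl ⟨hH, hHV⟩)⟩
  · rw [finrank_top]; omega
  · rintro U hU hne
    rcases hU with hU | ⟨hU, hUV⟩ | ⟨h, hg, rfl⟩
    · exact absurd hU hne
    · obtain ⟨h, hhU, hg⟩ := hplane U hU hUV
      have hfin := finrank_sup_span_singleton_of_notMem hg.1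
      have hle : U₀ ⊔ K ∙ h ≤ U := sup_le hU ((Submodule.span_singleton_le_iff_mem _ _).2 hhU)
      have hlt : U₀ ⊔ K ∙ h < U := by
        refine lt_of_le_of_ne hle fun heq => ?_
        rw [heq] at hfin
        omega
      obtain ⟨U', x, h5, h6, h7, h8, h9⟩ := hμ.exists_step (hrank' h hg.1) hlt
      have hcol := finrank_add_finrank_mulTop_le (μ := μ) U' x
      have hcol' := Submodule.finrank_mono (mulTop_mono (μ := μ) h5)
      have hr := hrank' h hg.1
      refine ⟨U', ?_, x, h6, h7, Or.inr (Or.inl ⟨le_sup_left.trans h8, by omega⟩), h9⟩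
      rcases h5.eq_or_lt with h10 | h10
      · exact Or.inr (Or.inr ⟨h, hg, h10.symm⟩)
      · refine Or.inr (Or.inl ⟨le_sup_left.trans h5, ?_⟩)
        have := Submodule.finrank_lt_finrank_of_lt h10
        omega
    · refine ⟨U₀, Or.inl rfl, h, hg.1, rfl, ?_⟩
      obtain ⟨hh, hc | ⟨h', h1', h2', h3', h4', h5'⟩⟩ := hg
      · exact ⟨Or.inr (Or.inl ⟨hμ.le_colon _ _, hc⟩), hμ.mulTop_eq _ hc⟩
      · refine ⟨Or.inr (Or.inr ⟨h', ⟨h1', Or.inr ⟨h, hh, h3', h2', h5', h4'⟩⟩, h2'⟩), ?_⟩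
        rw [h2']
        exact h4'

end IsThreeMul

end Multiplication

/-! ### Square-zero and exceptional elements -/

section Multiplication

variable {K V W : Type*} [Field K] [AddCommGroup V] [Module K V] [AddCommGroup W] [Module K W]
  {μ : V →ₗ[K] V →ₗ[K] W}

theorem mulTop_ker : mulTop μ (LinearMap.ker μ) = ⊥ := by
  rw [eq_bot_iff, mulTop_le]
  intro u hu v
  rw [LinearMap.mem_ker.1 hu]
  exact zero_mem _

theorem colon_ker (x : V) : colon μ (LinearMap.ker μ) x = LinearMap.ker (μ x) := by
  rw [colon, mulTop_ker, Submodule.comap_bot]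

variable [FiniteDimensional K V] [FiniteDimensional K W]

variable (μ) in
/-- `x` is not annihilated by `V`, and `x V` is a plane containing `Ann(x) V`. -/
structure IsExceptional (x : V) : Prop where
  notMem : x ∉ LinearMap.ker μ
  finrank_eq : Module.finrank K (LinearMap.range (μ x)) = 2
  le : mulTop μ (LinearMap.ker (μ x)) ≤ LinearMap.range (μ x)

namespace IsThreeMul

variable (hμ : IsThreeMul μ)
include hμ

omit [FiniteDimensional K V] in
theorem finrank_range_le (x : V) : Module.finrank K (LinearMap.range (μ x)) ≤ 3 :=
  hμ.finrank_eq ▸ Submodule.finrank_le _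

theorem isRelFiltration_ker_pair {p z : V} (hpz : μ p z = 0)
    (hp : 2 ≤ Module.finrank K (LinearMap.range (μ p)))
    (hz : 2 ≤ Module.finrank K (LinearMap.range (μ z)))
    (hp' : mulTop μ (LinearMap.ker (μ p)) = ⊤) (hz' : mulTop μ (LinearMap.ker (μ z)) = ⊤) :
    ∃ F, IsRelFiltration μ (LinearMap.ker μ) F := by
  have h : ∀ {x : V}, 2 ≤ Module.finrank K (LinearMap.range (μ x)) → x ∉ LinearMap.ker μ := by
    intro x hx hmem
    rw [LinearMap.mem_ker.1 hmem, LinearMap.range_zero, finrank_bot] at hx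
    omega
  refine ⟨_, hμ.isRelFiltration_pair (h hp) (h hz) (by rw [hpz]; exact zero_mem _) ?_ ?_ ?_ ?_⟩
  · rwa [mulTop_sup, mulTop_ker, bot_sup_eq, mulTop_span_singleton]
  · rwa [mulTop_sup, mulTop_ker, bot_sup_eq, mulTop_span_singleton]
  · rwa [colon_ker]
  · rwa [colon_ker]

/-- A nonexceptional square-zero element gives a filtration. -/
theorem exists_isRelFiltration_ker_of_sq [IsAlgClosed K] {x : V} (hx : x ∉ LinearMap.ker μ)
    (hsq : μ x x = 0) (hne : ¬ IsExceptional μ x) :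
    ∃ F, IsRelFiltration μ (LinearMap.ker μ) F := by
  have hker : LinearMap.ker μ ≤ LinearMap.ker (μ x) := colon_ker (μ := μ) x ▸ hμ.le_colon _ _
  have hdim := LinearMap.finrank_range_add_finrank_ker (μ x)
  have h3 := hμ.finrank_range_le x
  have hW := hμ.finrank_eq
  have h0 : 0 < Module.finrank K (LinearMap.range (μ x)) := by
    rw [Nat.pos_iff_ne_zero, Ne, Submodule.finrank_eq_zero, LinearMap.range_eq_bot]
    exact hx
  have hrange : LinearMap.range (μ x) ≤ mulTop μ (LinearMap.ker (μ x)) := by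
    rw [← mulTop_span_singleton]
    exact mulTop_mono ((Submodule.span_singleton_le_iff_mem _ _).2 hsq)
  -- Rank one: `Ann(x)` is a hyperplane above `ker μ + K x`, and the latter generates a line. Rank
  -- two: `Ann(x)V` contains the plane `xV` because `x ∈ Ann(x)`, and it is larger because `x` is
  -- not exceptional. Rank three: `xV` is already `W`.
  rcases (by omega : Module.finrank K (LinearMap.range (μ x)) = 1 ∨
    Module.finrank K (LinearMap.range (μ x)) = 2 ∨
    Module.finrank K (LinearMap.range (μ x)) = 3) with h | h | h
  · obtain ⟨F, hF, hHF⟩ := hμ.exists_isRelFiltration_of_finrank_eq_one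
      (U₀ := LinearMap.ker μ ⊔ K ∙ x) (H := LinearMap.ker (μ x))
      (by rwa [mulTop_sup, mulTop_ker, bot_sup_eq, mulTop_span_singleton])
      (sup_le hker ((Submodule.span_singleton_le_iff_mem _ _).2 hsq)) (by omega)
    refine ⟨_, hF.insert hx (by rwa [colon_ker]) ?_⟩
    rw [colon_ker]
    exact hμ.mulTop_eq _ (by omega)
  · have htop : mulTop μ (LinearMap.ker (μ x)) = ⊤ := by
      by_contra hcon
      refine hne ⟨hx, h, ?_⟩
      have h4 := Submodule.finrank_lt hcon
      rw [Submodule.eq_of_le_of_finrank_le hrange (by omega)]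
    exact hμ.isRelFiltration_ker_pair hsq (by omega) (by omega) htop htop
  · have htop : LinearMap.range (μ x) = ⊤ := Submodule.eq_top_of_finrank_eq (by omega)
    rw [htop, top_le_iff] at hrange
    exact hμ.isRelFiltration_ker_pair hsq (by omega) (by omega) hrange hrange

omit hμ [FiniteDimensional K V] [FiniteDimensional K W] in
theorem _root_.IsExceptional.mul_mem {x : V} (hx : IsExceptional μ x) {v : V} (hv : μ x v = 0)
    (w : V) : μ v w ∈ LinearMap.range (μ x) :=
  hx.le (mul_mem_mulTop (LinearMap.mem_ker.2 hv) w)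

omit hμ [FiniteDimensional K W] in
theorem _root_.IsExceptional.finrank_ker {x : V} (hx : IsExceptional μ x) :
    Module.finrank K (LinearMap.ker (μ x)) + 2 = Module.finrank K V := by
  rw [← LinearMap.finrank_range_add_finrank_ker (μ x), hx.finrank_eq, add_comm]

omit [FiniteDimensional K W] in
-- Otherwise `Ann(x) + K v` would be a hyperplane, yet it generates only a subspace of the plane
-- `xV`.
theorem mul_eq_zero_of_forall_mem {x : V} (hx : IsExceptional μ x) {v : V}
    (hv : ∀ w, μ v w ∈ LinearMap.range (μ x)) : μ x v = 0 := by
  by_contra hne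
  have hfin := finrank_sup_span_singleton_of_notMem (U := LinearMap.ker (μ x)) (x := v) hne
  have := hx.finrank_ker
  have htop := hμ.mulTop_eq (LinearMap.ker (μ x) ⊔ K ∙ v) (by omega)
  have hle : mulTop μ (LinearMap.ker (μ x) ⊔ K ∙ v) ≤ LinearMap.range (μ x) := by
    rw [mulTop_sup, mulTop_span_singleton]
    refine sup_le hx.le ?_
    rintro _ ⟨w, rfl⟩
    exact hv w
  have h := Submodule.finrank_mono hle
  rw [htop, finrank_top, hμ.finrank_eq, hx.finrank_eq] at h
  omega

omit [FiniteDimensional K W] in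
/-- Exceptional elements with product zero generate the same annihilator. -/
theorem ker_eq_of_mul_eq_zero {x y : V} (hx : IsExceptional μ x) (hy : IsExceptional μ y)
    (hxy : μ x y = 0) : LinearMap.range (μ y) = LinearMap.range (μ x) ∧
      ∀ v, μ y v = 0 → μ x v = 0 := by
  have hr : LinearMap.range (μ y) = LinearMap.range (μ x) := by
    refine Submodule.eq_of_le_of_finrank_le ?_ (by rw [hx.finrank_eq, hy.finrank_eq])
    rintro _ ⟨w, rfl⟩
    exact hx.mul_mem hxy w
  refine ⟨hr, fun v hv => hμ.mul_eq_zero_of_forall_mem hx fun w => ?_⟩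
  rw [← hr]
  exact hy.mul_mem hv w

/-- Let `Q` be a complement of `Ann(x)` and `D` a complement of `xV`. The pencil spanned by `x` and
`y`, acting from `Q` to `W/D` (both of dimension two), has a singular member `h`, say `hw ∈ D` with
`0 ≠ w ∈ Q`. If `h` did not annihilate `V` it would be exceptional with `hV = xV`. Then `hw = 0`,
which forces `xw = 0` and contradicts the choice of `Q`. So `h ∈ ker μ`, and `y` can be solved for.
-/
theorem mem_sup_of_mul_eq_zero [IsAlgClosed K]
    (hE : ∀ x, x ∉ LinearMap.ker μ → μ x x = 0 → IsExceptional μ x) {x y : V}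
    (hx : x ∉ LinearMap.ker μ) (hxx : μ x x = 0) (hyy : μ y y = 0) (hxy : μ x y = 0) :
    y ∈ LinearMap.ker μ ⊔ K ∙ x := by
  by_cases hdep : ∃ a : K, a • x = y
  · obtain ⟨a, rfl⟩ := hdep
    exact Submodule.mem_sup_right (Submodule.smul_mem _ _ (Submodule.mem_span_singleton_self x))
  have hx0 : x ≠ 0 := fun h => hx (h ▸ zero_mem _)
  have hli : LinearIndependent K ![x, y] := by
    rw [LinearIndependent.pair_iff' hx0]
    push Not at hdep
    exact hdep
  have hxe := hE x hx hxx
  have hxk := hxe.finrank_ker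
  have hW := hμ.finrank_eq
  obtain ⟨D, hDd, hDs, hDf⟩ := exists_compl_finrank (LinearMap.range (μ x))
  obtain ⟨Q, hQd, hQs, hQf⟩ := exists_compl_finrank (LinearMap.ker (μ x))
  rw [hxe.finrank_eq] at hDf
  obtain ⟨h, hh, hh0, w, hw, hw0, hhw⟩ := exists_mul_mem (μ := μ)
    (P := Submodule.span K (Set.range ![x, y])) (Q := Q) (D := D)
    (by rw [finrank_span_eq_card hli]; simp) (by omega)
    (by rintro rfl; rw [finrank_bot] at hQf; omega)
  have hwx : μ x w ≠ 0 := notMem_of_disjoint hQd hw hw0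
  rw [Matrix.range_cons_cons_empty, Submodule.mem_span_pair] at hh
  obtain ⟨s, t, rfl⟩ := hh
  have hyx : μ y x = 0 := by rw [hμ.comm, hxy]
  have hsq : μ (s • x + t • y) (s • x + t • y) = 0 := by
    simp [hxx, hyy, hxy, hyx]
  have hxh : μ x (s • x + t • y) = 0 := by simp [hxx, hxy]
  have hker : s • x + t • y ∈ LinearMap.ker μ := by
    by_contra hnot
    have he := hE _ hnot hsq
    obtain ⟨h1, h2⟩ := hμ.ker_eq_of_mul_eq_zero hxe he hxh
    refine hwx (h2 w ?_)
    refine Submodule.disjoint_def.1 hDd _ ?_ hhw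
    rw [← h1]
    exact ⟨w, rfl⟩
  have ht : t ≠ 0 := by
    rintro rfl
    rw [zero_smul, add_zero] at hker hh0
    have hs : s ≠ 0 := by rintro rfl; simp at hh0
    exact hx ((Submodule.smul_mem_iff _ hs).1 hker)
  have : y = t⁻¹ • (s • x + t • y) + (-(t⁻¹ * s)) • x := by
    rw [smul_add, smul_smul, smul_smul, inv_mul_cancel₀ ht]
    module
  rw [this]
  exact add_mem (Submodule.mem_sup_left (Submodule.smul_mem _ _ hker))
    (Submodule.mem_sup_right (Submodule.smul_mem _ _ (Submodule.mem_span_singleton_self x)))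

omit [FiniteDimensional K W] in
-- The planes `xV` and `vV` are distinct, since equality would give `xv = 0`. They therefore meet in
-- a line, which contains `xv`.
theorem exists_smul_of_mem_inf {x v : V} {a : W} (hx : IsExceptional μ x) (hv : IsExceptional μ v)
    (hxv : μ x v ≠ 0) (h1 : a ∈ LinearMap.range (μ x)) (h2 : a ∈ LinearMap.range (μ v)) :
    ∃ c : K, a = c • μ x v := by
  have hlt : LinearMap.range (μ x) ⊓ LinearMap.range (μ v) < LinearMap.range (μ x) := by
    refine lt_of_le_of_ne inf_le_left fun h => hxv ?_
    have hle : LinearMap.range (μ x) ≤ LinearMap.range (μ v) := by rw [← h]; exact inf_le_right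
    have heq := Submodule.eq_of_le_of_finrank_le hle (by rw [hx.finrank_eq, hv.finrank_eq])
    exact hμ.mul_eq_zero_of_forall_mem hx fun w => heq ▸ ⟨w, rfl⟩
  have hfin := Submodule.finrank_lt_finrank_of_lt hlt
  rw [hx.finrank_eq] at hfin
  have hmem : μ x v ∈ LinearMap.range (μ x) ⊓ LinearMap.range (μ v) :=
    ⟨⟨v, rfl⟩, ⟨x, hμ.comm v x⟩⟩
  have hle : K ∙ μ x v ≤ LinearMap.range (μ x) ⊓ LinearMap.range (μ v) :=
    (Submodule.span_singleton_le_iff_mem _ _).2 hmem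
  have heq := Submodule.eq_of_le_of_finrank_le hle (by rw [finrank_span_singleton hxv]; omega)
  have : a ∈ K ∙ μ x v := heq ▸ ⟨h1, h2⟩
  obtain ⟨c, hc⟩ := Submodule.mem_span_singleton.1 this
  exact ⟨c, hc.symm⟩

/-- Suppose all squares lie in every such `xV`. Square-zero elements `x`, `v`, `w`, independent
modulo `ker μ`, can be chosen successively: squares lie in `W`, then in `xV`, then in the line `K
xv`, while the available complements have dimension at least 4, 3, 2. Polarisation forces
characteristic two. There all squares vanish, and an element of `Ann(x)` outside `ker μ + K x`
contradicts `mem_sup_of_mul_eq_zero`. -/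
theorem exists_sq_notMem_range [IsAlgClosed K]
    (h4 : Module.finrank K (LinearMap.ker μ) + 4 ≤ Module.finrank K V)
    (hE : ∀ x, x ∉ LinearMap.ker μ → μ x x = 0 → IsExceptional μ x) :
    ∃ x v, IsExceptional μ x ∧ μ x x = 0 ∧ μ v v ∉ LinearMap.range (μ x) := by
  by_contra! hcon
  have hW := hμ.finrank_eq
  have hsq : ∀ x, x ∉ LinearMap.ker μ → μ x x = 0 → ∀ v, μ v v ∈ LinearMap.range (μ x) :=
    fun x hx hxx v => hcon x v (hE x hx hxx) hxx
  -- three independent square-zero elements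
  obtain ⟨P, hd, hs, hf⟩ := exists_compl_finrank (LinearMap.ker μ)
  obtain ⟨x, hxP, hx0, hxx⟩ := exists_sq_mem (μ := μ) (V₁ := P) (D₀ := ⊥) (D₁ := ⊤) le_top
    (fun _ _ => trivial) (by rw [finrank_top, finrank_bot]; omega)
  have hx := notMem_of_disjoint hd hxP hx0
  rw [Submodule.mem_bot] at hxx
  have hxe := hE x hx hxx
  have hTx := finrank_sup_span_singleton_of_notMem hx
  obtain ⟨P', hd', hs', hf'⟩ := exists_compl_finrank (LinearMap.ker μ ⊔ K ∙ x)
  obtain ⟨v, hvP, hv0, hvv⟩ := exists_sq_mem (μ := μ) (V₁ := P') (D₀ := ⊥)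
    (D₁ := LinearMap.range (μ x)) bot_le (fun v _ => hsq x hx hxx v)
    (by rw [hxe.finrank_eq, finrank_bot]; omega)
  have hv := notMem_of_disjoint hd' hvP hv0
  rw [Submodule.mem_bot] at hvv
  have hvT : v ∉ LinearMap.ker μ := fun h => hv (Submodule.mem_sup_left h)
  have hve := hE v hvT hvv
  have hxv : μ x v ≠ 0 := fun h => hv (hμ.mem_sup_of_mul_eq_zero hE hx hxx hvv h)
  have hTv := finrank_sup_span_singleton_of_notMem hv
  obtain ⟨P'', hd'', hs'', hf''⟩ := exists_compl_finrank (LinearMap.ker μ ⊔ K ∙ x ⊔ K ∙ v)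
  obtain ⟨w, hwP, hw0, hww⟩ := exists_sq_mem (μ := μ) (V₁ := P'') (D₀ := ⊥)
    (D₁ := K ∙ μ x v) bot_le (fun a _ => by
      obtain ⟨c, hc⟩ := hμ.exists_smul_of_mem_inf hxe hve hxv (hsq x hx hxx a) (hsq v hvT hvv a)
      rw [hc]
      exact Submodule.smul_mem _ _ (Submodule.mem_span_singleton_self _))
    (by rw [finrank_span_singleton hxv, finrank_bot]; omega)
  have hw := notMem_of_disjoint hd'' hwP hw0
  rw [Submodule.mem_bot] at hww
  have hwTx : w ∉ LinearMap.ker μ ⊔ K ∙ x := fun h => hw (Submodule.mem_sup_left h)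
  have hwT : w ∉ LinearMap.ker μ := fun h => hwTx (Submodule.mem_sup_left h)
  have hwe := hE w hwT hww
  have hxw : μ x w ≠ 0 := fun h => hwTx (hμ.mem_sup_of_mul_eq_zero hE hx hxx hww h)
  -- If two is invertible, products are combinations of squares, so `V·V` would lie in the plane
  -- `xV`.
  have h2 : (2 : K) = 0 := by
    by_contra h2
    have hle : mulTop μ ⊤ ≤ LinearMap.range (μ x) := by
      rw [mulTop_le]
      intro a _ b
      have h := sub_mem (sub_mem (hsq x hx hxx (a + b)) (hsq x hx hxx a)) (hsq x hx hxx b)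
      have h' : μ (a + b) (a + b) - μ a a - μ b b = (2 : K) • μ a b := by
        simp only [map_add, LinearMap.add_apply, hμ.comm b a]
        module
      rw [h'] at h
      exact (Submodule.smul_mem_iff _ h2).1 h
    have h := Submodule.finrank_mono hle
    rw [hμ.mulTop_eq ⊤ (by rw [finrank_top]; omega), finrank_top, hxe.finrank_eq] at h
    omega
  have hall : ∀ a, μ a a = 0 := by
    intro a
    by_contra ha
    obtain ⟨c, hc⟩ := hμ.exists_smul_of_mem_inf hxe hve hxv (hsq x hx hxx a) (hsq v hvT hvv a)
    obtain ⟨c', hc'⟩ := hμ.exists_smul_of_mem_inf hxe hwe hxw (hsq x hx hxx a) (hsq w hwT hww a)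
    have hc0 : c' ≠ 0 := by rintro rfl; rw [zero_smul] at hc'; exact ha hc'
    -- Both `c xv` and `c' xw` equal `a²`. In characteristic two the difference `c v - c' w` also
    -- has square zero, so it lies in `ker μ + K x`, against the independence of `w`.
    have h0 : μ x (c • v - c' • w) = 0 := by
      rw [map_sub, map_smul, map_smul, ← hc, ← hc', sub_self]
    have hsq0 : μ (c • v - c' • w) (c • v - c' • w) = 0 := by
      have : μ (c • v - c' • w) (c • v - c' • w) = (c * c) • μ v v + (c' * c') • μ w w -
          (2 * (c * c')) • μ v w := by
        simp only [map_sub, map_smul, LinearMap.sub_apply, LinearMap.smul_apply, hμ.comm w v]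
        module
      rw [this, hvv, hww, h2]
      simp
    have hmem := hμ.mem_sup_of_mul_eq_zero hE hx hxx hsq0 h0
    refine hw ((Submodule.smul_mem_iff _ hc0).1 ?_)
    have : c' • w = c • v - (c • v - c' • w) := by module
    rw [this]
    exact sub_mem (Submodule.mem_sup_right
      (Submodule.smul_mem _ _ (Submodule.mem_span_singleton_self v))) (Submodule.mem_sup_left hmem)
  obtain ⟨y, hy, hyT⟩ : ∃ y ∈ LinearMap.ker (μ x), y ∉ LinearMap.ker μ ⊔ K ∙ x := by
    by_contra! h
    have := Submodule.finrank_mono (show LinearMap.ker (μ x) ≤ LinearMap.ker μ ⊔ K ∙ x from h)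
    have := hxe.finrank_ker
    omega
  exact hyT (hμ.mem_sup_of_mul_eq_zero hE hx hxx (hall y) hy)

end IsThreeMul

end Multiplication

/-! ### The case in which all square-zero elements are exceptional -/

section Multiplication

variable {K V W : Type*} [Field K] [AddCommGroup V] [Module K V] [AddCommGroup W] [Module K W]
  {μ : V →ₗ[K] V →ₗ[K] W}

/-- A nonzero quadratic and a nonzero linear polynomial have a common non-root over an infinite
field. -/
theorem exists_quadratic_linear_ne_zero {K : Type*} [Field K] [Infinite K] {a b c d e : K}
    (h1 : a ≠ 0 ∨ b ≠ 0 ∨ c ≠ 0) (h2 : d ≠ 0 ∨ e ≠ 0) :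
    ∃ t : K, a + b * t + c * t ^ 2 ≠ 0 ∧ d + e * t ≠ 0 := by
  open Polynomial in
  have hp : (C a + C b * X + C c * X ^ 2 : K[X]) ≠ 0 := by
    intro h
    have h0 := congrArg (fun p => p.coeff 0) h
    have h1' := congrArg (fun p => p.coeff 1) h
    have h2' := congrArg (fun p => p.coeff 2) h
    simp [coeff_X, coeff_C] at h0 h1' h2'
    tauto
  open Polynomial in
  have hq : (C d + C e * X : K[X]) ≠ 0 := by
    intro h
    have h0 := congrArg (fun p => p.coeff 0) h
    have h1' := congrArg (fun p => p.coeff 1) h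
    simp [coeff_X, coeff_C] at h0 h1'
    tauto
  by_contra! hcon
  refine mul_ne_zero hp hq (Polynomial.funext fun t => ?_)
  by_cases ht : a + b * t + c * t ^ 2 = 0
  · simp [ht]
  · simp [hcon t ht]

theorem eq_top_of_ker_le {S : Submodule K W} {φ : W →ₗ[K] K} {e f w : W} (hφ : ∀ u, φ u = 0 →
    ∃ a b : K, u = a • e + b • f) (he : e ∈ S) (hf : f ∈ S) (hw : w ∈ S) (hφw : φ w ≠ 0) :
    S = ⊤ := by
  rw [eq_top_iff]
  intro u _
  obtain ⟨a, b, h⟩ := hφ (u - (φ u / φ w) • w) (by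
    rw [map_sub, map_smul, smul_eq_mul, div_mul_cancel₀ _ hφw, sub_self])
  rw [← sub_add_cancel u ((φ u / φ w) • w), h]
  exact add_mem (add_mem (S.smul_mem _ he) (S.smul_mem _ hf)) (S.smul_mem _ hw)

theorem two_le_finrank_range [FiniteDimensional K W] {φ : W →ₗ[K] K} {p : V} {e w : W} (he0 : e ≠ 0)
    (hφe : φ e = 0) (he : e ∈ LinearMap.range (μ p)) (hw : w ∈ LinearMap.range (μ p))
    (hφw : φ w ≠ 0) : 2 ≤ Module.finrank K (LinearMap.range (μ p)) := by
  have hli : LinearIndependent K ![e, w] := by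
    rw [LinearIndependent.pair_iff' he0]
    rintro a rfl
    exact hφw (by rw [map_smul, hφe, smul_zero])
  have h := finrank_span_eq_card hli
  have hle : Submodule.span K (Set.range ![e, w]) ≤ LinearMap.range (μ p) := by
    rw [Submodule.span_le, Matrix.range_cons_cons_empty]
    rintro _ (rfl | rfl)
    · exact he
    · exact hw
  have := Submodule.finrank_mono hle
  rw [h] at this
  simpa using this

variable [FiniteDimensional K V] [FiniteDimensional K W]

namespace IsThreeMul

variable (hμ : IsThreeMul μ)
include hμ

omit [FiniteDimensional K V] in
theorem exists_functional_of_finrank {x : V} (hx : Module.finrank K (LinearMap.range (μ x)) = 2) :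
    ∃ φ : W →ₗ[K] K, ∀ u, φ u = 0 ↔ u ∈ LinearMap.range (μ x) := by
  obtain ⟨w, hw⟩ : ∃ w, w ∉ LinearMap.range (μ x) := by
    by_contra! h
    rw [Submodule.eq_top_iff'.2 h, finrank_top, hμ.finrank_eq] at hx
    omega
  obtain ⟨φ, hφw, hφ⟩ := Submodule.exists_le_ker_of_notMem (p := LinearMap.range (μ x)) hw
  have hker : LinearMap.range (μ x) = LinearMap.ker φ := by
    refine Submodule.eq_of_le_of_finrank_le hφ ?_
    have h1 := LinearMap.finrank_range_add_finrank_ker φ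
    have h2 : LinearMap.ker φ < ⊤ := by
      refine lt_top_iff_ne_top.2 fun h => hφw ?_
      rw [LinearMap.ker_eq_top.1 h, LinearMap.zero_apply]
    have h3 := Submodule.finrank_lt h2.ne
    have := hμ.finrank_eq
    omega
  exact ⟨φ, fun u => by rw [hker, LinearMap.mem_ker]⟩

/-- A functional with kernel the plane `x V` and the form `φ(u v)`, nondegenerate modulo
`Ann(x)`. -/
theorem exists_functional {x : V} (hx : IsExceptional μ x) :
    ∃ φ : W →ₗ[K] K, (∀ u, φ u = 0 ↔ u ∈ LinearMap.range (μ x)) ∧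
      (∀ u v, μ x u = 0 → φ (μ u v) = 0) ∧ ∀ u, (∀ v, φ (μ u v) = 0) → μ x u = 0 := by
  obtain ⟨φ, hiff⟩ := hμ.exists_functional_of_finrank hx.finrank_eq
  exact ⟨φ, hiff, fun u v hu => (hiff _).2 (hx.mul_mem hu v), fun u hu =>
    hμ.mul_eq_zero_of_forall_mem hx fun v => (hiff _).1 (hu v)⟩

/-- Let `φ` have kernel `xV`. The form `φ(uv)` is nondegenerate on the two-dimensional space
`V/Ann(x)` and, because of `v₀`, not alternating. An element `y ∈ Ann(x)` outside `ker μ + K x` has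
`0 ≠ y² = xd`. An orthogonal pair `p₀`, `q₀` with `d = q₀ + c p₀`, `c ≠ 0`, gives a basis `e = xp₀`,
`f = xq₀` of `xV` in which `y² = f + c e`. Adding multiples of `y` and `x` turns the pair into `p`,
`z` with `pz = 0`, such that `py` is a multiple of `e` and `zy` a multiple of `f`. Then `Ann(p)`
contains `z` and `y` minus a multiple of `x`. Their multiples yield `f`, then `f + c e`, then a
vector outside `xV`, so `Ann(p)V = W`. The argument for `z` is the same. -/
theorem exists_isRelFiltration_ker_of_exceptional [IsAlgClosed K]
    (h4 : Module.finrank K (LinearMap.ker μ) + 4 ≤ Module.finrank K V)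
    (hE : ∀ x, x ∉ LinearMap.ker μ → μ x x = 0 → IsExceptional μ x) :
    ∃ F, IsRelFiltration μ (LinearMap.ker μ) F := by
  have hW := hμ.finrank_eq
  obtain ⟨x, v₀, hx, hxx, hv₀⟩ := hμ.exists_sq_notMem_range h4 hE
  obtain ⟨φ, hφ, hφN, hφn⟩ := hμ.exists_functional hx
  have hφx : ∀ u, φ (μ x u) = 0 := fun u => (hφ _).2 ⟨u, rfl⟩
  have hφN' : ∀ u v, μ x u = 0 → φ (μ v u) = 0 := fun u v hu => by rw [hμ.comm, hφN u v hu]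
  have hcomm : ∀ u v, φ (μ u v) = φ (μ v u) := fun u v => by rw [hμ.comm]
  have hNdim := hx.finrank_ker
  obtain ⟨y, hxy, hyT⟩ : ∃ y ∈ LinearMap.ker (μ x), y ∉ LinearMap.ker μ ⊔ K ∙ x := by
    by_contra! h
    have := Submodule.finrank_mono (show LinearMap.ker (μ x) ≤ LinearMap.ker μ ⊔ K ∙ x from h)
    have := finrank_sup_span_singleton_of_notMem hx.notMem
    omega
  rw [LinearMap.mem_ker] at hxy
  have hyx : μ y x = 0 := by rw [hμ.comm, hxy]
  have hyy : μ y y ≠ 0 := fun h => hyT (hμ.mem_sup_of_mul_eq_zero hE hx.notMem hxx h hxy)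
  obtain ⟨d, hd⟩ := hx.mul_mem hxy y
  have hdN : d ∉ LinearMap.ker (μ x) := by
    rw [LinearMap.mem_ker, hd]
    exact hyy
  -- a complement of `Ann(x) + K d`
  have hdfin := finrank_sup_span_singleton_of_notMem hdN
  obtain ⟨d₂, -, hd₂⟩ : ∃ d₂ ∈ (⊤ : Submodule K V), d₂ ∉ LinearMap.ker (μ x) ⊔ K ∙ d := by
    by_contra! h
    have := Submodule.finrank_mono (show (⊤ : Submodule K V) ≤ LinearMap.ker (μ x) ⊔ K ∙ d from h)
    rw [finrank_top] at this
    omega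
  have hspan : ∀ {a : V}, a ∉ LinearMap.ker (μ x) ⊔ K ∙ d →
      ∀ v, ∃ (n : V) (s t : K), μ x n = 0 ∧ v = n + s • d + t • a := by
    intro a ha v
    have htop : LinearMap.ker (μ x) ⊔ K ∙ d ⊔ K ∙ a = ⊤ := by
      apply Submodule.eq_top_of_finrank_eq
      have := finrank_sup_span_singleton_of_notMem ha
      omega
    have hv : v ∈ LinearMap.ker (μ x) ⊔ K ∙ d ⊔ K ∙ a := htop ▸ trivial
    obtain ⟨m, hm, _, hta, rfl⟩ := Submodule.mem_sup.1 hv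
    obtain ⟨n, hn, _, hsd, rfl⟩ := Submodule.mem_sup.1 hm
    obtain ⟨t, rfl⟩ := Submodule.mem_span_singleton.1 hta
    obtain ⟨s, rfl⟩ := Submodule.mem_span_singleton.1 hsd
    exact ⟨n, s, t, hn, rfl⟩
  -- For `p₀ = d₂ + t d` the two polynomials in `t` are `φ(p₀²)` and `φ(p₀ d)`. The first is not
  -- identically zero because the form is not alternating, the second because `d ∉ Ann(x)`.
  obtain ⟨t, ht1, ht2⟩ := exists_quadratic_linear_ne_zero (K := K) (a := φ (μ d₂ d₂))
    (b := 2 * φ (μ d₂ d)) (c := φ (μ d d)) (d := φ (μ d₂ d)) (e := φ (μ d d)) (by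
      by_contra! h
      obtain ⟨n, s, t, hn, hv⟩ := hspan hd₂ v₀
      apply hv₀
      rw [← hφ, hv]
      simp only [map_add, map_smul, LinearMap.add_apply, LinearMap.smul_apply, hφN n _ hn,
        hφN' n _ hn, h.1, h.2.2, smul_eq_mul, hcomm d d₂]
      linear_combination s * t * h.2.1) (by
      by_contra! h
      refine hdN (hφn d fun v => ?_)
      obtain ⟨n, s, t, hn, rfl⟩ := hspan hd₂ v
      simp only [map_add, map_smul, hφN' n _ hn, h.2, hcomm d d₂, h.1, smul_zero, add_zero])
  set p₀ := d₂ + t • d with hp₀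
  have hg1 : φ (μ p₀ p₀) ≠ 0 := by
    convert ht1 using 1
    simp only [hp₀, map_add, map_smul, LinearMap.add_apply, LinearMap.smul_apply, smul_eq_mul,
      hcomm d d₂]
    ring
  have hg2 : φ (μ p₀ d) ≠ 0 := by
    convert ht2 using 1
    simp only [hp₀, map_add, map_smul, LinearMap.add_apply, LinearMap.smul_apply, smul_eq_mul]
    ring
  have hp₀N : p₀ ∉ LinearMap.ker (μ x) ⊔ K ∙ d := by
    intro h
    apply hd₂
    have : d₂ = p₀ - t • d := by rw [hp₀]; module
    rw [this]
    exact sub_mem h (Submodule.mem_sup_right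
      (Submodule.smul_mem _ _ (Submodule.mem_span_singleton_self d)))
  set c := φ (μ p₀ d) / φ (μ p₀ p₀) with hc
  have hc0 : c ≠ 0 := div_ne_zero hg2 hg1
  set q₀ := d - c • p₀ with hq₀
  have hg3 : φ (μ p₀ q₀) = 0 := by
    rw [hq₀, map_sub, map_smul, map_sub, map_smul, smul_eq_mul, hc, div_mul_cancel₀ _ hg1, sub_self]
  set e := μ x p₀ with he
  set f := μ x q₀ with hf
  have hyyef : μ y y = f + c • e := by
    rw [← hd, he, hf, hq₀, map_sub, map_smul, sub_add_cancel]
  have hD : ∀ u, φ u = 0 → ∃ a b : K, u = a • e + b • f := by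
    intro u hu
    obtain ⟨v, rfl⟩ := (hφ u).1 hu
    obtain ⟨n, s, t, hn, rfl⟩ := hspan hp₀N v
    have hdq : d = q₀ + c • p₀ := by rw [hq₀, sub_add_cancel]
    refine ⟨s * c + t, s, ?_⟩
    rw [hdq, he, hf]
    simp only [map_add, map_smul, hn]
    module
  have he0 : e ≠ 0 := fun h => hp₀N (Submodule.mem_sup_left h)
  have hf0 : f ≠ 0 := by
    intro h
    apply hp₀N
    have h1 : μ x d = c • e := by rw [hd, hyyef, h, zero_add]
    have h2 : p₀ = (p₀ - c⁻¹ • d) + c⁻¹ • d := by module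
    rw [h2]
    refine add_mem (Submodule.mem_sup_left ?_) (Submodule.mem_sup_right
      (Submodule.smul_mem _ _ (Submodule.mem_span_singleton_self d)))
    rw [LinearMap.mem_ker, map_sub, map_smul, h1, smul_smul, inv_mul_cancel₀ hc0, one_smul,
      sub_self]
  obtain ⟨α, β, h1⟩ := hD (μ y p₀) (hφN _ _ hxy)
  obtain ⟨α', β', h2⟩ := hD (μ y q₀) (hφN _ _ hxy)
  have h1' : μ p₀ y = α • e + β • f := by rw [hμ.comm, h1]
  have h2' : μ q₀ y = α' • e + β' • f := by rw [hμ.comm, h2]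
  obtain ⟨a₀, b₀, h3⟩ := hD (μ p₀ q₀) hg3
  have hpx : μ p₀ x = e := by rw [hμ.comm]
  have hqx : μ q₀ x = f := by rw [hμ.comm]
  -- `ξ` removes the `f`-component of `py` and `ξ'` removes the `e`-component of `zy`. Then `ζ` and
  -- `ζ'` remove the remaining `f`- and `e`-components of `pz`, using `x q₀ = f` and `p₀ x = e`.
  obtain ⟨ξ, hξ⟩ : ∃ ξ, ξ = -β := ⟨_, rfl⟩
  obtain ⟨ξ', hξ'⟩ : ∃ ξ', ξ' * c = -α' := ⟨-α' / c, div_mul_cancel₀ _ hc0⟩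
  obtain ⟨ζ', hζ'⟩ : ∃ ζ', ζ' = -(a₀ + ξ' * α + ξ * α' + ξ * ξ' * c) := ⟨_, rfl⟩
  obtain ⟨ζ, hζ⟩ : ∃ ζ, ζ = -(b₀ + ξ' * β + ξ * β' + ξ * ξ') := ⟨_, rfl⟩
  set p := p₀ + ξ • y + ζ • x with hp
  set z := q₀ + ξ' • y + ζ' • x with hz
  have hpz : μ p z = 0 := by
    simp only [hp, hz, map_add, map_smul, LinearMap.add_apply, LinearMap.smul_apply, h3, h1', h2,
      hpx,
      hyyef, hyx, hxy, hxx, ← hf, hζ, hζ']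
    module
  have hpy : μ p y = (α + ξ * c) • e := by
    simp only [hp, map_add, map_smul, LinearMap.add_apply, LinearMap.smul_apply, h1', hyyef, hxy,
      hξ]
    module
  have hzy : μ z y = (β' + ξ') • f := by
    simp only [hz, map_add, map_smul, LinearMap.add_apply, LinearMap.smul_apply, h2', hyyef, hxy]
    have : α' = -(ξ' * c) := by rw [hξ', neg_neg]
    rw [this]
    module
  have hpx' : μ p x = e := by
    simp only [hp, map_add, map_smul, LinearMap.add_apply, LinearMap.smul_apply, hpx, hyx, hxx]
    module
  have hzx' : μ z x = f := by
    simp only [hz, map_add, map_smul, LinearMap.add_apply, LinearMap.smul_apply, hqx, hyx, hxx]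
    module
  have hφp : ∀ u, φ (μ p u) = φ (μ p₀ u) := fun u => by
    simp only [hp, map_add, map_smul, LinearMap.add_apply, LinearMap.smul_apply, hφN y u hxy, hφx,
      smul_zero, add_zero]
  have hφz : ∀ u, φ (μ z u) = φ (μ q₀ u) := fun u => by
    simp only [hz, map_add, map_smul, LinearMap.add_apply, LinearMap.smul_apply, hφN y u hxy, hφx,
      smul_zero, add_zero]
  obtain ⟨w, hw⟩ : ∃ w, φ (μ q₀ w) ≠ 0 := by
    by_contra! h
    exact hf0 (hφn q₀ h)
  rw [← hφp] at hg1
  rw [← hφz] at hw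
  have hyA : ∀ s : K, μ (y - s • x) y = f + c • e := fun s => by
    rw [map_sub, map_smul, LinearMap.sub_apply, LinearMap.smul_apply, hxy, smul_zero, sub_zero,
      hyyef]
  refine hμ.isRelFiltration_ker_pair hpz
    (two_le_finrank_range he0 (hφx _) ⟨x, hpx'⟩ ⟨p₀, rfl⟩ hg1)
    (two_le_finrank_range hf0 (hφx _) ⟨x, hzx'⟩ ⟨w, rfl⟩ hw) ?_ ?_
  · have hz' : z ∈ LinearMap.ker (μ p) := hpz
    have hy' : y - (α + ξ * c) • x ∈ LinearMap.ker (μ p) := by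
      rw [LinearMap.mem_ker, map_sub, map_smul, hpy, hpx', sub_self]
    have hfm : f ∈ mulTop μ (LinearMap.ker (μ p)) := hzx' ▸ mul_mem_mulTop hz' x
    have hem : e ∈ mulTop μ (LinearMap.ker (μ p)) := by
      have h := sub_mem (mul_mem_mulTop (μ := μ) hy' y) hfm
      rw [hyA, add_sub_cancel_left] at h
      exact (Submodule.smul_mem_iff _ hc0).1 h
    exact eq_top_of_ker_le hD hem hfm (mul_mem_mulTop hz' w) hw
  · have hp' : p ∈ LinearMap.ker (μ z) := by rw [LinearMap.mem_ker, hμ.comm, hpz]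
    have hy' : y - (β' + ξ') • x ∈ LinearMap.ker (μ z) := by
      rw [LinearMap.mem_ker, map_sub, map_smul, hzy, hzx', sub_self]
    have hem : e ∈ mulTop μ (LinearMap.ker (μ z)) := hpx' ▸ mul_mem_mulTop hp' x
    have hfm : f ∈ mulTop μ (LinearMap.ker (μ z)) := by
      have h := sub_mem (mul_mem_mulTop (μ := μ) hy' y) (Submodule.smul_mem _ c hem)
      rwa [hyA, add_sub_cancel_right] at h
    exact eq_top_of_ker_le hD hem hfm (mul_mem_mulTop hp' p₀) hg1

/-- Filtrations exist when the annihilator of `V` has codimension at least four. -/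
theorem exists_isRelFiltration_ker [IsAlgClosed K]
    (h4 : Module.finrank K (LinearMap.ker μ) + 4 ≤ Module.finrank K V) :
    ∃ F, IsRelFiltration μ (LinearMap.ker μ) F := by
  by_cases hE : ∀ x, x ∉ LinearMap.ker μ → μ x x = 0 → IsExceptional μ x
  · exact hμ.exists_isRelFiltration_ker_of_exceptional h4 hE
  · push Not at hE
    obtain ⟨x, hx, hxx, hne⟩ := hE
    exact hμ.exists_isRelFiltration_ker_of_sq hx hxx hne

end IsThreeMul

end Multiplication

/-! ### Coordinate changes and trivial extensions -/

open MvPolynomial in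
theorem finrank_homogeneousSubmodule (K : Type*) [Field K] (σ : Type*) [Fintype σ] (d : ℕ) :
    Module.finrank K (homogeneousSubmodule σ K d) = (Fintype.card σ + d - 1).choose d := by
  classical
  have hdeg : ∀ e : σ →₀ ℕ, e ∈ Finset.univ.finsuppAntidiag d ↔ e.degree = d := by
    intro e
    simp [Finset.mem_finsuppAntidiag, Finsupp.degree_eq_sum]
  have hspan : homogeneousSubmodule σ K d = Submodule.span K
      (((Finset.univ.finsuppAntidiag d).image fun e => monomial e (1 : K) :
        Finset (MvPolynomial σ K)) : Set (MvPolynomial σ K)) := by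
    apply le_antisymm
    · intro f hf
      rw [as_sum f]
      refine sum_mem fun e he => ?_
      have : monomial e (f.coeff e) = f.coeff e • (monomial e 1 : MvPolynomial σ K) := by
        rw [smul_monomial, smul_eq_mul, mul_one]
      rw [this]
      refine Submodule.smul_mem _ _ (Submodule.subset_span ?_)
      rw [Finset.coe_image]
      refine ⟨e, ?_, rfl⟩
      rw [SetLike.mem_coe, hdeg]
      by_contra hne
      exact mem_support_iff.1 he (IsHomogeneous.coeff_eq_zero (d := e) hf hne)
    · rw [Submodule.span_le, Finset.coe_image]
      rintro _ ⟨e, he, rfl⟩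
      exact isHomogeneous_monomial _ ((hdeg e).1 he)
  have hinj : Function.Injective fun e : σ →₀ ℕ => (monomial e 1 : MvPolynomial σ K) :=
    monomial_left_injective one_ne_zero
  rw [hspan, finrank_span_finset_eq_card, Finset.card_image_of_injective _ hinj,
    Finset.card_finsuppAntidiag_nat_eq_choose, Finset.card_univ]
  have hli := (basisMonomials σ K).linearIndependent
  have : LinearIndepOn K id (Set.range fun e : σ →₀ ℕ => (monomial e 1 : MvPolynomial σ K)) := by
    have h2 := hli.linearIndepOn_id
    rwa [coe_basisMonomials] at h2
  refine this.mono ?_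
  rw [Finset.coe_image]
  exact Set.image_subset_range _ _

open MvPolynomial in
/-- Forms of degree `i + j` are combinations of products of forms of degrees `i` and `j`. -/
theorem homogeneousSubmodule_add {K : Type*} [Field K] {σ : Type*} (i j : ℕ) :
    homogeneousSubmodule σ K (i + j) = homogeneousSubmodule σ K i * homogeneousSubmodule σ K j := by
  have h : ∀ k, homogeneousSubmodule σ K k = homogeneousSubmodule σ K 1 ^ k := fun k =>
    (homogeneousSubmodule_one_pow _ k).symm
  rw [h (i + j), pow_add, ← h i, ← h j]

theorem homogeneousSubmodule_two_induction {K : Type*} [Field K] {σ : Type*}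
    {M : Submodule K (MvPolynomial σ K)}
    (h : ∀ i j, MvPolynomial.X i * MvPolynomial.X j ∈ M) :
    MvPolynomial.homogeneousSubmodule σ K 2 ≤ M := by
  rw [show 2 = 1 + 1 from rfl, homogeneousSubmodule_add,
    MvPolynomial.homogeneousSubmodule_one_eq_span_X, Submodule.span_mul_span, Submodule.span_le]
  rintro _ ⟨_, ⟨i, rfl⟩, _, ⟨j, rfl⟩, rfl⟩
  exact h i j

theorem linMul_eq_zero_iff {K : Type*} [Field K] {n : ℕ} {I : Ideal (MvPolynomial (Fin n) K)}
    {u v : Fin n → K} : linMul I u v = 0 ↔ linPoly u * linPoly v ∈ I := by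
  rw [← Ideal.Quotient.eq_zero_iff_mem, map_mul, Subtype.ext_iff, coe_linMul]
  rfl

theorem mem_ker_linMul_iff {K : Type*} [Field K] {n : ℕ} {I : Ideal (MvPolynomial (Fin n) K)}
    {u : Fin n → K} : u ∈ LinearMap.ker (linMul I) ↔ ∀ v, linPoly u * linPoly v ∈ I := by
  simp only [LinearMap.mem_ker, LinearMap.ext_iff, LinearMap.zero_apply, linMul_eq_zero_iff]

theorem mem_map_algEquiv_iff {K A B : Type*} [CommSemiring K] [CommRing A] [CommRing B] [Algebra K
    A]
    [Algebra K B] (φ : A ≃ₐ[K] B) {I : Ideal A} {f : B} :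
    f ∈ I.map (φ : A →+* B) ↔ φ.symm f ∈ I := by
  rw [Ideal.mem_map_iff_of_surjective (φ : A →+* B) φ.surjective]
  constructor
  · rintro ⟨x, hx, rfl⟩
    rw [RingHom.coe_coe, AlgEquiv.symm_apply_apply]
    exact hx
  · intro h
    exact ⟨_, h, φ.apply_symm_apply f⟩

section CoordChange

theorem linPoly_finsupp_single {K : Type*} [Field K] {σ : Type*} [Fintype σ] (i : σ) :
    linPoly (⇑(Finsupp.single i (1 : K))) = MvPolynomial.X i := by
  classical
  rw [Finsupp.single_eq_pi_single, linPoly_single]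

variable {K : Type*} [Field K] {σ τ : Type*} [Fintype σ] [Fintype τ] [DecidableEq σ]

theorem aeval_linPoly {A : Type*} [CommRing A] [Algebra K A] (f : (σ → K) →ₗ[K] A) (v : σ → K) :
    MvPolynomial.aeval (fun j => f (Pi.single j 1)) (linPoly v) = f v := by
  rw [linPoly_apply, map_sum]
  conv_rhs => rw [pi_eq_sum_univ' v, map_sum]
  refine Finset.sum_congr rfl fun i _ => ?_
  rw [map_mul, MvPolynomial.aeval_X, MvPolynomial.aeval_C, map_smul, Algebra.smul_def]

/-- The linear change of coordinates expressing linear forms in a given basis. -/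
noncomputable def coordChange [DecidableEq τ] (b : Module.Basis τ K (σ → K)) :
    MvPolynomial σ K ≃ₐ[K] MvPolynomial τ K :=
  AlgEquiv.ofAlgHom
    (MvPolynomial.aeval fun j => (linPoly ∘ₗ b.equivFun.toLinearMap) (Pi.single j 1))
    (MvPolynomial.aeval fun j => (linPoly ∘ₗ b.equivFun.symm.toLinearMap) (Pi.single j 1))
    (by
      apply MvPolynomial.algHom_ext
      intro i
      rw [AlgHom.comp_apply, MvPolynomial.aeval_X, LinearMap.comp_apply, aeval_linPoly]
      simp [linPoly_finsupp_single])
    (by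
      apply MvPolynomial.algHom_ext
      intro i
      rw [AlgHom.comp_apply, MvPolynomial.aeval_X, LinearMap.comp_apply, aeval_linPoly,
        LinearMap.comp_apply, LinearEquiv.coe_coe, LinearEquiv.coe_coe,
          LinearEquiv.symm_apply_apply,
        linPoly_single, AlgHom.id_apply])

variable [DecidableEq τ] (b : Module.Basis τ K (σ → K))

theorem coordChange_linPoly (v : σ → K) : coordChange b (linPoly v) = linPoly (b.equivFun v) := by
  change MvPolynomial.aeval (fun j => (linPoly ∘ₗ b.equivFun.toLinearMap) (Pi.single j 1))
    (linPoly v) = _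
  rw [aeval_linPoly, LinearMap.comp_apply, LinearEquiv.coe_coe]

theorem coordChange_basis (i : τ) : coordChange b (linPoly (b i)) = MvPolynomial.X i := by
  rw [coordChange_linPoly, ← linPoly_finsupp_single, Module.Basis.equivFun_apply,
    Module.Basis.repr_self]

theorem coordChange_symm_X (i : τ) :
    (coordChange b).symm (MvPolynomial.X i) = linPoly (b i) := by
  rw [AlgEquiv.symm_apply_eq, coordChange_basis]

theorem coordChange_X_isHomogeneous (i : σ) :
    (coordChange b (MvPolynomial.X i)).IsHomogeneous 1 := by
  rw [← linPoly_single, coordChange_linPoly]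
  exact linPoly_isHomogeneous _

theorem mem_map_coordChange {I : Ideal (MvPolynomial σ K)} {f : MvPolynomial τ K} :
    f ∈ I.map (coordChange b : MvPolynomial σ K →+* MvPolynomial τ K) ↔
      (coordChange b).symm f ∈ I :=
  mem_map_algEquiv_iff _

end CoordChange

theorem IsHomogeneous.aeval_linear {K : Type*} [Field K] {σ τ : Type*}
    {f : σ → MvPolynomial τ K} (hf : ∀ i, (f i).IsHomogeneous 1) {p : MvPolynomial σ K} {d : ℕ}
    (hp : p.IsHomogeneous d) : (MvPolynomial.aeval f p).IsHomogeneous d := by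
  have := hp.aeval f (fun i => hf i)
  simpa using this

section TrivialExtension

variable {K : Type*} [Field K] {n k r : ℕ} {I : Ideal (MvPolynomial (Fin n) K)}
  (b : Module.Basis (Fin k ⊕ Fin r) K (Fin n → K))

/-- The ideal of relations among the first `k` elements of a basis of linear forms. -/
noncomputable def restrictIdeal (I : Ideal (MvPolynomial (Fin n) K))
    (b : Module.Basis (Fin k ⊕ Fin r) K (Fin n → K)) : Ideal (MvPolynomial (Fin k) K) :=
  I.comap (MvPolynomial.aeval (R := K) fun i => linPoly (b (Sum.inl i)))

theorem coordChange_symm_rename (f : MvPolynomial (Fin k) K) :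
    (coordChange b).symm (MvPolynomial.rename Sum.inl f) =
      MvPolynomial.aeval (fun i => linPoly (b (Sum.inl i))) f := by
  have h : ((coordChange b).symm : _ →ₐ[K] _).comp (MvPolynomial.rename (Sum.inl : _ → _ ⊕ Fin r)) =
      MvPolynomial.aeval (R := K) (fun i : Fin k => linPoly (b (Sum.inl i))) := by
    apply MvPolynomial.algHom_ext
    intro i
    simp [coordChange_symm_X]
  exact congrArg (fun g => g f) h

/-- Setting the last `r` variables to zero. -/
noncomputable def killInr (K : Type*) [Field K] (k r : ℕ) :
    MvPolynomial (Fin k ⊕ Fin r) K →ₐ[K] MvPolynomial (Fin k) K :=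
  MvPolynomial.aeval (Sum.elim MvPolynomial.X fun _ => 0)

theorem killInr_rename (f : MvPolynomial (Fin k) K) :
    killInr K k r (MvPolynomial.rename Sum.inl f) = f := by
  have h : (killInr K k r).comp (MvPolynomial.rename Sum.inl) = AlgHom.id K _ := by
    apply MvPolynomial.algHom_ext
    intro i
    simp [killInr]
  exact congrArg (fun g => g f) h

theorem killInr_isHomogeneous {f : MvPolynomial (Fin k ⊕ Fin r) K} {d : ℕ}
    (hf : f.IsHomogeneous d) : (killInr K k r f).IsHomogeneous d := by
  refine IsHomogeneous.aeval_linear (fun i => ?_) hf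
  rcases i with i | i
  · exact MvPolynomial.isHomogeneous_X _ _
  · exact MvPolynomial.isHomogeneous_zero _ _ _

/-- A quadric agrees with its restriction up to products with the last variables. -/
theorem sub_rename_killInr_mem {f : MvPolynomial (Fin k ⊕ Fin r) K} (hf : f.IsHomogeneous 2) :
    f - MvPolynomial.rename Sum.inl (killInr K k r f) ∈
      Ideal.span {f : MvPolynomial (Fin k ⊕ Fin r) K | ∃ (i : Fin r) (j : Fin k ⊕ Fin r),
        f = MvPolynomial.X (Sum.inr i) * MvPolynomial.X j} := by
  let E := Ideal.span {f : MvPolynomial (Fin k ⊕ Fin r) K | ∃ (i : Fin r) (j : Fin k ⊕ Fin r),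
        f = MvPolynomial.X (Sum.inr i) * MvPolynomial.X j}
  let L : MvPolynomial (Fin k ⊕ Fin r) K →ₗ[K] MvPolynomial (Fin k ⊕ Fin r) K :=
    LinearMap.id - ((MvPolynomial.rename Sum.inl).comp (killInr K k r)).toLinearMap
  refine homogeneousSubmodule_two_induction (M := (E.restrictScalars K).comap L) ?_ hf
  intro i j
  change MvPolynomial.X i * MvPolynomial.X j -
    MvPolynomial.rename Sum.inl (killInr K k r (MvPolynomial.X i * MvPolynomial.X j)) ∈ E
  rcases i with i | i
  · rcases j with j | j
    · simp [killInr]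
    · simp only [killInr, map_mul, MvPolynomial.aeval_X, Sum.elim_inr, mul_zero, map_zero, sub_zero]
      rw [mul_comm]
      exact Ideal.subset_span ⟨_, _, rfl⟩
  · simp only [killInr, map_mul, MvPolynomial.aeval_X, Sum.elim_inr, zero_mul, map_zero, sub_zero]
    exact Ideal.subset_span ⟨_, _, rfl⟩

theorem span_inr_le (hT : ∀ i, b (Sum.inr i) ∈ LinearMap.ker (linMul I)) :
    Ideal.span {f : MvPolynomial (Fin k ⊕ Fin r) K | ∃ (i : Fin r) (j : Fin k ⊕ Fin r),
        f = MvPolynomial.X (Sum.inr i) * MvPolynomial.X j} ≤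
      I.map (coordChange b : MvPolynomial (Fin n) K →+* _) := by
  rw [Ideal.span_le]
  rintro _ ⟨i, j, rfl⟩
  rw [SetLike.mem_coe, mem_map_coordChange, map_mul, coordChange_symm_X, coordChange_symm_X]
  exact mem_ker_linMul_iff.1 (hT i) _

/-- Setting the last variables to zero changes a quadric only by products involving those variables,
and these products lie in the ideal because the corresponding forms annihilate `R₁`. -/
theorem killInr_coordChange_mem (hT : ∀ i, b (Sum.inr i) ∈ LinearMap.ker (linMul I))
    {g : MvPolynomial (Fin n) K} (hg : g ∈ I) (hg2 : g.IsHomogeneous 2) :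
    killInr K k r (coordChange b g) ∈ restrictIdeal I b := by
  have h2 : (coordChange b g).IsHomogeneous 2 := by
    refine IsHomogeneous.aeval_linear (fun i => ?_) hg2
    exact linPoly_isHomogeneous _
  have h1 := sub_rename_killInr_mem h2
  have h3 := sub_mem ((mem_map_coordChange b).2 (by rwa [AlgEquiv.symm_apply_apply]))
    (span_inr_le b hT h1)
  rw [sub_sub_cancel, mem_map_coordChange, coordChange_symm_rename] at h3
  exact h3

/-- The restrictions of quadric generators of `I` generate: restriction is a ring homomorphism that
is a left inverse to the inclusion of the first variables, so it carries an expression in terms of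
generators of `I` to one in terms of their restrictions. -/
theorem isQuadraticIdeal_restrictIdeal (hI : IsQuadraticIdeal I)
    (hT : ∀ i, b (Sum.inr i) ∈ LinearMap.ker (linMul I)) : IsQuadraticIdeal (restrictIdeal I b) :=
      by
  obtain ⟨G, hG, hIG⟩ := hI
  refine ⟨(fun g => killInr K k r (coordChange b g)) '' G, ?_, le_antisymm ?_ ?_⟩
  · rintro _ ⟨g, hg, rfl⟩
    exact killInr_isHomogeneous (IsHomogeneous.aeval_linear (fun i => linPoly_isHomogeneous _) (hG g
      hg))
  · intro f hf
    rw [← killInr_rename (r := r) f, ← (coordChange b).apply_symm_apply (MvPolynomial.rename _ f),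
      coordChange_symm_rename]
    have hf' : MvPolynomial.aeval (fun i => linPoly (b (Sum.inl i))) f ∈ I := hf
    generalize MvPolynomial.aeval (fun i => linPoly (b (Sum.inl i))) f = g at hf'
    rw [hIG] at hf'
    have := Ideal.mem_map_of_mem
      (((killInr K k r).comp (coordChange b : _ →ₐ[K] _) : _ →ₐ[K] _)) hf'
    rw [Ideal.map_span] at this
    exact this
  · rw [Ideal.span_le]
    rintro _ ⟨g, hg, rfl⟩
    exact killInr_coordChange_mem b hT (hIG ▸ Ideal.subset_span hg) (hG g hg)

/-- If all but `k` elements of a basis annihilate `R₁`, then `R` is a trivial extension of the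
subalgebra generated by these `k` elements. -/
theorem map_coordChange_eq_trivialExtensionIdeal (hI : IsQuadraticIdeal I)
    (hT : ∀ i, b (Sum.inr i) ∈ LinearMap.ker (linMul I)) :
    I.map (coordChange b : MvPolynomial (Fin n) K →+* _) =
      trivialExtensionIdeal (restrictIdeal I b) r := by
  apply le_antisymm
  · obtain ⟨G, hG, hIG⟩ := hI
    rw [Ideal.map_le_iff_le_comap]
    conv_lhs => rw [hIG]
    rw [Ideal.span_le]
    intro g hg
    rw [SetLike.mem_coe, Ideal.mem_comap]
    have h1 := sub_rename_killInr_mem (k := k) (r := r) (f := coordChange b g)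
      (IsHomogeneous.aeval_linear (fun i => linPoly_isHomogeneous _) (hG g hg))
    have h2 := killInr_coordChange_mem b hT (hIG ▸ Ideal.subset_span hg) (hG g hg)
    have h3 : coordChange b g = MvPolynomial.rename Sum.inl (killInr K k r (coordChange b g)) +
        (coordChange b g - MvPolynomial.rename Sum.inl (killInr K k r (coordChange b g))) := by ring
    change coordChange b g ∈ _
    rw [h3]
    exact add_mem (Ideal.mem_sup_left (Ideal.mem_map_of_mem _ h2)) (Ideal.mem_sup_right h1)
  · refine sup_le ?_ (span_inr_le b hT)
    rw [Ideal.map_le_iff_le_comap]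
    intro f hf
    rw [Ideal.mem_comap]
    change MvPolynomial.rename Sum.inl f ∈ _
    rw [mem_map_coordChange, coordChange_symm_rename]
    exact hf

/-- The subalgebra generated by the first `k` basis forms contains all of `R₂`, since products
involving the other basis forms vanish. -/
theorem finrank_gradedPiece_restrictIdeal
    (hT : ∀ i, b (Sum.inr i) ∈ LinearMap.ker (linMul I)) :
    Module.finrank K (gradedPiece (restrictIdeal I b) 2) = Module.finrank K (gradedPiece I 2) := by
  let ψ : (MvPolynomial (Fin k) K ⧸ restrictIdeal I b) →ₐ[K] (MvPolynomial (Fin n) K ⧸ I) :=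
    Ideal.quotientMapₐ I (MvPolynomial.aeval (R := K) fun i => linPoly (b (Sum.inl i))) le_rfl
  have hψ : Function.Injective ψ := Ideal.quotientMap_injective
  have hmk : ∀ f, ψ (Ideal.Quotient.mk _ f) =
      Ideal.Quotient.mk I (MvPolynomial.aeval (R := K) (fun i => linPoly (b (Sum.inl i))) f) :=
    fun _ => rfl
  have hmap : (gradedPiece (restrictIdeal I b) 2).map ψ.toLinearMap = gradedPiece I 2 := by
    apply le_antisymm
    · rintro _ ⟨_, ⟨f, hf, rfl⟩, rfl⟩
      exact ⟨_, IsHomogeneous.aeval_linear (fun i => linPoly_isHomogeneous _) hf, rfl⟩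
    · have h : ∀ a b' : Fin n → K, linForm I a * linForm I b' ∈
          (gradedPiece (restrictIdeal I b) 2).map ψ.toLinearMap := by
        intro x y
        have hx := b.sum_repr x
        have hy := b.sum_repr y
        rw [← hx, ← hy]
        simp only [map_sum, Finset.sum_mul_sum, map_smul]
        refine sum_mem fun i _ => sum_mem fun j _ => ?_
        rw [smul_mul_smul_comm]
        refine Submodule.smul_mem _ _ ?_
        rcases i with i | i
        · rcases j with j | j
          · refine ⟨Ideal.Quotient.mk _ (MvPolynomial.X i * MvPolynomial.X j),
              ⟨MvPolynomial.X i * MvPolynomial.X j,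
                (MvPolynomial.isHomogeneous_X K i).mul (MvPolynomial.isHomogeneous_X K j), rfl⟩, ?_⟩
            refine (hmk _).trans ?_
            rw [map_mul, map_mul, MvPolynomial.aeval_X, MvPolynomial.aeval_X]
            rfl
          · rw [mul_comm, ← coe_linMul, LinearMap.mem_ker.1 (hT j)]
            exact zero_mem _
        · rw [← coe_linMul, LinearMap.mem_ker.1 (hT i)]
          exact zero_mem _
      rw [show gradedPiece I 2 = gradedPiece I (1 + 1) from rfl, gradedPiece_add, Submodule.mul_le]
      intro x hx y hy
      rw [← range_linForm] at hx hy
      obtain ⟨x, rfl⟩ := hx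
      obtain ⟨y, rfl⟩ := hy
      exact h x y
  rw [← hmap]
  exact (Submodule.equivMapOfInjective ψ.toLinearMap hψ _).finrank_eq

end TrivialExtension

/-! ### Spaces of quadrics and cubics -/

/-- The quadrics in an ideal. -/
noncomputable def quadricsOf {K : Type*} [Field K] {σ : Type*} (J : Ideal (MvPolynomial σ K)) :
    Submodule K (MvPolynomial σ K) :=
  MvPolynomial.homogeneousSubmodule σ K 2 ⊓ J.restrictScalars K

theorem IsQuadraticIdeal.eq_span_quadricsOf {K : Type*} [Field K] {n : ℕ}
    {J : Ideal (MvPolynomial (Fin n) K)} (hJ : IsQuadraticIdeal J) :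
    J = Ideal.span (quadricsOf J) := by
  obtain ⟨G, hG, hJG⟩ := hJ
  apply le_antisymm
  · conv_lhs => rw [hJG]
    exact Ideal.span_mono fun g hg => ⟨hG g hg, by
      rw [hJG]
      exact Ideal.subset_span hg⟩
  · rw [Ideal.span_le]
    exact fun g hg => hg.2

theorem finrank_gradedPiece_add_finrank_quadricsOf {K : Type*} [Field K] {n : ℕ}
    (J : Ideal (MvPolynomial (Fin n) K)) :
    Module.finrank K (gradedPiece J 2) + Module.finrank K (quadricsOf J) = (n + 1).choose 2 := by
  have : Module.Finite K (MvPolynomial.homogeneousSubmodule (Fin n) K 2) :=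
    Module.Finite.iff_fg.2 (MvPolynomial.homogeneousSubmodule_fg _ _ 2)
  let f := (Ideal.Quotient.mkₐ K J).toLinearMap.domRestrict
    (MvPolynomial.homogeneousSubmodule (Fin n) K 2)
  have h := LinearMap.finrank_range_add_finrank_ker f
  have h1 : LinearMap.range f = gradedPiece J 2 := LinearMap.range_domRestrict _ _
  have h2 : (LinearMap.ker f).map (Submodule.subtype _) = quadricsOf J := by
    ext g
    constructor
    · rintro ⟨g, hg, rfl⟩
      exact ⟨g.2, Ideal.Quotient.eq_zero_iff_mem.1 hg⟩
    · rintro ⟨h1, h2⟩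
      exact ⟨⟨g, h1⟩, Ideal.Quotient.eq_zero_iff_mem.2 h2, rfl⟩
  rw [h1, (Submodule.equivMapOfInjective _ (Submodule.injective_subtype _) _).finrank_eq, h2,
    finrank_homogeneousSubmodule] at h
  simpa using h

open MvPolynomial in
/-- Three quadrics in three variables do not generate all cubics. -/
theorem exists_cubic_notMem {K : Type*} [Field K] {q : Fin 3 → MvPolynomial (Fin 3) K}
    (hq : ∀ i, (q i).IsHomogeneous 2) :
    ∃ f : MvPolynomial (Fin 3) K, f.IsHomogeneous 3 ∧ f ∉ Ideal.span (Set.range q) := by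
  by_contra! hcon
  -- In degree three the ideal consists of the sums `∑ lᵢ qᵢ` with `lᵢ` linear. They form a space of
  -- dimension at most `3·3 = 9`, while there are 10 cubic monomials.
  let L : (Fin 3 → Fin 3 → K) →ₗ[K] MvPolynomial (Fin 3) K :=
    ∑ i, (LinearMap.mulRight K (q i)) ∘ₗ linPoly ∘ₗ LinearMap.proj i
  have hle : homogeneousSubmodule (Fin 3) K 3 ≤ LinearMap.range L := by
    intro f hf
    obtain ⟨c, hc⟩ := Ideal.mem_span_range_iff_exists_fun.1 (hcon f hf)
    have h1 : ∀ i, ∃ v, linPoly v = homogeneousComponent 1 (c i) := fun i => by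
      have := homogeneousComponent_isHomogeneous 1 (c i)
      rwa [← mem_homogeneousSubmodule, ← range_linPoly] at this
    choose v hv using h1
    refine ⟨v, ?_⟩
    have h2 := congrArg (homogeneousComponent 3) hc
    rw [homogeneousComponent_eq_self hf, map_sum] at h2
    rw [← h2]
    simp only [L, LinearMap.sum_apply, LinearMap.comp_apply, LinearMap.proj_apply,
      LinearMap.mulRight_apply, hv]
    refine Finset.sum_congr rfl fun i _ => ?_
    rw [mul_comm (c i)]
    exact (mul_comm _ _).trans (homogeneousComponent_add_mul (hq i) (j := 1) (c i)).symm
  have h := Submodule.finrank_mono hle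
  have h' := LinearMap.finrank_range_le L
  rw [finrank_homogeneousSubmodule] at h
  have h3 : Module.finrank K (Fin 3 → Fin 3 → K) = 9 := by
    simp [Module.finrank_pi_fintype]
  rw [h3] at h'
  have h4 : (Fintype.card (Fin 3) + 3 - 1).choose 3 = 10 := by decide
  omega

/-! ### Koszulness -/

section Koszul

variable {K : Type*} [Field K] {n : ℕ} {I : Ideal (MvPolynomial (Fin n) K)}

theorem isThreeMul_linMul (hI : IsQuadraticIdeal I) [IsArtinianRing (MvPolynomial (Fin n) K ⧸ I)]
    (h3 : Module.finrank K (gradedPiece I 2) = 3) : IsThreeMul (linMul I) where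
  comm := linMul_comm I
  finrank_eq := h3
  mulTop_eq _ hU := map₂_linMul_eq_top hI hU

/-- A space of codimension at most two generates at least a plane, whereas `ker μ` generates zero.
-/
theorem IsThreeMul.finrank_ker_add_three_le [IsAlgClosed K] {V W : Type*} [AddCommGroup V]
    [Module K V] [AddCommGroup W] [Module K W] [FiniteDimensional K V] [FiniteDimensional K W]
    {μ : V →ₗ[K] V →ₗ[K] W} (hμ : IsThreeMul μ) :
    Module.finrank K (LinearMap.ker μ) + 3 ≤ Module.finrank K V := by
  by_contra h
  have := hμ.two_le_finrank_mulTop (U := LinearMap.ker μ) (by omega)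
  rw [mulTop_ker, finrank_bot] at this
  omega

/-- A criterion for Koszulness: it suffices to have a filtration above the annihilator of `R₁`. -/
theorem isKoszul_of_relative (hI : IsQuadraticIdeal I)
    [IsArtinianRing (MvPolynomial (Fin n) K ⧸ I)] {F : Set (Submodule K (Fin n → K))}
    (htop : ⊤ ∈ F)
    (hF : ∀ U ∈ F, U ≠ LinearMap.ker (linMul I) → ∃ U' ∈ F, ∃ x, x ∉ U' ∧ U = U' ⊔ K ∙ x ∧
      ∃ L ∈ F, ∀ r, r * linForm I x ∈ linIdeal I U' ↔ r ∈ linIdeal I L) : IsKoszul I := by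
  obtain ⟨π, hπ⟩ := hI.exists_isGradedProj
  refine isKoszul_of_filtration hI (F := F ∪ {U | U ≤ LinearMap.ker (linMul I)}) (Or.inl htop) ?_
  intro U hU hne
  by_cases hUT : U ≤ LinearMap.ker (linMul I)
  -- Below the annihilator any flag works: the added form multiplies `R₁` to zero, so the colon
  -- space is everything.
  · obtain ⟨U', x, -, hx, rfl⟩ := exists_eq_sup_span_singleton (bot_lt_iff_ne_bot.2 hne)
    have hxT : linMul I x = 0 :=
      hUT (Submodule.mem_sup_right (Submodule.mem_span_singleton_self x))
    have hL : (⊤ : Submodule K (Fin n → K)) =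
        (Submodule.map₂ (linMul I) U' ⊤).comap (linMul I x) := by
      rw [hxT, Submodule.comap_zero]
    exact ⟨U', Or.inr (le_sup_left.trans hUT), x, hx, rfl, ⊤, Or.inl htop,
      fun r => hπ.mul_mem_linIdeal_iff hI hx hL (map₂_linMul_top I) r⟩
  · obtain ⟨U', hU', x, h1, h2, L, hL, h3⟩ := hF U (hU.resolve_right hUT)
      (fun h => hUT h.le)
    exact ⟨U', Or.inl hU', x, h1, h2, L, Or.inl hL, h3⟩

theorem IsGradedProj.mem_linIdeal {π : ℕ → (MvPolynomial (Fin n) K ⧸ I) →+ _}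
    (hπ : IsGradedProj I π) {U : Submodule K (Fin n → K)} {a : MvPolynomial (Fin n) K ⧸ I}
    (ha : a ∈ linIdeal I U) (j : ℕ) : π j a ∈ linIdeal I U := by
  induction ha using Submodule.closure_induction with
  | zero => simp
  | add x y _ _ hx hy => rw [map_add]; exact add_mem hx hy
  | smul_mem a g hg =>
    obtain ⟨u, hu, rfl⟩ := hg
    rw [smul_eq_mul, mul_comm]
    cases j with
    | zero => rw [hπ.zero_linForm_mul]; exact zero_mem _
    | succ j =>
      rw [hπ.succ_linForm_mul]
      exact Ideal.mul_mem_right _ _ (linForm_mem_linIdeal hu)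

/-- The forms in `ker (linMul I)` annihilate `R₁`, so the ideal they generate is concentrated in
degree one. -/
theorem IsGradedProj.eq_zero_of_mem_linIdeal_ker {π : ℕ → (MvPolynomial (Fin n) K ⧸ I) →+ _}
    (hπ : IsGradedProj I π) {a : MvPolynomial (Fin n) K ⧸ I}
    (ha : a ∈ linIdeal I (LinearMap.ker (linMul I))) {j : ℕ} (haj : a ∈ gradedPiece I (j + 2)) :
    a = 0 := by
  rw [← hπ.of_mem _ _ haj]
  clear haj
  induction ha using Submodule.closure_induction with
  | zero => simp
  | add x y _ _ hx hy => rw [map_add, hx, hy, add_zero]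
  | smul_mem a g hg =>
    obtain ⟨u, hu, rfl⟩ := hg
    rw [smul_eq_mul, mul_comm, hπ.succ_linForm_mul]
    have h := hπ.mem (j + 1) a
    rw [add_comm, gradedPiece_add] at h
    rw [add_comm j 1]
    generalize π (1 + j) a = a at h
    induction h using Submodule.mul_induction_on' with
    | mem_mul_mem x hx y hy =>
      rw [← range_linForm] at hx
      obtain ⟨v, rfl⟩ := hx
      rw [← mul_assoc, ← coe_linMul, LinearMap.mem_ker.1 hu]
      simp
    | add x _ y _ hx hy => rw [mul_add, hx, hy, add_zero]

/-- All cubics are multiples of `u` modulo a hyperplane-type condition. -/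
theorem exists_mul_eq_of_codim_two (hμ : IsThreeMul (linMul I)) {u : Fin n → K}
    (hu : n ≤ Module.finrank K (LinearMap.ker (linMul I) ⊔ K ∙ u : Submodule K _) + 2)
    (hr : Module.finrank K (LinearMap.range (linMul I u)) = 2)
    {w : MvPolynomial (Fin n) K ⧸ I} (hw : w ∈ gradedPiece I 3) :
    ∃ w' ∈ gradedPiece I 2, w = linForm I u * w' := by
  have hW := hμ.finrank_eq
  have : Module.Finite K (gradedPiece I 2) := Module.finite_of_finrank_pos (by omega)
  set T := LinearMap.ker (linMul I)
  have hTu : mulTop (linMul I) (T ⊔ K ∙ u) = LinearMap.range (linMul I u) := by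
    rw [mulTop_sup, mulTop_ker, bot_sup_eq, mulTop_span_singleton]
  have hV : Module.finrank K (Fin n → K) = n := by simp
  rw [show 3 = 1 + 2 from rfl, gradedPiece_add] at hw
  induction hw using Submodule.mul_induction_on' with
  | add x _ y _ hx hy =>
    obtain ⟨x', hx', rfl⟩ := hx
    obtain ⟨y', hy', rfl⟩ := hy
    exact ⟨x' + y', add_mem hx' hy', (mul_add _ _ _).symm⟩
  | mem_mul_mem x hx w hw =>
    rw [← range_linForm] at hx
    obtain ⟨a, rfl⟩ := hx
    -- an element `a'` outside `T + K u` with `a a' ∈ u V`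
    have hcol := finrank_add_finrank_mulTop_le (μ := linMul I) (T ⊔ K ∙ u) a
    rw [hTu, hr, hV, hW] at hcol
    have hsup : T ⊔ K ∙ u ≤ colon (linMul I) (T ⊔ K ∙ u) a := hμ.le_colon _ _
    by_cases hlt : T ⊔ K ∙ u < colon (linMul I) (T ⊔ K ∙ u) a
    · obtain ⟨a', ha', hna'⟩ := SetLike.exists_of_lt hlt
      rw [mem_colon, hTu] at ha'
      obtain ⟨z, hz⟩ := ha'
      -- The hyperplane `T + K u + K a'` generates `R₂`, so `w = up + a'q`. With `aa' = uz` this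
      -- gives `aw = u(ap + zq)`.
      have htop := hμ.mulTop_eq (T ⊔ K ∙ u ⊔ K ∙ a') (by
        rw [finrank_sup_span_singleton_of_notMem hna']
        omega)
      rw [mulTop_sup, hTu, mulTop_span_singleton] at htop
      have hw2 : (⟨w, hw⟩ : gradedPiece I 2) ∈ LinearMap.range (linMul I u) ⊔
        LinearMap.range (linMul I a') := htop ▸ trivial
      obtain ⟨_, ⟨p, rfl⟩, _, ⟨q, rfl⟩, hpq⟩ := Submodule.mem_sup.1 hw2
      have hw3 : w = linForm I u * linForm I p + linForm I a' * linForm I q :=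
        (congrArg Subtype.val hpq).symm
      have hz' : linForm I u * linForm I z = linForm I a * linForm I a' := congrArg Subtype.val hz
      refine ⟨linForm I a * linForm I p + linForm I z * linForm I q,
        add_mem (gradedPiece_mul_mem (linForm_mem I _) (linForm_mem I _))
          (gradedPiece_mul_mem (linForm_mem I _) (linForm_mem I _)), ?_⟩
      rw [hw3]
      linear_combination (-linForm I q) * hz'
    · have heq := congrArg (fun U : Submodule K (Fin n → K) => Module.finrank K U)
        (hsup.eq_of_not_lt hlt)
      have htop := hμ.mulTop_eq (T ⊔ K ∙ u) (by omega)
      rw [hTu] at htop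
      rw [htop, finrank_top, hW] at hr
      omega

/-- The pencil argument on a three-dimensional complement of `T` gives `u`, `v` outside `T` with `uv
= 0`. Each has rank two, and `Ann(u) = T + K v`, `Ann(v) = T + K u` in degree one. These spaces need
not generate `R₂`, so the colon ideals are checked in higher degrees as well, and this is where `R₃
≠ 0` is used. The filtration consists of `T` and all spaces above `T + K u` or `T + K v`. -/
theorem isKoszul_of_finrank_ker_add_three [IsAlgClosed K] (hI : IsQuadraticIdeal I)
    [IsArtinianRing (MvPolynomial (Fin n) K ⧸ I)] (h3 : Module.finrank K (gradedPiece I 2) = 3)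
    (hT : Module.finrank K (LinearMap.ker (linMul I)) + 3 = n) (hcub : gradedPiece I 3 ≠ ⊥) :
    IsKoszul I := by
  have hμ := isThreeMul_linMul hI h3
  have : Module.Finite K (gradedPiece I 2) := Module.finite_of_finrank_pos (by omega)
  obtain ⟨π, hπ⟩ := hI.exists_isGradedProj
  set T := LinearMap.ker (linMul I) with hTdef
  have hV : Module.finrank K (Fin n → K) = n := by simp
  obtain ⟨P, hd, hs, hf⟩ := exists_compl_finrank T
  obtain ⟨u, huP, hu0, v, hvP, hv0, huv⟩ := exists_mul_mem (μ := linMul I) (P := P) (Q := P) (D :=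
      ⊥)
    (by omega) (by rw [finrank_bot]; omega) (by rintro rfl; rw [finrank_bot] at hf; omega)
  rw [Submodule.mem_bot] at huv
  have hu := notMem_of_disjoint hd huP hu0
  have hv := notMem_of_disjoint hd hvP hv0
  have hvu : linMul I v u = 0 := by rw [linMul_comm, huv]
  have hTV : ∀ {x : Fin n → K}, mulTop (linMul I) (T ⊔ K ∙ x) = LinearMap.range (linMul I x) := by
    intro x
    rw [mulTop_sup, mulTop_ker, bot_sup_eq, mulTop_span_singleton]
  have hker : ∀ {x y : Fin n → K}, x ∉ T → y ∉ T → linMul I x y = 0 →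
      T ⊔ K ∙ y = LinearMap.ker (linMul I x) ∧
        Module.finrank K (LinearMap.range (linMul I x)) = 2 := by
    intro x y hx hy hxy
    have hle : T ⊔ K ∙ y ≤ LinearMap.ker (linMul I x) := by
      refine sup_le ?_ ((Submodule.span_singleton_le_iff_mem _ _).2 hxy)
      have := hμ.le_colon T x
      rwa [colon_ker] at this
    have h1 := finrank_sup_span_singleton_of_notMem hy
    have h2 := LinearMap.finrank_range_add_finrank_ker (linMul I x)
    have h4 := Submodule.finrank_mono hle
    have h5 := hμ.two_le_finrank_mulTop (U := T ⊔ K ∙ x) (by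
      rw [finrank_sup_span_singleton_of_notMem hx]; omega)
    rw [hTV] at h5
    exact ⟨Submodule.eq_of_le_of_finrank_le hle (by omega), by omega⟩
  -- the annihilator of `x` modulo `T` is generated by `y`
  have hcolon : ∀ {x y : Fin n → K}, x ∉ T → y ∉ T → linMul I x y = 0 →
      ∀ r, r * linForm I x ∈ linIdeal I T ↔ r ∈ linIdeal I (T ⊔ K ∙ y) := by
    intro x y hx hy hxy r
    have hyx : linMul I y x = 0 := by rw [linMul_comm, hxy]
    obtain ⟨hkx, hrx⟩ := hker hx hy hxy
    obtain ⟨hky, hry⟩ := hker hy hx hyx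
    have hcubx := @exists_mul_eq_of_codim_two K _ n I hμ x
      (by rw [finrank_sup_span_singleton_of_notMem hx]; omega) hrx
    have hcuby := @exists_mul_eq_of_codim_two K _ n I hμ y
      (by rw [finrank_sup_span_singleton_of_notMem hy]; omega) hry
    have hyL : linForm I y ∈ linIdeal I (T ⊔ K ∙ y) :=
      linForm_mem_linIdeal (Submodule.mem_sup_right (Submodule.mem_span_singleton_self y))
    constructor
    · intro h
      refine hπ.mem_linIdeal_of_forall fun j => ?_
      rw [mul_comm] at h
      have hj := hπ.mem_linIdeal h (j + 1)
      rw [hπ.succ_linForm_mul] at hj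
      match j with
      | 0 =>
        obtain ⟨c, hc⟩ := hπ.exists_algebraMap r
        obtain ⟨t, ht, ht'⟩ := hπ.one_of_mem_linIdeal h
        rw [hπ.succ_linForm_mul 0, hc, mul_comm, ← quotient_smul_def, ← map_smul] at ht'
        have := linForm_injective hI ht'
        by_cases hc0 : c = 0
        · rw [hc, hc0, map_zero]
          exact zero_mem _
        · refine absurd ?_ hx
          rwa [← Submodule.smul_mem_iff T hc0, this]
      | 1 =>
        obtain ⟨z, hz⟩ := hπ.exists_linForm r
        rw [hz] at hj ⊢
        refine linForm_mem_linIdeal ?_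
        rw [hkx, LinearMap.mem_ker]
        exact Subtype.ext (hπ.eq_zero_of_mem_linIdeal_ker hj (j := 0) (linMul I x z).2)
      | 2 =>
        have hw := hπ.mem 2 r
        generalize π 2 r = w at hw hj
        have h0 : linForm I x * w = 0 :=
          hπ.eq_zero_of_mem_linIdeal_ker hj (j := 1) (gradedPiece_mul_mem (linForm_mem I x) hw)
        by_cases hwy : (⟨w, hw⟩ : gradedPiece I 2) ∈ LinearMap.range (linMul I y)
        · obtain ⟨z, hz⟩ := hwy
          have : w = linForm I y * linForm I z := (congrArg Subtype.val hz).symm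
          rw [this]
          exact Ideal.mul_mem_right _ _ hyL
        -- If `w ∉ yR₁` satisfies `xw = 0`, then `R₂ = yR₁ + K w` because `yR₁` is a plane. Hence
        -- `xR₂ = 0`, and `R₃ = xR₂` vanishes.
        · exfalso
          apply hcub
          rw [eq_bot_iff]
          intro a ha
          obtain ⟨w', hw', rfl⟩ := hcubx ha
          have htop : LinearMap.range (linMul I y) ⊔ K ∙ (⟨w, hw⟩ : gradedPiece I 2) = ⊤ := by
            apply Submodule.eq_top_of_finrank_eq
            rw [finrank_sup_span_singleton_of_notMem hwy]
            omega
          have hmem : (⟨w', hw'⟩ : gradedPiece I 2) ∈ LinearMap.range (linMul I y) ⊔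
            K ∙ (⟨w, hw⟩ : gradedPiece I 2) := htop ▸ trivial
          obtain ⟨_, ⟨z, rfl⟩, _, hm, hsum⟩ := Submodule.mem_sup.1 hmem
          obtain ⟨c, rfl⟩ := Submodule.mem_span_singleton.1 hm
          have hw3 : w' = linForm I y * linForm I z + c • w := (congrArg Subtype.val hsum).symm
          have hxy' : linForm I x * linForm I y = 0 := congrArg Subtype.val hxy
          rw [Submodule.mem_bot, hw3, mul_add, mul_smul_comm, h0, smul_zero, add_zero, ← mul_assoc,
            hxy', zero_mul]
      -- Since `R₃ = yR₂`, everything of degree at least three is a multiple of `y`.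
      | j + 3 =>
        have hw := hπ.mem (j + 3) r
        generalize π (j + 3) r = w at hw
        rw [add_comm, gradedPiece_add] at hw
        induction hw using Submodule.mul_induction_on' with
        | add a _ b _ ha hb => exact add_mem ha hb
        | mem_mul_mem a ha b hb =>
          obtain ⟨w', hw', rfl⟩ := hcuby ha
          rw [mul_assoc]
          exact Ideal.mul_mem_right _ _ hyL
    · intro h
      rw [linIdeal_sup, linIdeal_span_singleton] at h
      obtain ⟨a, ha, b, hb, rfl⟩ := Submodule.mem_sup.1 h
      rw [add_mul]
      refine add_mem (Ideal.mul_mem_right _ _ ha) ?_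
      obtain ⟨c, rfl⟩ := Ideal.mem_span_singleton'.1 hb
      have hyx' : linForm I y * linForm I x = 0 := congrArg Subtype.val hyx
      rw [mul_assoc, hyx', mul_zero]
      exact zero_mem _
  have hstep : ∀ {x : Fin n → K} {U}, x ∉ T →
      Module.finrank K (LinearMap.range (linMul I x)) = 2 → T ⊔ K ∙ x < U →
      ∃ U' y, T ⊔ K ∙ x ≤ U' ∧ y ∉ U' ∧ U = U' ⊔ K ∙ y ∧ ∃ L, T ⊔ K ∙ x ≤ L ∧
        ∀ r, r * linForm I y ∈ linIdeal I U' ↔ r ∈ linIdeal I L := by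
    intro x U hx hrx hlt
    obtain ⟨U', y, h1, h2, h4, h5, h6⟩ := hμ.exists_step (by rw [hTV, hrx]) hlt
    exact ⟨U', y, h1, h2, h4, _, h5, hπ.mul_mem_linIdeal_iff hI h2 rfl h6⟩
  refine isKoszul_of_relative hI (F := {U | U = T ∨ T ⊔ K ∙ u ≤ U ∨ T ⊔ K ∙ v ≤ U})
    (Or.inr (Or.inl le_top)) ?_
  rintro U hU hne
  rcases hU with hU | hU | hU
  · exact absurd hU hne
  · rcases hU.eq_or_lt with rfl | hlt
    · exact ⟨T, Or.inl rfl, u, hu, rfl, _, Or.inr (Or.inr le_rfl), hcolon hu hv huv⟩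
    · obtain ⟨U', y, h1, h2, h4, L, h5, h6⟩ := hstep hu (hker hu hv huv).2 hlt
      exact ⟨U', Or.inr (Or.inl h1), y, h2, h4, L, Or.inr (Or.inl h5), h6⟩
  · rcases hU.eq_or_lt with rfl | hlt
    · exact ⟨T, Or.inl rfl, v, hv, rfl, _, Or.inr (Or.inl le_rfl), hcolon hv hu hvu⟩
    · obtain ⟨U', y, h1, h2, h4, L, h5, h6⟩ := hstep hv (hker hv hu hvu).2 hlt
      exact ⟨U', Or.inr (Or.inr h1), y, h2, h4, L, Or.inr (Or.inr h5), h6⟩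

/-- A basis of the space of linear forms adapted to a subspace, starting with a basis of a
complement. -/
theorem exists_basis_sum {K V : Type*} [Field K] [AddCommGroup V] [Module K V]
    [FiniteDimensional K V] {T P : Submodule K V} (h : IsCompl P T) {k : ℕ}
    (p : Module.Basis (Fin k) K P) :
    ∃ (r : ℕ) (b : Module.Basis (Fin k ⊕ Fin r) K V),
      (∀ i, b (Sum.inl i) = p i) ∧ ∀ i, b (Sum.inr i) ∈ T := by
  refine ⟨_, (p.prod (Module.finBasis K T)).map (Submodule.prodEquivOfIsCompl P T h),
    fun i => ?_, fun i => ?_⟩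
  · simp
  · simp

theorem IsQuadraticIdeal.eq_span_range_basis {k : ℕ} {J : Ideal (MvPolynomial (Fin k) K)}
    (hJ : IsQuadraticIdeal J) {ι : Type*} (b : Module.Basis ι K (quadricsOf J)) :
    J = Ideal.span (Set.range fun i => (b i : MvPolynomial (Fin k) K)) := by
  have hspan := congrArg (Submodule.map (quadricsOf J).subtype) b.span_eq
  rw [Submodule.map_span, ← Set.range_comp, Submodule.map_subtype_top] at hspan
  conv_lhs => rw [hJ.eq_span_quadricsOf, ← hspan]
  exact Submodule.span_span_of_tower K _ _

theorem finrank_quadricsOf {J : Ideal (MvPolynomial (Fin 3) K)}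
    (h3 : Module.finrank K (gradedPiece J 2) = 3) : Module.finrank K (quadricsOf J) = 3 := by
  have h := finrank_gradedPiece_add_finrank_quadricsOf J
  have h6 : (3 + 1).choose 2 = 6 := rfl
  omega

theorem exists_span_range_eq {J : Ideal (MvPolynomial (Fin 3) K)} (hJ : IsQuadraticIdeal J)
    (h3 : Module.finrank K (gradedPiece J 2) = 3) :
    ∃ q : Fin 3 → MvPolynomial (Fin 3) K, (∀ i, (q i).IsHomogeneous 2) ∧
      J = Ideal.span (Set.range q) := by
  have hq := finrank_quadricsOf h3
  have hfin : Module.Finite K (quadricsOf J) := Module.finite_of_finrank_pos (by omega)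
  let b := Module.finBasisOfFinrankEq K (quadricsOf J) hq
  exact ⟨fun i => b i, fun i => (b i).2.1, hJ.eq_span_range_basis b⟩

/-- Modulo the annihilator, `R` is defined by three ternary quadrics, and three quadrics cannot
generate all cubics. -/
theorem gradedPiece_three_ne_bot (hI : IsQuadraticIdeal I)
    (h3 : Module.finrank K (gradedPiece I 2) = 3)
    (hT : Module.finrank K (LinearMap.ker (linMul I)) + 3 = n) : gradedPiece I 3 ≠ ⊥ := by
  obtain ⟨P, hP⟩ := (LinearMap.ker (linMul I)).exists_isCompl
  have hf := Submodule.finrank_add_eq_of_isCompl hP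
  rw [Module.finrank_fin_fun] at hf
  obtain ⟨r, b, -, hb⟩ := exists_basis_sum hP.symm
    (Module.finBasisOfFinrankEq K P (n := 3) (by omega))
  obtain ⟨q, hq, hqJ⟩ := exists_span_range_eq (isQuadraticIdeal_restrictIdeal b hI hb)
    ((finrank_gradedPiece_restrictIdeal b hb).trans h3)
  obtain ⟨f, hf, hfJ⟩ := exists_cubic_notMem hq
  intro hbot
  apply hfJ
  rw [← hqJ]
  have : Ideal.Quotient.mk I (MvPolynomial.aeval (fun i => linPoly (b (Sum.inl i))) f) ∈
      gradedPiece I 3 :=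
    ⟨_, IsHomogeneous.aeval_linear (fun i => linPoly_isHomogeneous _) hf, rfl⟩
  rw [hbot, Submodule.mem_bot] at this
  exact Ideal.mem_comap.2 (Ideal.Quotient.eq_zero_iff_mem.1 this)

theorem isKoszul_of_isAlgClosed [IsAlgClosed K] (hI : IsQuadraticIdeal I)
    [IsArtinianRing (MvPolynomial (Fin n) K ⧸ I)] (h3 : Module.finrank K (gradedPiece I 2) = 3) :
    IsKoszul I := by
  have hμ := isThreeMul_linMul hI h3
  have : Module.Finite K (gradedPiece I 2) := Module.finite_of_finrank_pos (by omega)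
  have hle := hμ.finrank_ker_add_three_le
  rw [Module.finrank_fin_fun] at hle
  rcases hle.eq_or_lt with hT | hT
  · exact isKoszul_of_finrank_ker_add_three hI h3 hT (gradedPiece_three_ne_bot hI h3 hT)
  · obtain ⟨π, hπ⟩ := hI.exists_isGradedProj
    obtain ⟨F, hF⟩ := hμ.exists_isRelFiltration_ker (by rw [Module.finrank_fin_fun]; omega)
    refine isKoszul_of_relative hI hF.top fun U hU hne => ?_
    obtain ⟨U', hU', x, h1, h2, h4, h5⟩ := hF.step U hU hne
    exact ⟨U', hU', x, h1, h2, _, h4, hπ.mul_mem_linIdeal_iff hI h1 rfl h5⟩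

/-- Artinian quadratic algebras with `dim R₂ = 3` are Koszul. -/
theorem isKoszul_of_finrank_eq_three (hI : IsQuadraticIdeal I)
    [IsArtinianRing (MvPolynomial (Fin n) K ⧸ I)] (h3 : Module.finrank K (gradedPiece I 2) = 3) :
    IsKoszul I := by
  have : Module.Finite K (gradedPiece I 2) := Module.finite_of_finrank_pos (by omega)
  have := isArtinianRing_extIdeal (AlgebraicClosure K) hI
  exact IsKoszul.of_extIdeal (AlgebraicClosure K) hI (isKoszul_of_isAlgClosed hI.extIdeal
    ((finrank_gradedPiece_extIdeal _ I 2).trans h3))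

end Koszul

/-! ### The reverse lexicographic order -/

section RevLex

/-- The monomial order obtained from another one by means of an injective linear map. -/
noncomputable def MonomialOrder.pullback {σ : Type*} (m : MonomialOrder σ)
    (f : (σ →₀ ℕ) →+ (σ →₀ ℕ)) (hf : Function.Injective f) : MonomialOrder σ where
  syn := AddMonoidHom.mrange ((m.toSyn : (σ →₀ ℕ) →+ m.syn).comp f)
  addCommMonoidSyn := AddSubmonoid.toAddCommMonoid _
  linearOrderSyn := inferInstance
  isOrderedAddMonoid_syn := ⟨fun a b hab c => add_le_add_left (α := m.syn) hab c,
      fun a b hab c => add_le_add_right (α := m.syn) hab c⟩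
  toSyn :=
    { Equiv.ofBijective ((m.toSyn : (σ →₀ ℕ) →+ m.syn).comp f).mrangeRestrict
        ⟨fun a b h => hf (m.toSyn.injective (congrArg Subtype.val h)),
          AddMonoidHom.mrangeRestrict_surjective _⟩ with
      map_add' := fun a b => Subtype.ext (map_add ((m.toSyn : (σ →₀ ℕ) →+ m.syn).comp f) a b) }
  toSyn_monotone := by
    intro a b hab
    obtain ⟨c, rfl⟩ := exists_add_of_le hab
    change m.toSyn (f a) ≤ m.toSyn (f (a + c))
    rw [map_add]
    exact m.toSyn_monotone le_self_add

theorem MonomialOrder.pullback_lt_iff {σ : Type*} (m : MonomialOrder σ)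
    (f : (σ →₀ ℕ) →+ (σ →₀ ℕ)) (hf : Function.Injective f) {a b : σ →₀ ℕ} :
    (m.pullback f hf).toSyn a < (m.pullback f hf).toSyn b ↔ m.toSyn (f a) < m.toSyn (f b) :=
  Iff.rfl

/-- The tail sums of an exponent vector. -/
noncomputable def tailSum (n : ℕ) : (Fin n →₀ ℕ) →+ (Fin n →₀ ℕ) where
  toFun a := Finsupp.equivFunOnFinite.symm fun t => ∑ j ∈ Finset.Ici t, a j
  map_zero' := by ext; simp
  map_add' a b := by ext; simp [Finset.sum_add_distrib]

theorem tailSum_apply {n : ℕ} (a : Fin n →₀ ℕ) (t : Fin n) :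
    tailSum n a t = ∑ j ∈ Finset.Ici t, a j := rfl

theorem tailSum_injective (n : ℕ) : Function.Injective (tailSum n) := by
  intro a b hab
  have h : ∀ t, ∀ j, t ≤ j → a j = b j := by
    intro t
    induction t using WellFoundedGT.induction with
    | ind t ih =>
      intro j hj
      rcases hj.eq_or_lt with rfl | hj
      · have h1 := DFunLike.congr_fun hab t
        rw [tailSum_apply, tailSum_apply, ← Finset.Ioi_insert, Finset.sum_insert (by simp),
          Finset.sum_insert (by simp)] at h1
        have h2 : ∑ j ∈ Finset.Ioi t, a j = ∑ j ∈ Finset.Ioi t, b j :=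
          Finset.sum_congr rfl fun j hj => ih j (Finset.mem_Ioi.1 hj) j le_rfl
        omega
      · exact ih j hj j le_rfl
  ext t
  exact h t t le_rfl

theorem tailSum_single {n : ℕ} (i t : Fin n) :
    tailSum n (Finsupp.single i 1) t = if t ≤ i then 1 else 0 := by
  rw [tailSum_apply]
  simp [Finsupp.single_apply]

/-- The graded reverse lexicographic order in which the first variable is the smallest one. -/
noncomputable def degRevLex (n : ℕ) : MonomialOrder (Fin n) :=
  MonomialOrder.lex.pullback (tailSum n) (tailSum_injective n)

/-- The tail sum at the first index is the total degree, so degrees are compared first. For equal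
degrees, a smaller tail sum at the next index means a larger exponent of the first variable, which
is therefore the smallest variable. -/
theorem degRevLex_lt_iff {n : ℕ} {a b : Fin n →₀ ℕ} :
    (degRevLex n).toSyn a < (degRevLex n).toSyn b ↔
      ∃ t, (∀ s < t, tailSum n a s = tailSum n b s) ∧ tailSum n a t < tailSum n b t := by
  rw [degRevLex, MonomialOrder.pullback_lt_iff, MonomialOrder.lex_lt_iff, Finsupp.Lex.lt_iff]
  rfl

theorem degRevLex_lt_of_lt {n : ℕ} {i j k l : Fin n} (hij : i ≤ j) (hk : k < i) :
    (degRevLex n).toSyn (Finsupp.single k 1 + Finsupp.single l 1) <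
      (degRevLex n).toSyn (Finsupp.single i 1 + Finsupp.single j 1) := by
  have hmin : min k l < i := (min_le_left _ _).trans_lt hk
  have hn : (min k l : Fin n).val + 1 < n := lt_of_le_of_lt hmin i.2
  -- Tail sums up to the smaller of `k`, `l` all equal two on both sides. The next one still equals
  -- two for `i`, `j` but has dropped for `k`, `l`.
  refine degRevLex_lt_iff.2 ⟨⟨(min k l : Fin n).val + 1, hn⟩, fun s hs => ?_, ?_⟩
  · have hs' : s ≤ min k l := Nat.lt_succ_iff.1 hs
    have h1 : s ≤ k := hs'.trans (min_le_left _ _)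
    have h2 : s ≤ l := hs'.trans (min_le_right _ _)
    have h3 : s ≤ i := hs'.trans hmin.le
    have h4 : s ≤ j := h3.trans hij
    simp [map_add, tailSum_single, h1, h2, h3, h4]
  · set t : Fin n := ⟨(min k l : Fin n).val + 1, hn⟩
    have h3 : t ≤ i := hmin
    have h4 : t ≤ j := h3.trans hij
    have h5 : ¬ (t ≤ k ∧ t ≤ l) := by
      rintro ⟨h1, h2⟩
      have h6 : t ≤ min k l := le_min h1 h2
      have h7 : (min k l : Fin n).val + 1 ≤ (min k l : Fin n).val := h6
      omega
    simp only [map_add, Finsupp.add_apply, tailSum_single, h3, h4, if_true]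
    by_cases h1 : t ≤ k
    · have h2 : ¬ t ≤ l := fun h2 => h5 ⟨h1, h2⟩
      simp [h1, h2]
    · simp only [h1, if_false]
      split_ifs <;> omega

theorem degRevLex_single_lt {n : ℕ} {l j : Fin n} (h : l < j) :
    (degRevLex n).toSyn (Finsupp.single l 1) < (degRevLex n).toSyn (Finsupp.single j 1) := by
  refine degRevLex_lt_iff.2 ⟨⟨l + 1, by omega⟩, fun s hs => ?_, ?_⟩
  · have h1 : s ≤ l := Nat.lt_succ_iff.1 hs
    simp [tailSum_single, h1, h1.trans h.le]
  · have h1 : (⟨l + 1, by omega⟩ : Fin n) ≤ j := h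
    have h2 : ¬ (⟨l + 1, by omega⟩ : Fin n) ≤ l := by
      intro h2
      have : l.val + 1 ≤ l.val := h2
      omega
    simp [tailSum_single, h1, h2]

theorem degRevLex_lt_of_lt_right {n : ℕ} {i l j : Fin n} (h : l < j) :
    (degRevLex n).toSyn (Finsupp.single i 1 + Finsupp.single l 1) <
      (degRevLex n).toSyn (Finsupp.single i 1 + Finsupp.single j 1) := by
  rw [map_add, map_add]
  exact add_lt_add_right (degRevLex_single_lt h) _

end RevLex

/-! ### A criterion for quadratic Gröbner bases -/

section Groebner

variable {K : Type*} [Field K] {n : ℕ} {I : Ideal (MvPolynomial (Fin n) K)}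

/-- In the reverse lexicographic order attached to the basis `b` of linear forms, the monomial
`x_i x_j` (where `i ≤ j`) is a leading monomial of a quadric in `I`. -/
def IsLead (I : Ideal (MvPolynomial (Fin n) K)) (b : Module.Basis (Fin n) K (Fin n → K))
    (i j : Fin n) : Prop :=
  linMul I (b i) (b j) ∈ mulTop (linMul I) (Submodule.span K (b '' Set.Iio i)) ⊔
    (Submodule.span K (b '' Set.Iio j)).map (linMul I (b i))

/-- `IsLead` says that `bᵢbⱼ` is a combination of products of smaller basis forms in `R₂`. Here that
relation is lifted to a polynomial of the ideal in the new coordinates. -/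
theorem coordChange_mul_mem_sub {b : Module.Basis (Fin n) K (Fin n → K)}
    (M : Submodule K (MvPolynomial (Fin n) K)) {i j : Fin n}
    (h1 : ∀ k < i, ∀ l, MvPolynomial.X k * MvPolynomial.X l ∈ M)
    (h2 : ∀ l < j, MvPolynomial.X i * MvPolynomial.X l ∈ M) (h : IsLead I b i j) :
    ∃ p ∈ M, MvPolynomial.X i * MvPolynomial.X j - p ∈
      I.map (coordChange b : MvPolynomial (Fin n) K →+* MvPolynomial (Fin n) K) := by
  let ψ : MvPolynomial (Fin n) K →ₗ[K] MvPolynomial (Fin n) K ⧸ I :=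
    (Ideal.Quotient.mkₐ K I).toLinearMap ∘ₗ (coordChange b).symm.toLinearMap
  have hψ : ∀ k l, ψ (MvPolynomial.X k * MvPolynomial.X l) = linMul I (b k) (b l) := by
    intro k l
    change Ideal.Quotient.mk I ((coordChange b).symm _) = _
    rw [map_mul, coordChange_symm_X, coordChange_symm_X, map_mul]
    rfl
  have hle : mulTop (linMul I) (Submodule.span K (b '' Set.Iio i)) ⊔
      (Submodule.span K (b '' Set.Iio j)).map (linMul I (b i)) ≤
      (M.map ψ).comap (gradedPiece I 2).subtype := by
    refine sup_le ?_ ?_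
    · rw [mulTop, ← b.span_eq, Submodule.map₂_span_span, Submodule.span_le]
      rintro _ ⟨_, ⟨k, hk, rfl⟩, _, ⟨l, rfl⟩, rfl⟩
      exact ⟨_, h1 k hk l, hψ k l⟩
    · rw [Submodule.map_span, Submodule.span_le]
      rintro _ ⟨_, ⟨l, hl, rfl⟩, rfl⟩
      exact ⟨_, h2 l hl, hψ i l⟩
  obtain ⟨p, hp, hp'⟩ := hle h
  refine ⟨p, hp, ?_⟩
  rw [mem_map_coordChange, ← Ideal.Quotient.eq_zero_iff_mem]
  change ψ (_ - p) = 0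
  rw [map_sub, hψ, hp']
  exact sub_self _

theorem exists_quadric_of_isLead {b : Module.Basis (Fin n) K (Fin n → K)} {i j : Fin n}
    (hij : i ≤ j) (h : IsLead I b i j) :
    ∃ g ∈ I.map (coordChange b : MvPolynomial (Fin n) K →+* MvPolynomial (Fin n) K),
      g.IsHomogeneous 2 ∧ g ≠ 0 ∧
      (degRevLex n).degree g = Finsupp.single i 1 + Finsupp.single j 1 := by
  classical
  set m := degRevLex n
  set c : Fin n →₀ ℕ := Finsupp.single i 1 + Finsupp.single j 1 with hc
  -- Quadrics all of whose monomials are smaller than `XᵢXⱼ`. Subtracting such a quadric from `XᵢXⱼ`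
  -- cannot affect the leading term.
  let M : Submodule K (MvPolynomial (Fin n) K) :=
    MvPolynomial.homogeneousSubmodule (Fin n) K 2 ⊓
      { carrier := {p | ∀ e, p.coeff e ≠ 0 → m.toSyn e < m.toSyn c}
        zero_mem' := fun e he => absurd (MvPolynomial.coeff_zero e) he
        add_mem' := fun {p q} hp hq e he => by
          rw [MvPolynomial.coeff_add] at he
          by_cases hpe : p.coeff e = 0
          · exact hq e fun h0 => he (by rw [hpe, h0, add_zero])
          · exact hp e hpe
        smul_mem' := fun a p hp e he => hp e fun h0 => he (by
          rw [MvPolynomial.coeff_smul, h0, smul_zero]) }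
  have hXX : ∀ k l : Fin n, (MvPolynomial.X k * MvPolynomial.X l : MvPolynomial (Fin n) K) =
      MvPolynomial.monomial (Finsupp.single k 1 + Finsupp.single l 1) 1 := by
    intro k l
    rw [MvPolynomial.X, MvPolynomial.X, MvPolynomial.monomial_mul, one_mul]
  have hhom : ∀ k l : Fin n, (MvPolynomial.X k * MvPolynomial.X l :
      MvPolynomial (Fin n) K).IsHomogeneous 2 := fun k l =>
    (MvPolynomial.isHomogeneous_X K k).mul (MvPolynomial.isHomogeneous_X K l)
  have hM : ∀ k l : Fin n, m.toSyn (Finsupp.single k 1 + Finsupp.single l 1) < m.toSyn c →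
      (MvPolynomial.X k * MvPolynomial.X l : MvPolynomial (Fin n) K) ∈ M := by
    intro k l hkl
    refine ⟨hhom k l, fun e he => ?_⟩
    rw [hXX, MvPolynomial.coeff_monomial] at he
    split_ifs at he with h
    · rwa [← h]
    · exact absurd rfl he
  obtain ⟨p, hp, hpI⟩ := coordChange_mul_mem_sub M (fun k hk l => hM k l (degRevLex_lt_of_lt hij
      hk))
    (fun l hl => hM i l (degRevLex_lt_of_lt_right hl)) h
  have hpc : p.coeff c = 0 := by
    by_contra hne
    exact lt_irrefl _ (hp.2 c hne)
  have hcoeff : (MvPolynomial.X i * MvPolynomial.X j - p).coeff c = 1 := by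
    rw [MvPolynomial.coeff_sub, hXX, MvPolynomial.coeff_monomial, if_pos rfl, hpc, sub_zero]
  refine ⟨_, hpI, (hhom i j).sub hp.1, fun h0 => ?_, ?_⟩
  · rw [h0, MvPolynomial.coeff_zero] at hcoeff
    exact zero_ne_one hcoeff
  · apply m.toSyn.injective
    apply le_antisymm
    · rw [MonomialOrder.degree_le_iff]
      intro e he
      rw [MvPolynomial.mem_support_iff, MvPolynomial.coeff_sub, hXX,
        MvPolynomial.coeff_monomial] at he
      by_cases hce : c = e
      · rw [hce]
      · rw [if_neg hce, zero_sub, neg_ne_zero] at he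
        exact (hp.2 e he).le
    · apply m.le_degree
      rw [MvPolynomial.mem_support_iff, hcoeff]
      exact one_ne_zero

/-- If all exponents of degree `N` are leading exponents of forms in `J`,
then `J` contains all forms of degree `N`. -/
theorem mem_of_forall_exists_degree_eq {J : Ideal (MvPolynomial (Fin n) K)} {N : ℕ}
    (m : MonomialOrder (Fin n))
    (h : ∀ c : Fin n →₀ ℕ, c.degree = N → ∃ g ∈ J, g.IsHomogeneous N ∧ g ≠ 0 ∧ m.degree g = c)
    {f : MvPolynomial (Fin n) K} (hf : f.IsHomogeneous N) : f ∈ J := by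
  have hmono : ∀ s : m.syn, ∀ c : Fin n →₀ ℕ, m.toSyn c = s → c.degree = N →
      ∀ a : K, MvPolynomial.monomial c a ∈ J := by
    intro s
    induction s using WellFoundedLT.induction with
    | ind s ih =>
      rintro c rfl hc a
      obtain ⟨g, hgJ, hgN, hg0, hgc⟩ := h c hc
      have hlc : g.coeff c ≠ 0 := by
        rw [← hgc]
        exact m.leadingCoeff_ne_zero_iff.2 hg0
      have hsum : MvPolynomial.monomial c (g.coeff c) = g - ∑ e ∈ g.support.erase c,
          MvPolynomial.monomial e (g.coeff e) := by
        rw [eq_sub_iff_add_eq, Finset.add_sum_erase _ (fun e => MvPolynomial.monomial e (g.coeff e))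
          (MvPolynomial.mem_support_iff.2 hlc), ← MvPolynomial.as_sum]
      have hmem : MvPolynomial.monomial c (g.coeff c) ∈ J := by
        rw [hsum]
        refine sub_mem hgJ (sum_mem fun e he => ?_)
        rw [Finset.mem_erase] at he
        refine ih (m.toSyn e) (lt_of_le_of_ne (hgc ▸ m.le_degree he.2) fun h =>
          he.1 (m.toSyn.injective h)) e rfl ?_ _
        by_contra hne
        exact MvPolynomial.mem_support_iff.1 he.2 (hgN.coeff_eq_zero hne)
      have : MvPolynomial.monomial c a = MvPolynomial.C (a / g.coeff c) *
          MvPolynomial.monomial c (g.coeff c) := by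
        rw [MvPolynomial.C_mul_monomial, div_mul_cancel₀ _ hlc]
      rw [this]
      exact Ideal.mul_mem_left _ _ hmem
  rw [MvPolynomial.as_sum f]
  refine sum_mem fun e he => hmono _ e rfl ?_ _
  by_contra hne
  exact MvPolynomial.mem_support_iff.1 he (hf.coeff_eq_zero hne)

/-- Divisibility of an exponent vector by a leading quadratic monomial. -/
def HasLeadDivisor (I : Ideal (MvPolynomial (Fin n) K)) (b : Module.Basis (Fin n) K (Fin n → K))
    (d : Fin n →₀ ℕ) : Prop :=
  ∃ i j, i ≤ j ∧ IsLead I b i j ∧ Finsupp.single i 1 + Finsupp.single j 1 ≤ d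

theorem isHomogeneous_coordChange {b : Module.Basis (Fin n) K (Fin n → K)}
    {g : MvPolynomial (Fin n) K} {d : ℕ} (hg : g.IsHomogeneous d) :
    (coordChange b g).IsHomogeneous d :=
  IsHomogeneous.aeval_linear (fun _ => linPoly_isHomogeneous _) hg

theorem IsQuadraticIdeal.map_coordChange (hI : IsQuadraticIdeal I)
    (b : Module.Basis (Fin n) K (Fin n → K)) :
    IsQuadraticIdeal (I.map (coordChange b : MvPolynomial (Fin n) K →+* MvPolynomial (Fin n) K)) :=
      by
  obtain ⟨G, hG, rfl⟩ := hI
  refine ⟨coordChange b '' G, ?_, Ideal.map_span _ _⟩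
  rintro _ ⟨g, hg, rfl⟩
  exact isHomogeneous_coordChange (hG g hg)

/-- `R` is G-quadratic if, for some basis of linear forms, all exponents of degree at least three,
with the possible exception of one of degree three in case `R₃ ≠ 0`, are divisible by quadratic
leading monomials. -/
theorem isGQuadratic_of_hasLeadDivisor (hI : IsQuadraticIdeal I)
    (b : Module.Basis (Fin n) K (Fin n → K))
    (hd : ∀ d : Fin n →₀ ℕ, 3 ≤ d.degree → HasLeadDivisor I b d ∨ (gradedPiece I 3 ≠ ⊥ ∧
      d.degree = 3 ∧ ∀ c : Fin n →₀ ℕ, c.degree = 3 → c ≠ d → HasLeadDivisor I b c)) :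
    IsGQuadratic I := by
  set m := degRevLex n
  set J := I.map (coordChange b : MvPolynomial (Fin n) K →+* MvPolynomial (Fin n) K) with hJ
  have hJq : IsQuadraticIdeal J := hI.map_coordChange b
  refine ⟨coordChange b, m, {g | g ∈ J ∧ g.IsHomogeneous 2}, coordChange_X_isHomogeneous b,
    fun g hg => hg.2, fun g hg => hg.1, fun f hf hf0 => ?_⟩
  -- pass to the component of top degree
  set d := m.degree f with hdf
  set f' := MvPolynomial.homogeneousComponent d.degree f with hf'
  have hf'J : f' ∈ J := hJq.homogeneousComponent_mem hf _
  have hfhom : f'.IsHomogeneous d.degree := MvPolynomial.homogeneousComponent_isHomogeneous _ _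
  have hfd : f.coeff d ≠ 0 := m.leadingCoeff_ne_zero_iff.2 hf0
  have hf'd : f'.coeff d ≠ 0 := by
    rw [hf', MvPolynomial.coeff_homogeneousComponent, if_pos rfl]
    exact hfd
  have hf'0 : f' ≠ 0 := fun h => hf'd (by rw [h, MvPolynomial.coeff_zero])
  have hf'deg : m.degree f' = d := by
    apply m.toSyn.injective
    apply le_antisymm
    · rw [MonomialOrder.degree_le_iff]
      intro e he
      apply m.le_degree
      rw [MvPolynomial.mem_support_iff] at he ⊢
      rw [hf', MvPolynomial.coeff_homogeneousComponent] at he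
      split_ifs at he with h
      · exact he
      · exact absurd rfl he
    · exact m.le_degree (MvPolynomial.mem_support_iff.2 hf'd)
  have hlead : ∀ c : Fin n →₀ ℕ, HasLeadDivisor I b c →
      ∃ g ∈ {g | g ∈ J ∧ g.IsHomogeneous 2}, g ≠ 0 ∧ m.degree g ≤ c := by
    rintro c ⟨i, j, hij, hl, hle⟩
    obtain ⟨g, hgJ, hg2, hg0, hgd⟩ := exists_quadric_of_isLead hij hl
    exact ⟨g, ⟨hgJ, hg2⟩, hg0, hgd ▸ hle⟩
  rcases lt_trichotomy d.degree 2 with h2 | h2 | h2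
  · exact absurd (hJq.homogeneousComponent_eq_zero hf h2) hf'0
  · exact ⟨f', ⟨hf'J, h2 ▸ hfhom⟩, hf'0, hf'deg.le⟩
  · rcases hd d h2 with h | ⟨h3, hd3, hc⟩
    · exact hlead d h
    -- If the one exceptional exponent `d` were the leading exponent of an element of `J`, then
    -- every exponent of degree three would be one. So `J` would contain all cubics, contradicting
    -- `R₃ ≠ 0`.
    · exfalso
      apply h3
      rw [eq_bot_iff]
      rintro _ ⟨p, hp, rfl⟩
      have hall : coordChange b p ∈ J := by
        refine mem_of_forall_exists_degree_eq m (fun c hc3 => ?_) (isHomogeneous_coordChange hp)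
        by_cases hcd : c = d
        · exact ⟨f', hf'J, hd3 ▸ hfhom, hf'0, hcd ▸ hf'deg⟩
        · obtain ⟨g, ⟨hgJ, hg2⟩, hg0, hgc⟩ := hlead c (hc c hc3 hcd)
          have hgdeg : (m.degree g).degree = 2 := by
            by_contra hne
            exact m.leadingCoeff_ne_zero_iff.2 hg0 (hg2.coeff_eq_zero hne)
          obtain ⟨e, rfl⟩ := exists_add_of_le hgc
          have he : e.degree = 1 := by
            rw [map_add, hgdeg] at hc3
            omega
          have hmono0 : (MvPolynomial.monomial e (1 : K)) ≠ 0 := by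
            rw [Ne, MvPolynomial.monomial_eq_zero]
            exact one_ne_zero
          refine ⟨g * MvPolynomial.monomial e 1, Ideal.mul_mem_right _ _ hgJ,
            hg2.mul (MvPolynomial.isHomogeneous_monomial _ he), mul_ne_zero hg0 hmono0, ?_⟩
          classical
          rw [m.degree_mul hg0 hmono0, m.degree_monomial, if_neg one_ne_zero]
      rw [hJ, mem_map_coordChange, AlgEquiv.symm_apply_apply] at hall
      exact Ideal.Quotient.eq_zero_iff_mem.2 hall

end Groebner

/-! ### Square flags -/

section Multiplication

variable {K V W : Type*} [Field K] [AddCommGroup V] [Module K V] [AddCommGroup W] [Module K W]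
  {μ : V →ₗ[K] V →ₗ[K] W} [FiniteDimensional K V] [FiniteDimensional K W]

theorem exists_add_mul_add_mul_sq_eq_zero {K : Type*} [Field K] [IsAlgClosed K] {a b c : K}
    (h : c ≠ 0 ∨ b ≠ 0) : ∃ t : K, a + b * t + c * t ^ 2 = 0 := by
  by_cases hc : c = 0
  · have hb : b ≠ 0 := h.resolve_left (not_not.2 hc)
    refine ⟨-a / b, ?_⟩
    rw [hc, mul_div_cancel₀ _ hb]
    ring
  · open Polynomial in
    obtain ⟨t, ht⟩ := IsAlgClosed.exists_root (C c * X ^ 2 + C b * X + C a : K[X])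
      (by rw [degree_quadratic hc]; exact two_ne_zero)
    refine ⟨t, ?_⟩
    simp only [Polynomial.IsRoot.def, Polynomial.eval_add, Polynomial.eval_mul, Polynomial.eval_C,
      Polynomial.eval_pow, Polynomial.eval_X] at ht
    linear_combination ht

namespace IsThreeMul

variable (hμ : IsThreeMul μ)
include hμ

/-- In characteristic different from two, not all square-zero elements are exceptional. -/
theorem exists_not_isExceptional [IsAlgClosed K] (h2 : (2 : K) ≠ 0)
    (h4 : Module.finrank K (LinearMap.ker μ) + 4 ≤ Module.finrank K V) :
    ∃ x, x ∉ LinearMap.ker μ ∧ μ x x = 0 ∧ ¬ IsExceptional μ x := by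
  by_contra! hE
  have hW := hμ.finrank_eq
  obtain ⟨P, hd, hs, hf⟩ := exists_compl_finrank (LinearMap.ker μ)
  obtain ⟨x, hxP, hx0, hxx⟩ := exists_sq_mem (μ := μ) (V₁ := P) (D₀ := ⊥) (D₁ := ⊤) le_top
    (fun _ _ => trivial) (by rw [finrank_top, finrank_bot]; omega)
  have hxT := notMem_of_disjoint hd hxP hx0
  rw [Submodule.mem_bot] at hxx
  have hx := hE x hxT hxx
  obtain ⟨φ, hφ, hφN, hφn⟩ := hμ.exists_functional hx
  have hcomm : ∀ u v, φ (μ u v) = φ (μ v u) := fun u v => by rw [hμ.comm]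
  have hNdim := hx.finrank_ker
  obtain ⟨y, hxy, hyT⟩ : ∃ y ∈ LinearMap.ker (μ x), y ∉ LinearMap.ker μ ⊔ K ∙ x := by
    by_contra! h
    have := Submodule.finrank_mono (show LinearMap.ker (μ x) ≤ LinearMap.ker μ ⊔ K ∙ x from h)
    have := finrank_sup_span_singleton_of_notMem hx.notMem
    omega
  rw [LinearMap.mem_ker] at hxy
  have hyx : μ y x = 0 := by rw [hμ.comm, hxy]
  have hyy : μ y y ≠ 0 := fun h => hyT (hμ.mem_sup_of_mul_eq_zero hE hx.notMem hxx h hxy)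
  obtain ⟨d, hd⟩ := hx.mul_mem hxy y
  have hdN : d ∉ LinearMap.ker (μ x) := by
    rw [LinearMap.mem_ker, hd]
    exact hyy
  have hdfin := finrank_sup_span_singleton_of_notMem hdN
  have hspan : ∀ {a : V}, a ∉ LinearMap.ker (μ x) ⊔ K ∙ d →
      ∀ v, ∃ (n : V) (s t : K), μ x n = 0 ∧ v = n + s • d + t • a := by
    intro a ha v
    have htop : LinearMap.ker (μ x) ⊔ K ∙ d ⊔ K ∙ a = ⊤ := by
      apply Submodule.eq_top_of_finrank_eq
      have := finrank_sup_span_singleton_of_notMem ha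
      omega
    have hv : v ∈ LinearMap.ker (μ x) ⊔ K ∙ d ⊔ K ∙ a := htop ▸ trivial
    obtain ⟨m, hm, _, hta, rfl⟩ := Submodule.mem_sup.1 hv
    obtain ⟨n, hn, _, hsd, rfl⟩ := Submodule.mem_sup.1 hm
    obtain ⟨t, rfl⟩ := Submodule.mem_span_singleton.1 hta
    obtain ⟨s, rfl⟩ := Submodule.mem_span_singleton.1 hsd
    exact ⟨n, s, t, hn, rfl⟩
  -- an isotropic vector outside `Ann(x) + K d`
  obtain ⟨a₀, ha₀, hga⟩ : ∃ a₀, a₀ ∉ LinearMap.ker (μ x) ⊔ K ∙ d ∧ φ (μ a₀ a₀) = 0 := by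
    obtain ⟨d₂, -, hd₂⟩ : ∃ d₂ ∈ (⊤ : Submodule K V), d₂ ∉ LinearMap.ker (μ x) ⊔ K ∙ d := by
      by_contra! h
      have := Submodule.finrank_mono (show (⊤ : Submodule K V) ≤ LinearMap.ker (μ x) ⊔ K ∙ d from h)
      rw [finrank_top] at this
      omega
    obtain ⟨t, ht⟩ := exists_add_mul_add_mul_sq_eq_zero (a := φ (μ d₂ d₂)) (b := 2 * φ (μ d₂ d))
      (c := φ (μ d d)) (by
        by_contra! h
        refine hdN (hφn d fun v => ?_)
        have h' : φ (μ d₂ d) = 0 := (mul_eq_zero.1 h.2).resolve_left h2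
        obtain ⟨n, s, t, hn, rfl⟩ := hspan hd₂ v
        simp only [map_add, map_smul, hcomm d n, hφN n _ hn, h.1, hcomm d d₂, h', smul_zero,
          add_zero])
    refine ⟨d₂ + t • d, fun h => hd₂ ?_, ?_⟩
    · have : d₂ = (d₂ + t • d) - t • d := by module
      rw [this]
      exact sub_mem h (Submodule.mem_sup_right
        (Submodule.smul_mem _ _ (Submodule.mem_span_singleton_self d)))
    · rw [← ht]
      simp only [map_add, map_smul, LinearMap.add_apply, LinearMap.smul_apply, smul_eq_mul,
        hcomm d d₂]
      ring
  set s := μ x a₀ with hs'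
  have hD : ∀ u, φ u = 0 → ∃ p q : K, u = p • s + q • μ y y := by
    intro u hu
    obtain ⟨v, rfl⟩ := (hφ u).1 hu
    obtain ⟨n, p, q, hn, rfl⟩ := hspan ha₀ v
    refine ⟨q, p, ?_⟩
    simp only [map_add, map_smul, hn, hd]
    module
  obtain ⟨α, β, h1⟩ := hD _ hga
  obtain ⟨γ, δ, h3⟩ := hD _ (hφN y a₀ hxy)
  have h3' : μ a₀ y = γ • s + δ • μ y y := by rw [hμ.comm, h3]
  have hax : μ a₀ x = s := by rw [hμ.comm]
  -- `a₀²` lies in the plane spanned by `s` and `y²`. Adding `Y y` kills the `y²`-component, by a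
  -- quadratic equation. Adding `X x` then kills the `s`-component, by a linear equation with
  -- coefficient two.
  obtain ⟨Y, hY⟩ := exists_add_mul_add_mul_sq_eq_zero (a := β) (b := 2 * δ) (c := 1) (Or.inl
      one_ne_zero)
  obtain ⟨X, hX⟩ : ∃ X : K, 2 * X = -(α + 2 * Y * γ) := ⟨-(α + 2 * Y * γ) / 2, by field_simp⟩
  set a := a₀ + Y • y + X • x with ha
  have haa : μ a a = 0 := by
    have : μ a a = (α + 2 * Y * γ + 2 * X) • s + (β + 2 * δ * Y + 1 * Y ^ 2) • μ y y := by
      simp only [ha, map_add, map_smul, LinearMap.add_apply, LinearMap.smul_apply, h1, h3, h3', hax,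
        ← hs', hxy, hyx, hxx]
      module
    rw [this, hY, hX]
    simp
  have hs0 : s ≠ 0 := fun h => ha₀ (Submodule.mem_sup_left h)
  have hxa : μ x a = s := by
    simp only [ha, map_add, map_smul, hxy, hxx, ← hs', smul_zero, add_zero]
  have haT : a ∉ LinearMap.ker μ := by
    intro h
    rw [hμ.comm, LinearMap.mem_ker.1 h] at hxa
    exact hs0 hxa.symm
  have hae := hE a haT haa
  -- Both `x` and `a` are exceptional, so `xV` and `aV` meet in the line `K s`. Hence `y - l x`
  -- annihilates `a`, and its square, still `y²`, lies in that line. From `xd = y² = c x a₀` it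
  -- follows that `a₀ ∈ Ann(x) + K d`, a contradiction.
  obtain ⟨l, hl⟩ := hμ.exists_smul_of_mem_inf hx hae (hxa.symm ▸ hs0) (hx.mul_mem hxy a)
    ⟨y, hμ.comm a y⟩
  have hy' : μ a (y - l • x) = 0 := by
    rw [map_sub, map_smul, hμ.comm a y, hl, hμ.comm a x, sub_self]
  have hyy' : μ (y - l • x) (y - l • x) = μ y y := by
    simp only [map_sub, map_smul, LinearMap.sub_apply, LinearMap.smul_apply, hxy, hyx, hxx,
      smul_zero,
      sub_zero]
  obtain ⟨c, hc⟩ := hμ.exists_smul_of_mem_inf hx hae (hxa.symm ▸ hs0) (hx.mul_mem hxy y)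
    (hyy' ▸ hae.mul_mem hy' _)
  rw [hxa] at hc
  have hc0 : c ≠ 0 := by
    rintro rfl
    rw [zero_smul] at hc
    exact hyy hc
  refine ha₀ ?_
  have : a₀ = (a₀ - c⁻¹ • d) + c⁻¹ • d := by module
  rw [this]
  refine add_mem (Submodule.mem_sup_left ?_) (Submodule.mem_sup_right
    (Submodule.smul_mem _ _ (Submodule.mem_span_singleton_self d)))
  rw [LinearMap.mem_ker, map_sub, map_smul, hd, hc, smul_smul, inv_mul_cancel₀ hc0, one_smul,
    ← hs', sub_self]

omit [FiniteDimensional K W] in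
/-- An isotropic vector for the form `φ(u v)` in good position to `x`. -/
theorem exists_isotropic [IsAlgClosed K] (h2 : (2 : K) ≠ 0) {x : V}
    (hr : Module.finrank K (LinearMap.range (μ x)) = 2) {φ : W →ₗ[K] K}
    (hφ : ∀ u, φ u = 0 ↔ u ∈ LinearMap.range (μ x))
    (hx : ¬ mulTop μ (LinearMap.ker (μ x)) ≤ LinearMap.range (μ x)) :
    ∃ v w, φ (μ v v) = 0 ∧ φ (μ v w) ≠ 0 ∧
      (μ x v = 0 ∨ ∀ z, ∃ z', φ (μ v z') = 0 ∧ μ x z' = μ x z) := by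
  have hcomm : ∀ u v, φ (μ u v) = φ (μ v u) := fun u v => by rw [hμ.comm]
  rw [mulTop_le] at hx
  push Not at hx
  obtain ⟨l, hl, w, hlw⟩ := hx
  rw [← hφ] at hlw
  by_cases hll : φ (μ l l) = 0
  · exact ⟨l, w, hll, hlw, Or.inl hl⟩
  -- If the form vanished on all vectors orthogonal to `l`, polarisation would make it zero on that
  -- hyperplane. Since `l` is not isotropic, the hyperplane times `V` would then lie in `xV`, yet
  -- hyperplanes generate `W`.
  obtain ⟨u, hlu, huu⟩ : ∃ u, φ (μ l u) = 0 ∧ φ (μ u u) ≠ 0 := by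
    by_contra! hcon
    have hpol : ∀ u v, φ (μ l u) = 0 → φ (μ l v) = 0 → φ (μ u v) = 0 := by
      intro u v hu hv
      have h := hcon (u + v) (by rw [map_add, map_add, hu, hv, add_zero])
      simp only [map_add, LinearMap.add_apply, hcon u hu, hcon v hv, hcomm v u] at h
      have h' : 2 * φ (μ u v) = 0 := by linear_combination h
      exact (mul_eq_zero.1 h').resolve_left h2
    have hH : Module.finrank K V ≤ Module.finrank K (LinearMap.ker (φ ∘ₗ μ l)) + 1 := by
      have h1 := LinearMap.finrank_range_add_finrank_ker (φ ∘ₗ μ l)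
      have h3 := Submodule.finrank_le (LinearMap.range (φ ∘ₗ μ l))
      rw [Module.finrank_self] at h3
      omega
    have htop := hμ.mulTop_eq _ hH
    have hle : mulTop μ (LinearMap.ker (φ ∘ₗ μ l)) ≤ LinearMap.range (μ x) := by
      rw [mulTop_le]
      intro u hu v
      rw [← hφ]
      have hu' : φ (μ l u) = 0 := hu
      have hv : v = (v - (φ (μ l v) / φ (μ l l)) • l) + (φ (μ l v) / φ (μ l l)) • l := by module
      rw [hv, map_add, map_add, map_smul, map_smul, hcomm u l, hu', smul_zero, add_zero]
      refine hpol _ _ hu' ?_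
      rw [map_sub, map_sub, map_smul, map_smul, smul_eq_mul, div_mul_cancel₀ _ hll, sub_self]
    rw [htop, top_le_iff] at hle
    rw [hle, finrank_top, hμ.finrank_eq] at hr
    omega
  -- `u` and `l` are orthogonal and anisotropic, so a suitable `u + c l` is isotropic and not
  -- orthogonal to `l ∈ Ann(x)`. Subtracting a multiple of `l` moves any `z` into its orthogonal
  -- without changing `xz`.
  obtain ⟨c, hc⟩ := exists_add_mul_add_mul_sq_eq_zero (a := φ (μ u u)) (b := 0) (c := φ (μ l l))
      (Or.inl hll)
  have hc0 : c ≠ 0 := by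
    rintro rfl
    apply huu
    linear_combination hc
  have hvl : φ (μ (u + c • l) l) = c * φ (μ l l) := by
    simp only [map_add, map_smul, LinearMap.add_apply, LinearMap.smul_apply, hcomm u l, hlu,
      zero_add, smul_eq_mul]
  have hvl0 : φ (μ (u + c • l) l) ≠ 0 := hvl ▸ mul_ne_zero hc0 hll
  refine ⟨u + c • l, l, ?_, hvl0, Or.inr fun z =>
    ⟨z - (φ (μ (u + c • l) z) / φ (μ (u + c • l) l)) • l, ?_, ?_⟩⟩
  · simp only [map_add, map_smul, LinearMap.add_apply, LinearMap.smul_apply, hcomm u l, hlu,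
      zero_add, smul_eq_mul]
    linear_combination hc
  · rw [map_sub, map_sub, map_smul, map_smul, smul_eq_mul, div_mul_cancel₀ _ hvl0, sub_self]
  · rw [map_sub, map_smul, LinearMap.mem_ker.1 hl, smul_zero, sub_zero]

/-- Flags can be extended by vectors with small squares. -/
theorem exists_sq_mem_mulTop [IsAlgClosed K] {U : Submodule K V} (hU : U < ⊤)
    (hT : ¬ U ≤ LinearMap.ker μ ∨ Module.finrank K U + 4 ≤ Module.finrank K V) :
    ∃ v, v ∉ U ∧ μ v v ∈ mulTop μ U := by
  have hW := hμ.finrank_eq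
  obtain ⟨P, hd, hs, hf⟩ := exists_compl_finrank U
  have hlt := Submodule.finrank_lt hU.ne
  have h0 : ¬ U ≤ LinearMap.ker μ → 0 < Module.finrank K (mulTop μ U) := by
    intro h
    rw [Nat.pos_iff_ne_zero, Ne, Submodule.finrank_eq_zero]
    intro hbot
    refine h fun u hu => LinearMap.ext fun v => ?_
    have := mul_mem_mulTop (μ := μ) hu v
    rwa [hbot, Submodule.mem_bot] at this
  have h1 : Module.finrank K V ≤ Module.finrank K U + 2 → 2 ≤ Module.finrank K (mulTop μ U) :=
    hμ.two_le_finrank_mulTop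
  have h2 : Module.finrank K V ≤ Module.finrank K U + 1 → Module.finrank K (mulTop μ U) = 3 := by
    intro h
    rw [hμ.mulTop_eq U h, finrank_top, hW]
  have h4 : 3 < Module.finrank K (mulTop μ U) + Module.finrank K P := by
    rcases hT with hT | hT
    · have := h0 hT
      by_cases h5 : Module.finrank K V ≤ Module.finrank K U + 1
      · have := h2 h5; omega
      · by_cases h6 : Module.finrank K V ≤ Module.finrank K U + 2
        · have := h1 h6; omega
        · omega
    · omega
  obtain ⟨v, hv, hv0, hvv⟩ := exists_sq_mem (μ := μ) (V₁ := P) (D₀ := mulTop μ U) (D₁ := ⊤) le_top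
    (fun _ _ => trivial) (by rw [finrank_top]; omega)
  exact ⟨v, notMem_of_disjoint hd hv hv0, hvv⟩

end IsThreeMul

variable (μ) in
/-- A linearly independent sequence in which the square of each member is a combination of multiples
of the preceding ones. -/
structure IsSquareFlag {k : ℕ} (e : Fin k → V) : Prop where
  linearIndependent : LinearIndependent K e
  sq_mem : ∀ i, μ (e i) (e i) ∈ mulTop μ (Submodule.span K (e '' Set.Iio i))

omit [FiniteDimensional K V] [FiniteDimensional K W] in
theorem IsSquareFlag.snoc {k : ℕ} {e : Fin k → V} (he : IsSquareFlag μ e) {v : V}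
    (hv : v ∉ Submodule.span K (Set.range e))
    (hvv : μ v v ∈ mulTop μ (Submodule.span K (Set.range e))) :
    IsSquareFlag μ (Fin.snoc e v : Fin (k + 1) → V) := by
  refine ⟨linearIndependent_finSnoc.2 ⟨he.linearIndependent, hv⟩, fun i => ?_⟩
  induction i using Fin.lastCases with
  | last =>
    rw [Fin.snoc_last]
    refine mulTop_mono (Submodule.span_mono ?_) hvv
    rintro _ ⟨j, rfl⟩
    exact ⟨j.castSucc, Fin.castSucc_lt_last j, Fin.snoc_castSucc (α := fun _ => V) _ _ _⟩
  | cast i =>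
    rw [Fin.snoc_castSucc (α := fun _ => V)]
    refine mulTop_mono (Submodule.span_mono ?_) (he.sq_mem i)
    rintro _ ⟨j, hj, rfl⟩
    exact ⟨j.castSucc, Fin.castSucc_lt_castSucc_iff.2 hj, Fin.snoc_castSucc (α := fun _ => V) _ _ _⟩

omit [FiniteDimensional K W] in
theorem IsSquareFlag.exists_extension {H : Submodule K V} {m : ℕ} (hm : Module.finrank K H = m)
    {k : ℕ} {e : Fin k → V} (he : IsSquareFlag μ e) (heH : ∀ i, e i ∈ H)
    (hext : ∀ U, Submodule.span K (Set.range e) ≤ U → U < H → ∃ v ∈ H, v ∉ U ∧ μ v v ∈ mulTop μ U) :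
    ∃ e' : Fin m → V, IsSquareFlag μ e' ∧ (∀ i, e' i ∈ H) ∧
      ∀ (i : Fin m) (j : Fin k), i.val = j.val → e' i = e j := by
  have hle : Submodule.span K (Set.range e) ≤ H := by
    rw [Submodule.span_le]
    rintro _ ⟨i, rfl⟩
    exact heH i
  have hk := finrank_span_eq_card he.linearIndependent
  rw [Fintype.card_fin] at hk
  have hkm : k ≤ m := by
    rw [← hk, ← hm]
    exact Submodule.finrank_mono hle
  induction hr : m - k generalizing k with
  | zero =>
    obtain rfl : k = m := by omega
    exact ⟨e, he, heH, fun i j hij => by rw [Fin.ext hij]⟩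
  | succ r ih =>
    have hlt : Submodule.span K (Set.range e) < H := by
      refine lt_of_le_of_ne hle fun h => ?_
      rw [h] at hk
      omega
    obtain ⟨v, hvH, hv, hvv⟩ := hext _ le_rfl hlt
    have he' := he.snoc hv hvv
    have hsub : Submodule.span K (Set.range e) ≤
        Submodule.span K (Set.range (Fin.snoc e v : Fin (k + 1) → V)) := by
      refine Submodule.span_mono ?_
      rintro _ ⟨i, rfl⟩
      exact ⟨i.castSucc, Fin.snoc_castSucc (α := fun _ => V) _ _ _⟩
    have hH' : ∀ i, (Fin.snoc e v : Fin (k + 1) → V) i ∈ H := by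
      intro i
      induction i using Fin.lastCases with
      | last => rw [Fin.snoc_last]; exact hvH
      | cast i => rw [Fin.snoc_castSucc (α := fun _ => V)]; exact heH i
    obtain ⟨e', h1, h2, h3⟩ := ih he' hH' (fun U hU => hext U (hsub.trans hU)) (by
      rw [Submodule.span_le]
      rintro _ ⟨i, rfl⟩
      exact hH' i) (by rw [finrank_span_eq_card he'.linearIndependent, Fintype.card_fin]) (by omega)
      (by omega)
    refine ⟨e', h1, h2, fun i j hij => ?_⟩
    rw [h3 i j.castSucc hij, Fin.snoc_castSucc (α := fun _ => V)]

omit [FiniteDimensional K W] in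
theorem IsSquareFlag.span_eq {H : Submodule K V} {e : Fin (Module.finrank K H) → V}
    (he : IsSquareFlag μ e) (heH : ∀ i, e i ∈ H) : Submodule.span K (Set.range e) = H := by
  refine Submodule.eq_of_le_of_finrank_le ?_ ?_
  · rw [Submodule.span_le]
    rintro _ ⟨i, rfl⟩
    exact heH i
  · rw [finrank_span_eq_card he.linearIndependent, Fintype.card_fin]

omit [FiniteDimensional K W] in
/-- The flag consisting of a basis of the annihilator of `V` and one square-zero element. -/
theorem exists_isSquareFlag_ker {x : V} (hx : x ∉ LinearMap.ker μ) (hxx : μ x x = 0) {t : ℕ}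
    (ht : Module.finrank K (LinearMap.ker μ) = t) :
    ∃ e : Fin (t + 1) → V, IsSquareFlag μ e ∧ (∀ i : Fin t, e i.castSucc ∈ LinearMap.ker μ) ∧
      e (Fin.last _) = x ∧ Submodule.span K (Set.range e) = LinearMap.ker μ ⊔ K ∙ x := by
  subst ht
  let c := Module.finBasis K (LinearMap.ker μ)
  have hc : IsSquareFlag μ fun i => (c i : V) :=
    ⟨c.linearIndependent.map' _ (Submodule.ker_subtype _), fun i => by
      rw [LinearMap.mem_ker.1 (c i).2]
      exact zero_mem _⟩
  have hspan := hc.span_eq fun i => (c i).2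
  refine ⟨Fin.snoc (fun i => (c i : V)) x, hc.snoc (by rwa [hspan]) (by
    rw [hxx]; exact zero_mem _), fun i => ?_, Fin.snoc_last _ _, ?_⟩
  · rw [Fin.snoc_castSucc (α := fun _ => V)]
    exact (c i).2
  · rw [Fin.range_snoc, Set.insert_eq, Submodule.span_union, hspan, sup_comm]

namespace IsThreeMul

variable (hμ : IsThreeMul μ)
include hμ

omit [FiniteDimensional K V] in
-- `UV` contains the plane `xV` and the vector `vw` outside it.
theorem mulTop_eq_top_of_isotropic {x v w : V} (hr : Module.finrank K (LinearMap.range (μ x)) = 2)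
    {φ : W →ₗ[K] K} (hφ : ∀ u, φ u = 0 ↔ u ∈ LinearMap.range (μ x)) (hvw : φ (μ v w) ≠ 0)
    {U : Submodule K V} (hxU : x ∈ U) (hvU : v ∈ U) : mulTop μ U = ⊤ := by
  have hW := hμ.finrank_eq
  by_contra hne
  have hle : LinearMap.range (μ x) ≤ mulTop μ U := by
    rintro _ ⟨z, rfl⟩
    exact mul_mem_mulTop hxU z
  have h := Submodule.finrank_lt (lt_top_iff_ne_top.2 hne).ne
  have heq := Submodule.eq_of_le_of_finrank_le hle (by omega)
  refine hvw ((hφ _).2 ?_)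
  rw [heq]
  exact mul_mem_mulTop hvU w

/-- A square flag through `x`, an isotropic vector `v`, and the orthogonal of `v`. -/
theorem exists_isSquareFlag_isotropic {x v w : V} (hxT : x ∉ LinearMap.ker μ) (hxx : μ x x = 0)
    (hr : Module.finrank K (LinearMap.range (μ x)) = 2) {φ : W →ₗ[K] K}
    (hφ : ∀ u, φ u = 0 ↔ u ∈ LinearMap.range (μ x)) (hvv : φ (μ v v) = 0) (hvw : φ (μ v w) ≠ 0)
    {t n : ℕ} (ht : Module.finrank K (LinearMap.ker μ) = t) (hn : Module.finrank K V = n) :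
    ∃ e : Fin n → V, IsSquareFlag μ e ∧ (∀ i, i.val < t → e i ∈ LinearMap.ker μ) ∧
      (∀ i, i.val = t → e i = x) ∧ (∀ i, i.val = t + 1 → e i = v) ∧
      Submodule.span K (e '' {i | i.val + 1 < n}) = LinearMap.ker (φ ∘ₗ μ v) := by
  obtain ⟨e₀, he₀, heT, hex, hspan⟩ := exists_isSquareFlag_ker hxT hxx ht
  have hφT : ∀ u ∈ LinearMap.ker μ, ∀ z, φ (μ z u) = 0 := fun u hu z => by
    rw [hμ.comm, LinearMap.mem_ker.1 hu]
    exact map_zero φ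
  have hφx : ∀ z, φ (μ z x) = 0 := fun z => (hφ _).2 ⟨z, hμ.comm _ _⟩
  have hvU : v ∉ Submodule.span K (Set.range e₀) := by
    rw [hspan]
    intro h
    refine hvw ?_
    obtain ⟨u, hu, _, hy, rfl⟩ := Submodule.mem_sup.1 h
    obtain ⟨c, rfl⟩ := Submodule.mem_span_singleton.1 hy
    rw [hμ.comm, map_add, map_add, map_smul, map_smul, hφT u hu, hφx, smul_zero, add_zero]
  have hxe₀ : x ∈ Submodule.span K (Set.range e₀) := Submodule.subset_span ⟨_, hex⟩
  have hrange : LinearMap.range (μ x) ≤ mulTop μ (Submodule.span K (Set.range e₀)) := by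
    rintro _ ⟨z, rfl⟩
    exact mul_mem_mulTop hxe₀ z
  have he₁ := he₀.snoc hvU (hrange ((hφ (μ v v)).1 hvv))
  set e₁ : Fin (t + 1 + 1) → V := Fin.snoc e₀ v with he₁def
  have hsn : ∀ i : Fin (t + 1), e₁ i.castSucc = e₀ i := fun i =>
    Fin.snoc_castSucc (α := fun _ => V) _ _ _
  have hxe : e₁ (Fin.last t).castSucc = x := by rw [hsn, hex]
  have hve : e₁ (Fin.last (t + 1)) = v := Fin.snoc_last _ _
  have hxv : ∀ U : Submodule K V, Submodule.span K (Set.range e₁) ≤ U → mulTop μ U = ⊤ :=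
    fun U hU => hμ.mulTop_eq_top_of_isotropic hr hφ hvw (hU (Submodule.subset_span ⟨_, hxe⟩))
      (hU (Submodule.subset_span ⟨_, hve⟩))
  have hext : ∀ H U : Submodule K V, Submodule.span K (Set.range e₁) ≤ U → U < H →
      ∃ v ∈ H, v ∉ U ∧ μ v v ∈ mulTop μ U := by
    intro H U hU hUH
    obtain ⟨z, hz, hzU⟩ := SetLike.exists_of_lt hUH
    exact ⟨z, hz, hzU, hxv U hU ▸ trivial⟩
  set H := LinearMap.ker (φ ∘ₗ μ v) with hH
  obtain ⟨m, hm⟩ : ∃ m, Module.finrank K H = m := ⟨_, rfl⟩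
  have hmn : m + 1 = n := by
    have h1 := LinearMap.finrank_range_add_finrank_ker (φ ∘ₗ μ v)
    have h3 := Submodule.finrank_le (LinearMap.range (φ ∘ₗ μ v))
    have h5 : 0 < Module.finrank K (LinearMap.range (φ ∘ₗ μ v)) := by
      rw [Nat.pos_iff_ne_zero, Ne, Submodule.finrank_eq_zero, LinearMap.range_eq_bot]
      exact fun h => hvw (LinearMap.congr_fun h w)
    rw [Module.finrank_self] at h3
    rw [← hH] at h1
    omega
  have he₁H : ∀ i, e₁ i ∈ H := by
    intro i
    induction i using Fin.lastCases with
    | last => rw [hve]; exact hvv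
    | cast i =>
      rw [hsn]
      induction i using Fin.lastCases with
      | last => rw [hex]; exact hφx v
      | cast i => exact hφT _ (heT i) v
  have he₁H' : Submodule.span K (Set.range e₁) ≤ H := by
    rw [Submodule.span_le]
    rintro _ ⟨i, rfl⟩
    exact he₁H i
  -- The flag is first completed inside the hyperplane orthogonal to `v`, so only the last vector
  -- lies outside it. Once `x` and `v` are present the square condition is vacuous, because they
  -- already generate `W`.
  obtain ⟨e₂, he₂, he₂H, he₂e⟩ := he₁.exists_extension hm he₁H (hext H)
  have hHspan : Submodule.span K (Set.range e₂) = H := by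
    subst hm
    exact he₂.span_eq he₂H
  obtain ⟨e, he, -, hee⟩ := he₂.exists_extension (H := ⊤) (m := n) (by rw [finrank_top, hn])
    (fun _ => trivial) fun U hU => hext _ U (he₁H'.trans (hHspan ▸ hU))
  have hcard : t + 2 ≤ m := by
    rw [← hm]
    have := Submodule.finrank_mono he₁H'
    rwa [finrank_span_eq_card he₁.linearIndependent, Fintype.card_fin] at this
  have hee₁ : ∀ (i : Fin n) (j : Fin (t + 1 + 1)), i.val = j.val → e i = e₁ j := fun i j hij => by
    have hi : i.val < m := by omega
    rw [hee i ⟨i, hi⟩ rfl, he₂e ⟨i, hi⟩ j hij]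
  refine ⟨e, he, fun i hi => ?_, fun i hi => ?_, fun i hi => ?_, ?_⟩
  · rw [hee₁ i (Fin.castSucc (Fin.castSucc ⟨i, hi⟩)) rfl, hsn]
    exact heT _
  · rw [hee₁ i (Fin.last t).castSucc hi, hxe]
  · rw [hee₁ i (Fin.last (t + 1)) hi, hve]
  · rw [← hHspan]
    congr 1
    ext z
    constructor
    · rintro ⟨i, hi, rfl⟩
      have hi' : i.val + 1 < n := hi
      exact ⟨⟨i, by omega⟩, (hee i _ rfl).symm⟩
    · rintro ⟨i, rfl⟩
      exact ⟨⟨i, by omega⟩, by show i.val + 1 < n; omega, hee _ i rfl⟩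

end IsThreeMul

end Multiplication

/-! ### G-quadraticity -/

section GQuadratic

variable {K : Type*} [Field K] {n : ℕ} {I : Ideal (MvPolynomial (Fin n) K)}

theorem isLead_of_mem_ker {b : Module.Basis (Fin n) K (Fin n → K)} {i j : Fin n}
    (h : b i ∈ LinearMap.ker (linMul I) ∨ b j ∈ LinearMap.ker (linMul I)) : IsLead I b i j := by
  have : linMul I (b i) (b j) = 0 := by
    rcases h with h | h
    · rw [LinearMap.mem_ker.1 h]; rfl
    · rw [linMul_comm, LinearMap.mem_ker.1 h]; rfl
  rw [IsLead, this]
  exact zero_mem _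

/-- A monomial outside the ideal of quadratic leading monomials is squarefree, and no variable in
it comes from the annihilator. -/
theorem support_of_not_hasLeadDivisor {b : Module.Basis (Fin n) K (Fin n → K)}
    (hsq : ∀ i, IsLead I b i i) {d : Fin n →₀ ℕ} (hd : 3 ≤ d.degree)
    (hn : ¬ HasLeadDivisor I b d) : (∀ i, d i ≤ 1) ∧ d.degree ≤ d.support.card ∧
      (∀ i ∈ d.support, b i ∉ LinearMap.ker (linMul I)) ∧
      ∀ i ∈ d.support, ∀ j ∈ d.support, i < j → ¬ IsLead I b i j := by
  classical
  have hpair : ∀ i ∈ d.support, ∀ j ∈ d.support, i < j → ¬ IsLead I b i j := by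
    intro i hi j hj hij h
    refine hn ⟨i, j, hij.le, h, fun l => ?_⟩
    rw [Finsupp.mem_support_iff] at hi hj
    rw [Finsupp.add_apply, Finsupp.single_apply, Finsupp.single_apply]
    split_ifs with h1 h2 h2
    · exact absurd (h1.trans h2.symm) hij.ne
    all_goals subst_vars; omega
  have h1 : ∀ i, d i ≤ 1 := by
    intro i
    by_contra! h
    refine hn ⟨i, i, le_rfl, hsq i, fun l => ?_⟩
    rw [Finsupp.add_apply, Finsupp.single_apply]
    split_ifs with hl
    · subst hl; omega
    · omega
  have h2 : d.degree ≤ d.support.card := by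
    rw [Finsupp.degree_apply, Finset.card_eq_sum_ones]
    exact Finset.sum_le_sum fun i _ => h1 i
  refine ⟨h1, h2, fun i hi hk => ?_, hpair⟩
  obtain ⟨j, hj, hji⟩ := Finset.exists_mem_ne (s := d.support) (by omega) i
  rcases lt_or_gt_of_ne hji with h | h
  · exact hpair j hj i hi h (isLead_of_mem_ker (Or.inr hk))
  · exact hpair i hi j hj h (isLead_of_mem_ker (Or.inl hk))

/-- Three products none of which is a leading monomial generate a three-dimensional space. -/
theorem finrank_triangle {b : Module.Basis (Fin n) K (Fin n → K)} {i j k : Fin n}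
    (hij : i < j) (hjk : j < k) (h1 : ¬ IsLead I b i j) (h2 : ¬ IsLead I b i k)
    (h3 : ¬ IsLead I b j k) (hμ : IsThreeMul (linMul I)) :
    mulTop (linMul I) (Submodule.span K (b '' Set.Iio i)) = ⊥ ∧
      Module.finrank K (LinearMap.range (linMul I (b i))) = 2 := by
  have hW := hμ.finrank_eq
  have : Module.Finite K (gradedPiece I 2) := Module.finite_of_finrank_pos (by omega)
  have hmem : ∀ {l m : Fin n}, l < m → b l ∈ Submodule.span K (b '' Set.Iio m) :=
    fun hlm => Submodule.subset_span ⟨_, hlm, rfl⟩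
  set A := mulTop (linMul I) (Submodule.span K (b '' Set.Iio i)) with hA
  set B := A ⊔ K ∙ linMul I (b i) (b j) with hB
  have hBk : B ≤ A ⊔ (Submodule.span K (b '' Set.Iio k)).map (linMul I (b i)) := by
    refine sup_le_sup_left ((Submodule.span_singleton_le_iff_mem _ _).2 ?_) _
    exact Submodule.mem_map_of_mem (hmem hjk)
  have hij' : linMul I (b i) (b j) ∉ A := fun h => h1 (Submodule.mem_sup_left h)
  have hik' : linMul I (b i) (b k) ∉ B := fun h => h2 (hBk h)
  have hCj : B ⊔ K ∙ linMul I (b i) (b k) ≤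
      mulTop (linMul I) (Submodule.span K (b '' Set.Iio j)) := by
    refine sup_le (sup_le (mulTop_mono (Submodule.span_mono (Set.image_mono
      (Set.Iio_subset_Iio hij.le)))) ?_) ?_
    all_goals
      rw [Submodule.span_singleton_le_iff_mem]
      exact mul_mem_mulTop (hmem hij) _
  -- The products `bᵢbⱼ` and `bᵢbₖ` each raise the dimension by one, and there is still no room for
  -- `bⱼbₖ`. In a space of dimension three this leaves `A = 0`.
  have hlt : B ⊔ K ∙ linMul I (b i) (b k) < ⊤ := by
    refine lt_top_iff_ne_top.2 fun h => h3 (Submodule.mem_sup_left (hCj ?_))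
    rw [h]
    trivial
  have hf := Submodule.finrank_lt hlt.ne
  have hfk := finrank_sup_span_singleton_of_notMem hik'
  have hfj := finrank_sup_span_singleton_of_notMem hij'
  rw [← hB] at hfj
  refine ⟨Submodule.finrank_eq_zero.1 (by omega), le_antisymm ?_ ?_⟩
  · have hle : LinearMap.range (linMul I (b i)) ≤
        mulTop (linMul I) (Submodule.span K (b '' Set.Iio j)) := by
      rintro _ ⟨w, rfl⟩
      exact mul_mem_mulTop (hmem hij) w
    have hlt : LinearMap.range (linMul I (b i)) < ⊤ := by
      refine lt_top_iff_ne_top.2 fun h => h3 (Submodule.mem_sup_left (hle ?_))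
      rw [h]
      trivial
    have := Submodule.finrank_lt hlt.ne
    omega
  · have hA0 : A = ⊥ := Submodule.finrank_eq_zero.1 (by omega)
    have hle : B ⊔ K ∙ linMul I (b i) (b k) ≤ LinearMap.range (linMul I (b i)) := by
      rw [hB, hA0, bot_sup_eq]
      refine sup_le ?_ ?_
      all_goals
        rw [Submodule.span_singleton_le_iff_mem]
        exact ⟨_, rfl⟩
    have := Submodule.finrank_mono hle
    omega

/-- A square flag beginning with a basis of the annihilator and a square-zero element `x` gives a
quadratic Gröbner basis, unless some triple `x, e_j, e_k` has no leading products. -/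
theorem isGQuadratic_of_isSquareFlag (hI : IsQuadraticIdeal I) (hμ : IsThreeMul (linMul I))
    {e : Fin n → Fin n → K} (he : IsSquareFlag (linMul I) e) {t : Fin n}
    (ht : e t ∉ LinearMap.ker (linMul I))
    (H : ∀ b : Module.Basis (Fin n) K (Fin n → K), ⇑b = e →
      Module.finrank K (LinearMap.range (linMul I (e t))) = 2 → ∀ j k, t < j → j < k →
        ¬ IsLead I b t j → ¬ IsLead I b t k → ¬ IsLead I b j k → False)
    (hT : ∀ i < t, e i ∈ LinearMap.ker (linMul I)) : IsGQuadratic I := by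
  rcases Nat.eq_zero_or_pos n with hn0 | hn0
  · subst hn0
    exact t.elim0
  have : Nonempty (Fin n) := ⟨t⟩
  let b := basisOfLinearIndependentOfCardEqFinrank he.linearIndependent (by simp)
  have hb : ⇑b = e := coe_basisOfLinearIndependentOfCardEqFinrank _ _
  have hsq : ∀ i, IsLead I b i i := fun i => Submodule.mem_sup_left (by
    rw [hb]
    exact he.sq_mem i)
  refine isGQuadratic_of_hasLeadDivisor hI b fun d hd => Or.inl ?_
  by_contra hcon
  obtain ⟨-, hcard, hker, hpair⟩ := support_of_not_hasLeadDivisor hsq hd hcon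
  -- A surviving monomial of degree at least three is squarefree, so it involves three variables,
  -- and no two of them form a leading product.
  let f := Finset.orderEmbOfCardLe d.support (hd.trans hcard)
  have hf : ∀ a, f a ∈ d.support := Finset.orderEmbOfCardLe_mem _ _
  have h01 : f 0 < f 1 := f.strictMono (by decide)
  have h12 : f 1 < f 2 := f.strictMono (by decide)
  have H1 := hpair _ (hf 0) _ (hf 1) h01
  have H2 := hpair _ (hf 0) _ (hf 2) (h01.trans h12)
  have H3 := hpair _ (hf 1) _ (hf 2) h12
  obtain ⟨hA, hr⟩ := finrank_triangle h01 h12 H1 H2 H3 hμ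
  -- Indices below `t` lie in the annihilator. An index above `t` would make `e t` annihilate
  -- everything, since the forms preceding the first variable of the triple generate zero.
  have h0 : f 0 = t := by
    rcases lt_trichotomy (f 0) t with h | h | h
    · exact absurd (hb ▸ hT _ h) (hker _ (hf 0))
    · exact h
    · refine absurd ?_ ht
      rw [LinearMap.mem_ker]
      refine LinearMap.ext fun v => ?_
      have := mul_mem_mulTop (μ := linMul I) (U := Submodule.span K (b '' Set.Iio (f 0)))
        (u := e t) (Submodule.subset_span ⟨t, h, by rw [hb]⟩) v
      rwa [hA, Submodule.mem_bot] at this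
  rw [h0] at h01 H1 H2 hr
  rw [hb] at hr
  exact H b hb hr _ _ h01 h12 H1 H2 H3

/-- If the annihilator of `R₁` has codimension at least four, then `R` is G-quadratic. -/
theorem isGQuadratic_of_four_le [IsAlgClosed K] (h2 : (2 : K) ≠ 0) (hI : IsQuadraticIdeal I)
    (hμ : IsThreeMul (linMul I)) (h4 : Module.finrank K (LinearMap.ker (linMul I)) + 4 ≤ n) :
    IsGQuadratic I := by
  have hW := hμ.finrank_eq
  have : Module.Finite K (gradedPiece I 2) := Module.finite_of_finrank_pos (by omega)
  have hV : Module.finrank K (Fin n → K) = n := by simp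
  obtain ⟨x, hxT, hxx, hx⟩ := hμ.exists_not_isExceptional h2 (by rwa [hV])
  obtain ⟨t, ht⟩ : ∃ t, Module.finrank K (LinearMap.ker (linMul I)) = t := ⟨_, rfl⟩
  by_cases hr : Module.finrank K (LinearMap.range (linMul I x)) = 2
  · obtain ⟨φ, hφ⟩ := hμ.exists_functional_of_finrank hr
    obtain ⟨v, w, hvv, hvw, hor⟩ := hμ.exists_isotropic h2 hr hφ fun h => hx ⟨hxT, hr, h⟩
    obtain ⟨e, he, heT, hex, hev, heH⟩ :=
      hμ.exists_isSquareFlag_isotropic hxT hxx hr hφ hvv hvw ht hV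
    refine isGQuadratic_of_isSquareFlag hI hμ he (t := ⟨t, by omega⟩) (by rwa [hex _ rfl]) ?_
      fun i hi => heT i hi
    intro b hb _ j k htj hjk h1 h2' h3
    rw [IsLead, hb, hex ⟨t, _⟩ rfl] at h1 h2'
    rw [IsLead, hb] at h3
    have hmem : ∀ {l m : Fin n}, l < m → e l ∈ Submodule.span K (e '' Set.Iio m) :=
      fun {l m} hlm => Submodule.subset_span ⟨l, hlm, rfl⟩
    have hxj : x ∈ Submodule.span K (e '' Set.Iio j) := hex ⟨t, _⟩ rfl ▸ hmem htj
    -- If `e j` comes after `v`, then `x` and `v` precede it and generate `R₂`, so `bⱼbₖ` is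
    -- leading. If `e j = v`, then `v·e k ∉ xV` makes `e k` the last vector. Now either `xv = 0`, or
    -- `x·e k` equals `x z'` with `z'` in the span of the earlier vectors. Both make a product with
    -- `x` leading.
    obtain hj | hj : j.val = t + 1 ∨ t + 1 < j.val := by
      have : t < j.val := htj
      omega
    · rw [hev j hj] at h1 h3
      have hkH : φ (linMul I v (e k)) ≠ 0 := by
        intro h
        obtain ⟨z, hz⟩ := (hφ _).1 h
        exact h3 (Submodule.mem_sup_left (hz ▸ mul_mem_mulTop hxj z))
      have hkn : ¬ k.val + 1 < n := fun hk =>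
        hkH (heH.le (Submodule.subset_span ⟨k, hk, rfl⟩))
      rcases hor with hxv | hor
      · exact h1 (hxv ▸ zero_mem _)
      · obtain ⟨z', hz', hxz'⟩ := hor (e k)
        refine h2' (Submodule.mem_sup_right (hxz' ▸ Submodule.mem_map_of_mem ?_))
        refine Submodule.span_mono (Set.image_mono fun i hi => ?_) (heH.ge hz')
        have hi' : i.val + 1 < n := hi
        show i.val < k.val
        omega
    · refine h3 (Submodule.mem_sup_left ?_)
      rw [hμ.mulTop_eq_top_of_isotropic hr hφ hvw hxj (hev ⟨t + 1, by omega⟩ rfl ▸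
        hmem (Fin.lt_def.2 hj))]
      trivial
  · obtain ⟨e₀, he₀, heT, hex, -⟩ := exists_isSquareFlag_ker hxT hxx ht
    obtain ⟨e, he, -, hee⟩ := he₀.exists_extension (H := ⊤) (m := n) (by rw [finrank_top, hV])
      (fun _ => trivial) fun U hU hUH => by
        obtain ⟨v, hv, hvv⟩ := hμ.exists_sq_mem_mulTop hUH
          (Or.inl fun hUT => hxT (hUT (hU (Submodule.subset_span ⟨_, hex⟩))))
        exact ⟨v, trivial, hv, hvv⟩
    have hex' : e ⟨t, by omega⟩ = x := by rw [hee _ (Fin.last t) rfl, hex]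
    refine isGQuadratic_of_isSquareFlag hI hμ he (t := ⟨t, by omega⟩) (by rwa [hex']) ?_ ?_
    · intro b hb h
      rw [hex'] at h
      exact absurd h hr
    · intro i hi
      have hi' : i.val < t := hi
      rw [hee i (Fin.castSucc ⟨i, hi'⟩) rfl]
      exact heT _

/-- If the annihilator of `R₁` has codimension three and `R` has a further square-zero linear form,
then `R` is G-quadratic. -/
theorem isGQuadratic_of_sq_eq_zero [IsAlgClosed K] (hI : IsQuadraticIdeal I)
    (hμ : IsThreeMul (linMul I)) (hn : Module.finrank K (LinearMap.ker (linMul I)) + 3 = n)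
    {x : Fin n → K} (hxT : x ∉ LinearMap.ker (linMul I)) (hxx : linMul I x x = 0) :
    IsGQuadratic I := by
  have hW := hμ.finrank_eq
  have : Module.Finite K (gradedPiece I 2) := Module.finite_of_finrank_pos (by omega)
  have hV : Module.finrank K (Fin n → K) = n := by simp
  set T := LinearMap.ker (linMul I) with hTdef
  obtain ⟨e₀, he₀, heT, hex, -⟩ := exists_isSquareFlag_ker hxT hxx rfl
  obtain ⟨e, he, -, hee⟩ := he₀.exists_extension (H := ⊤) (m := n) (by rw [finrank_top, hV])
    (fun _ => trivial) fun U hU hUH => by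
      obtain ⟨v, hv, hvv⟩ := hμ.exists_sq_mem_mulTop hUH
        (Or.inl fun hUT => hxT (hUT (hU (Submodule.subset_span ⟨_, hex⟩))))
      exact ⟨v, trivial, hv, hvv⟩
  have : Nonempty (Fin n) := ⟨⟨0, by omega⟩⟩
  let b := basisOfLinearIndependentOfCardEqFinrank he.linearIndependent (by simp)
  have hb : ⇑b = e := coe_basisOfLinearIndependentOfCardEqFinrank _ _
  have hsq : ∀ i, IsLead I b i i := fun i => Submodule.mem_sup_left (by
    rw [hb]
    exact he.sq_mem i)
  let t : Fin n := ⟨Module.finrank K T, by omega⟩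
  -- Only three variables lie outside the annihilator, so the sole possible surviving monomial is
  -- their product.
  have key : ∀ d : Fin n →₀ ℕ, 3 ≤ d.degree → ¬ HasLeadDivisor I b d →
      d.support = Finset.Ici t ∧ (∀ i, d i ≤ 1) ∧ d.degree = 3 := by
    intro d hd hcon
    obtain ⟨h1, hcard, hker, -⟩ := support_of_not_hasLeadDivisor hsq hd hcon
    have hsub : d.support ⊆ Finset.Ici t := by
      intro i hi
      by_contra hit
      rw [Finset.mem_Ici, not_le] at hit
      refine hker i hi ?_
      rw [hb, hee i (Fin.castSucc ⟨i, hit⟩) rfl]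
      exact heT _
    have hIci : (Finset.Ici t).card = 3 := by
      rw [Fin.card_Ici]
      show n - Module.finrank K T = 3
      omega
    have hle := Finset.card_le_card hsub
    exact ⟨Finset.eq_of_subset_of_card_le hsub (by omega), h1, by omega⟩
  refine isGQuadratic_of_hasLeadDivisor hI b fun d hd => or_iff_not_imp_left.2 fun hcon => ?_
  obtain ⟨hs, h1, h3⟩ := key d hd hcon
  refine ⟨gradedPiece_three_ne_bot hI hW hn, h3, fun c hc => not_imp_comm.1 fun hcon' => ?_⟩
  obtain ⟨hs', h1', -⟩ := key c hc.ge hcon'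
  ext i
  have hi : i ∈ c.support ↔ i ∈ d.support := by rw [hs, hs']
  rw [Finsupp.mem_support_iff, Finsupp.mem_support_iff] at hi
  have := h1 i
  have := h1' i
  omega

end GQuadratic

/-! ### Regular sequences of ternary quadrics -/

/-- A common irreducible factor would divide powers of both variables, hence be associated to each
of them. -/
theorem isRelPrime_of_X_pow_mem {K : Type*} [Field K] {a b : MvPolynomial (Fin 2) K} {N : ℕ}
    (h : ∀ i, MvPolynomial.X i ^ N ∈ Ideal.span {a, b}) : IsRelPrime a b := by
  intro d hda hdb
  have hd : ∀ i, d ∣ MvPolynomial.X i ^ N := fun i => by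
    obtain ⟨u, v, huv⟩ := Ideal.mem_span_pair.1 (h i)
    rw [← huv]
    exact dvd_add (hda.mul_left _) (hdb.mul_left _)
  have hd0 : d ≠ 0 := by
    rintro rfl
    exact pow_ne_zero N (MvPolynomial.X_ne_zero 0) (zero_dvd_iff.1 (hd 0))
  by_contra hu
  obtain ⟨p, hp, hpd⟩ := WfDvdMonoid.exists_irreducible_factor hu hd0
  have hX : ∀ i, Associated p (MvPolynomial.X i : MvPolynomial (Fin 2) K) := fun i =>
    (hp.prime.dvd_prime_iff_associated (MvPolynomial.X_prime)).1
      (hp.prime.dvd_of_dvd_pow (hpd.trans (hd i)))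
  have := MvPolynomial.X_dvd_X.1 ((hX 0).symm.trans (hX 1)).dvd
  exact absurd this (by decide)

section RegularSequence

variable {K : Type*} [Field K]

/-- The restriction of polynomials to the hyperplane `X 0 = 0`. -/
noncomputable def killZero (K : Type*) [Field K] (k : ℕ) :
    MvPolynomial (Fin (k + 1)) K →ₐ[K] MvPolynomial (Fin k) K :=
  MvPolynomial.aeval (Fin.cases 0 MvPolynomial.X)

theorem killZero_X_zero (k : ℕ) : killZero K k (MvPolynomial.X 0) = 0 := by
  rw [killZero, MvPolynomial.aeval_X, Fin.cases_zero]

theorem killZero_X_succ {k : ℕ} (i : Fin k) :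
    killZero K k (MvPolynomial.X i.succ) = MvPolynomial.X i := by
  rw [killZero, MvPolynomial.aeval_X, Fin.cases_succ]

theorem killZero_rename {k : ℕ} (f : MvPolynomial (Fin k) K) :
    killZero K k (MvPolynomial.rename Fin.succ f) = f := by
  induction f using MvPolynomial.induction_on with
  | C a => rw [MvPolynomial.rename_C, MvPolynomial.algHom_C]; rfl
  | add p q hp hq => rw [map_add, map_add, hp, hq]
  | mul_X p i hp => rw [map_mul, map_mul, hp, MvPolynomial.rename_X, killZero_X_succ]

theorem killZero_isHomogeneous {k : ℕ} {f : MvPolynomial (Fin (k + 1)) K} {d : ℕ}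
    (hf : f.IsHomogeneous d) : (killZero K k f).IsHomogeneous d :=
  IsHomogeneous.aeval_linear (fun i => by
    induction i using Fin.cases with
    | zero => exact MvPolynomial.isHomogeneous_zero _ _ _
    | succ i => exact MvPolynomial.isHomogeneous_X _ _) hf

theorem X_zero_dvd_sub {k : ℕ} (f : MvPolynomial (Fin (k + 1)) K) :
    MvPolynomial.X 0 ∣ f - MvPolynomial.rename Fin.succ (killZero K k f) := by
  induction f using MvPolynomial.induction_on with
  | C a =>
    rw [MvPolynomial.algHom_C, MvPolynomial.algebraMap_eq, MvPolynomial.rename_C, sub_self]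
    exact dvd_zero _
  | add p q hp hq =>
    rw [map_add, map_add, add_sub_add_comm]
    exact dvd_add hp hq
  | mul_X p i hp =>
    rw [map_mul, map_mul]
    induction i using Fin.cases with
    | zero => rw [killZero_X_zero, map_zero, mul_zero, sub_zero]; exact dvd_mul_left _ _
    | succ i =>
      rw [killZero_X_succ, MvPolynomial.rename_X, ← sub_mul]
      exact hp.mul_right _

theorem killZero_eq_zero_iff {k : ℕ} {f : MvPolynomial (Fin (k + 1)) K} :
    killZero K k f = 0 ↔ MvPolynomial.X 0 ∣ f := by
  constructor
  · intro h
    have := X_zero_dvd_sub f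
    rwa [h, map_zero, sub_zero] at this
  · rintro ⟨g, rfl⟩
    rw [map_mul, killZero_X_zero, zero_mul]

theorem mem_of_homogeneousComponent_mem {σ : Type*} {J : Ideal (MvPolynomial σ K)}
    {f : MvPolynomial σ K} (h : ∀ j, MvPolynomial.homogeneousComponent j f ∈ J) : f ∈ J := by
  rw [← MvPolynomial.sum_homogeneousComponent f]
  exact sum_mem fun j _ => h j

/-- If `X₀f = ua + vb`, then modulo `X₀` the pair `(u, v)` is a syzygy of two coprime polynomials,
hence a multiple of the trivial syzygy. Subtracting a lift of that syzygy makes both coefficients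
divisible by `X₀`, which can then be cancelled. -/
theorem X_zero_mul_mem {a b f : MvPolynomial (Fin 3) K}
    (hab : IsRelPrime (killZero K 2 a) (killZero K 2 b)) (ha : killZero K 2 a ≠ 0)
    (h : MvPolynomial.X 0 * f ∈ Ideal.span {a, b}) : f ∈ Ideal.span {a, b} := by
  obtain ⟨u, v, huv⟩ := Ideal.mem_span_pair.1 h
  have h0 := congrArg (killZero K 2) huv
  simp only [map_add, map_mul, killZero_X_zero, zero_mul] at h0
  obtain ⟨c, hc⟩ : killZero K 2 a ∣ killZero K 2 v := by
    refine hab.dvd_of_dvd_mul_right ⟨-killZero K 2 u, ?_⟩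
    linear_combination h0
  have hu : killZero K 2 u = -(c * killZero K 2 b) := by
    refine mul_right_cancel₀ ha ?_
    rw [hc] at h0
    linear_combination h0
  set C := MvPolynomial.rename (R := K) Fin.succ c with hC
  have hCc : killZero K 2 C = c := killZero_rename c
  obtain ⟨v', hv'⟩ : MvPolynomial.X 0 ∣ v - a * C :=
    killZero_eq_zero_iff.1 (by rw [map_sub, map_mul, hCc, hc, sub_self])
  obtain ⟨u', hu'⟩ : MvPolynomial.X 0 ∣ u + C * b :=
    killZero_eq_zero_iff.1 (by rw [map_add, map_mul, hCc, hu, neg_add_cancel])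
  refine Ideal.mem_span_pair.2 ⟨u', v', mul_left_cancel₀ (MvPolynomial.X_ne_zero (R := K) 0) ?_⟩
  linear_combination huv - a * hu' - b * hv'

theorem X_zero_mul_mem_span_singleton {a f : MvPolynomial (Fin 3) K} (ha : killZero K 2 a ≠ 0)
    (h : a ∣ MvPolynomial.X 0 * f) : a ∣ f := by
  obtain ⟨u, hu⟩ := h
  have h0 := congrArg (killZero K 2) hu
  rw [map_mul, map_mul, killZero_X_zero, zero_mul] at h0
  obtain ⟨u', rfl⟩ := killZero_eq_zero_iff.1 ((mul_eq_zero.1 h0.symm).resolve_left ha)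
  exact ⟨u', mul_left_cancel₀ (MvPolynomial.X_ne_zero (R := K) 0) (by linear_combination hu)⟩

/-- Modulo `X₀` coprimality gives `f = ac + X₀g`. Since `X₀` can be cancelled modulo `a`, the
problem passes to `g`, of smaller degree. -/
theorem dvd_of_dvd_mul_of_isHomogeneous {a b : MvPolynomial (Fin 3) K}
    (haq : a.IsHomogeneous 2)
    (hab : IsRelPrime (killZero K 2 a) (killZero K 2 b)) (ha : killZero K 2 a ≠ 0) {d : ℕ}
    {f : MvPolynomial (Fin 3) K} (hf : f.IsHomogeneous d) (h : a ∣ b * f) : a ∣ f := by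
  induction d generalizing f with
  | zero =>
    obtain ⟨u, hu⟩ := h
    obtain ⟨c, hc⟩ : killZero K 2 a ∣ killZero K 2 f :=
      hab.dvd_of_dvd_mul_left ⟨killZero K 2 u, by rw [← map_mul, hu, map_mul]⟩
    obtain ⟨g, hg⟩ : MvPolynomial.X 0 ∣ f - a * MvPolynomial.rename Fin.succ c :=
      killZero_eq_zero_iff.1 (by rw [map_sub, map_mul, killZero_rename, hc, sub_self])
    have h1 := congrArg (MvPolynomial.homogeneousComponent 0) hg
    rw [map_sub, MvPolynomial.homogeneousComponent_eq_self hf,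
      MvPolynomial.homogeneousComponent_mul_of_lt haq (by omega),
      MvPolynomial.homogeneousComponent_mul_of_lt (MvPolynomial.isHomogeneous_X K _) (by omega),
        sub_zero] at h1
    rw [h1]
    exact dvd_zero _
  | succ d ih =>
    have hS : IsQuadraticIdeal (Ideal.span {a}) := ⟨{a}, by simpa using haq, rfl⟩
    obtain ⟨u, hu⟩ := h
    obtain ⟨c, hc⟩ : killZero K 2 a ∣ killZero K 2 f :=
      hab.dvd_of_dvd_mul_left ⟨killZero K 2 u, by rw [← map_mul, hu, map_mul]⟩
    obtain ⟨g, hg⟩ : MvPolynomial.X 0 ∣ f - a * MvPolynomial.rename Fin.succ c :=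
      killZero_eq_zero_iff.1 (by rw [map_sub, map_mul, killZero_rename, hc, sub_self])
    have h1 := congrArg (MvPolynomial.homogeneousComponent (1 + d)) hg
    rw [MvPolynomial.homogeneousComponent_add_mul (MvPolynomial.isHomogeneous_X K _), map_sub,
      add_comm 1 d,
      MvPolynomial.homogeneousComponent_eq_self hf, sub_eq_iff_eq_add] at h1
    have h2 : a ∣ MvPolynomial.homogeneousComponent (d + 1) (a * MvPolynomial.rename Fin.succ c) :=
      Ideal.mem_span_singleton.1 (hS.homogeneousComponent_mem
        (Ideal.mem_span_singleton.2 (dvd_mul_right _ _)) _)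
    rw [h1]
    refine dvd_add (Dvd.dvd.mul_left (ih (MvPolynomial.homogeneousComponent_isHomogeneous _ _) ?_)
      _)
      h2
    refine X_zero_mul_mem_span_singleton ha ?_
    have h3 : MvPolynomial.X 0 * (b * MvPolynomial.homogeneousComponent d g) =
        a * u - b * MvPolynomial.homogeneousComponent (d + 1)
          (a * MvPolynomial.rename Fin.succ c) := by
      rw [← hu]
      linear_combination -b * h1
    rw [h3]
    exact dvd_sub (dvd_mul_right _ _) (h2.mul_left _)

/-- Write `Q = (a, b)`. Multiplication by `X₀` on the quotient by `Q` is injective everywhere and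
surjective in high degrees, so the Hilbert function is eventually constant. Multiplication by `c` is
surjective in high degrees between spaces of equal dimension, hence injective there. Small degrees
are reached by first multiplying with a power of `X₀`. -/
theorem mul_mem_of_eventually {a b c : MvPolynomial (Fin 3) K} (ha : a.IsHomogeneous 2)
    (hb : b.IsHomogeneous 2) (hc : c.IsHomogeneous 2)
    (hX : ∀ f, MvPolynomial.X 0 * f ∈ Ideal.span {a, b} → f ∈ Ideal.span {a, b}) {N : ℕ}
    (h1 : ∀ j, N ≤ j → ∀ f : MvPolynomial (Fin 3) K, f.IsHomogeneous j →
      f ∈ Ideal.span {a, b} ⊔ Ideal.span {MvPolynomial.X 0})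
    (h2 : ∀ j, N ≤ j → ∀ f : MvPolynomial (Fin 3) K, f.IsHomogeneous j →
      f ∈ Ideal.span {a, b} ⊔ Ideal.span {c})
    {f : MvPolynomial (Fin 3) K} (hf : c * f ∈ Ideal.span {a, b}) : f ∈ Ideal.span {a, b} := by
  set Q : Ideal (MvPolynomial (Fin 3) K) := Ideal.span {a, b} with hQdef
  have hQ : IsQuadraticIdeal Q := ⟨{a, b}, by
    rintro g (rfl | rfl)
    · exact ha
    · exact hb, rfl⟩
  -- multiplication by `y` on graded pieces
  have hmap : ∀ (y : MvPolynomial (Fin 3) K) (e j : ℕ), y.IsHomogeneous e →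
      (∀ f : MvPolynomial (Fin 3) K, f.IsHomogeneous (e + j) → f ∈ Q ⊔ Ideal.span {y}) →
      (gradedPiece Q j).map (LinearMap.mulLeft K (Ideal.Quotient.mk Q y)) =
        gradedPiece Q (e + j) := by
    intro y e j hy h
    apply le_antisymm
    · rintro _ ⟨x, hx, rfl⟩
      exact gradedPiece_mul_mem ⟨y, hy, rfl⟩ hx
    · rintro _ ⟨g, hg, rfl⟩
      obtain ⟨s, hs, t, ht, hst⟩ := Submodule.mem_sup.1 (h g hg)
      obtain ⟨u, rfl⟩ := Ideal.mem_span_singleton.1 ht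
      have h3 := congrArg (MvPolynomial.homogeneousComponent (e + j)) hst
      rw [map_add, MvPolynomial.homogeneousComponent_add_mul hy,
        MvPolynomial.homogeneousComponent_eq_self hg]
        at h3
      refine ⟨_, ⟨_, MvPolynomial.homogeneousComponent_isHomogeneous j u, rfl⟩, ?_⟩
      show Ideal.Quotient.mk Q y * Ideal.Quotient.mk Q _ = Ideal.Quotient.mk Q g
      rw [← map_mul, Ideal.Quotient.eq, ← h3, sub_add_cancel_right, neg_mem_iff]
      exact hQ.homogeneousComponent_mem hs _
  have hfin : ∀ j, Module.Finite K (gradedPiece Q j) := fun j => by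
    have : Module.Finite K (MvPolynomial.homogeneousSubmodule (Fin 3) K j) :=
      Module.Finite.iff_fg.2 (MvPolynomial.homogeneousSubmodule_fg (Fin 3) K j)
    exact Module.Finite.map _ _
  have hXinj : Function.Injective (LinearMap.mulLeft K (Ideal.Quotient.mk Q
      (MvPolynomial.X 0 : MvPolynomial (Fin 3) K))) := by
    rw [injective_iff_map_eq_zero]
    intro x hx
    obtain ⟨f, rfl⟩ := Ideal.Quotient.mk_surjective x
    rw [LinearMap.mulLeft_apply, ← map_mul, Ideal.Quotient.eq_zero_iff_mem] at hx
    exact Ideal.Quotient.eq_zero_iff_mem.2 (hX f hx)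
  have hdim : ∀ j, N ≤ j →
      Module.finrank K (gradedPiece Q (1 + j)) = Module.finrank K (gradedPiece Q j) := by
    intro j hj
    rw [← hmap (MvPolynomial.X 0) 1 j (MvPolynomial.isHomogeneous_X K _) (h1 _ (by omega))]
    exact (Submodule.equivMapOfInjective _ hXinj _).finrank_eq.symm
  have hcinj : ∀ j, N ≤ j → ∀ f : MvPolynomial (Fin 3) K, f.IsHomogeneous j → c * f ∈ Q →
      f ∈ Q := by
    intro j hj f hf hcf
    have hm := hmap c 2 j hc (h2 _ (by omega))
    have hd : Module.finrank K (gradedPiece Q (2 + j)) = Module.finrank K (gradedPiece Q j) := by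
      rw [show 2 + j = 1 + (1 + j) by omega, hdim _ (by omega), hdim _ hj]
    rw [← hm, ← LinearMap.range_domRestrict] at hd
    have h3 := LinearMap.finrank_range_add_finrank_ker
      ((LinearMap.mulLeft K (Ideal.Quotient.mk Q c)).domRestrict (gradedPiece Q j))
    have h4 : LinearMap.ker ((LinearMap.mulLeft K (Ideal.Quotient.mk Q c)).domRestrict
        (gradedPiece Q j)) = ⊥ := Submodule.finrank_eq_zero.1 (by omega)
    have h5 := (LinearMap.ker_eq_bot'.1 h4) ⟨Ideal.Quotient.mk Q f, ⟨f, hf, rfl⟩⟩ (by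
      rw [LinearMap.domRestrict_apply, LinearMap.mulLeft_apply, ← map_mul]
      exact Ideal.Quotient.eq_zero_iff_mem.2 hcf)
    exact Ideal.Quotient.eq_zero_iff_mem.1 (congrArg Subtype.val h5)
  refine mem_of_homogeneousComponent_mem fun j => ?_
  have h6 : c * MvPolynomial.homogeneousComponent j f ∈ Q := by
    rw [← MvPolynomial.homogeneousComponent_add_mul hc]
    exact hQ.homogeneousComponent_mem hf _
  have h7 : ∀ (k : ℕ) (g : MvPolynomial (Fin 3) K), MvPolynomial.X 0 ^ k * g ∈ Q → g ∈ Q := by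
    intro k
    induction k with
    | zero => intro g hg; rwa [pow_zero, one_mul] at hg
    | succ k ih =>
      intro g hg
      refine ih g (hX _ ?_)
      rwa [← mul_assoc, ← pow_succ']
  refine h7 N _ (hcinj (N + j) (by omega) _ ?_ ?_)
  · have := ((MvPolynomial.isHomogeneous_X K (0 : Fin 3)).pow N).mul
      (MvPolynomial.homogeneousComponent_isHomogeneous j f)
    rwa [one_mul] at this
  · rw [mul_left_comm]
    exact Q.mul_mem_left _ h6

/-- A criterion for three ternary quadrics to form a regular sequence. -/
theorem isRegular_of_eventually {q : Fin 3 → MvPolynomial (Fin 3) K}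
    (hq : ∀ i, (q i).IsHomogeneous 2) {N : ℕ}
    (h1 : ∀ j, N ≤ j → ∀ f : MvPolynomial (Fin 3) K, f.IsHomogeneous j →
      f ∈ Ideal.span {q 0, q 1} ⊔ Ideal.span {MvPolynomial.X 0})
    (h2 : ∀ j, N ≤ j → ∀ f : MvPolynomial (Fin 3) K, f.IsHomogeneous j →
      f ∈ Ideal.span (Set.range q)) :
    RingTheory.Sequence.IsRegular (MvPolynomial (Fin 3) K) [q 0, q 1, q 2] := by
  have hrange : Ideal.span (Set.range q) = Ideal.span {q 0, q 1} ⊔ Ideal.span {q 2} := by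
    rw [← Ideal.span_union]
    congr 1
    ext x
    simp only [Set.mem_range, Fin.exists_fin_succ, Set.mem_union, Set.mem_insert_iff,
      Set.mem_singleton_iff, eq_comm (b := x), IsEmpty.exists_iff, or_false]
    exact or_assoc.symm
  have hab : IsRelPrime (killZero K 2 (q 0)) (killZero K 2 (q 1)) := by
    refine isRelPrime_of_X_pow_mem (N := N) fun i => ?_
    have h3 := h1 N le_rfl (MvPolynomial.X i.succ ^ N) (by
      have := (MvPolynomial.isHomogeneous_X K i.succ).pow N
      rwa [one_mul] at this)
    obtain ⟨s, hs, t, ht, hst⟩ := Submodule.mem_sup.1 h3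
    have h4 := congrArg (killZero K 2) hst
    rw [map_add, killZero_eq_zero_iff.2 (Ideal.mem_span_singleton.1 ht), add_zero, map_pow,
      killZero_X_succ] at h4
    rw [← h4]
    obtain ⟨u, v, rfl⟩ := Ideal.mem_span_pair.1 hs
    exact Ideal.mem_span_pair.2 ⟨_, _, by rw [map_add, map_mul, map_mul]⟩
  have ha : killZero K 2 (q 0) ≠ 0 := by
    intro h0
    -- If `q 0` vanished on `X₀ = 0`, coprimality would make the restriction of `q 1`, a quadric, a
    -- unit.
    have hu : IsUnit (killZero K 2 (q 1)) := hab (h0 ▸ dvd_zero _) dvd_rfl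
    have hu' := hu.map (MvPolynomial.constantCoeff (R := K) (σ := Fin 2))
    rw [MvPolynomial.constantCoeff_eq, (killZero_isHomogeneous (hq 1)).coeff_eq_zero (by simp)]
      at hu'
    exact not_isUnit_zero hu'
  have hq0 : q 0 ≠ 0 := fun h => ha (by rw [h, map_zero])
  have key : ∀ (J : Ideal (MvPolynomial (Fin 3) K)) (c : MvPolynomial (Fin 3) K),
      (∀ f, c * f ∈ J → f ∈ J) → IsSMulRegular (MvPolynomial (Fin 3) K ⧸
        (J • ⊤ : Submodule (MvPolynomial (Fin 3) K) (MvPolynomial (Fin 3) K))) c := by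
    intro J c h
    rw [isSMulRegular_on_quot_iff_lsmul_comap_le]
    intro f hf
    rw [smul_eq_mul, Ideal.mul_top]
    rw [Submodule.mem_comap, smul_eq_mul, Ideal.mul_top] at hf
    exact h f hf
  have hdvd : ∀ f, q 0 ∣ q 1 * f → q 0 ∣ f := by
    intro f hf
    rw [← Ideal.mem_span_singleton] at hf ⊢
    have hS : IsQuadraticIdeal (Ideal.span {q 0}) := ⟨{q 0}, by simpa using hq 0, rfl⟩
    refine mem_of_homogeneousComponent_mem fun j => Ideal.mem_span_singleton.2 ?_
    refine dvd_of_dvd_mul_of_isHomogeneous (hq 0) hab ha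
      (MvPolynomial.homogeneousComponent_isHomogeneous j f) ?_
    rw [← MvPolynomial.homogeneousComponent_add_mul (hq 1), ← Ideal.mem_span_singleton]
    exact hS.homogeneousComponent_mem hf _
  refine ⟨⟨?_⟩, ?_⟩
  · intro i hi
    refine key _ _ fun f hf => ?_
    obtain rfl | rfl | rfl : i = 0 ∨ i = 1 ∨ i = 2 := by
      simp only [List.length_cons, List.length_nil] at hi
      omega
    · simp only [List.take_zero, Ideal.ofList_nil, Ideal.mem_bot, List.getElem_cons_zero] at hf ⊢
      exact (mul_eq_zero.1 hf).resolve_left hq0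
    · simp only [List.take_succ_cons, List.take_zero, Ideal.ofList_singleton,
        Ideal.mem_span_singleton, List.getElem_cons_succ, List.getElem_cons_zero] at hf ⊢
      exact hdvd f hf
    · have hl : Ideal.ofList (List.take 2 [q 0, q 1, q 2]) = Ideal.span {q 0, q 1} := by
        simp [Ideal.span_insert]
      rw [hl] at hf ⊢
      exact mul_mem_of_eventually (hq 0) (hq 1) (hq 2) (fun f => X_zero_mul_mem hab ha) h1
        (hrange ▸ h2) hf
  · intro h
    rw [smul_eq_mul, Ideal.mul_top] at h
    have hle : Ideal.ofList [q 0, q 1, q 2] ≤ RingHom.ker (MvPolynomial.constantCoeff (R := K)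
        (σ := Fin 3)) := by
      rw [Ideal.ofList, Ideal.span_le]
      intro f hf
      have : ∃ i, q i = f := by
        simp only [List.mem_cons, List.not_mem_nil, or_false, Set.mem_ofPred_eq] at hf
        rcases hf with rfl | rfl | rfl
        exacts [⟨_, rfl⟩, ⟨_, rfl⟩, ⟨_, rfl⟩]
      obtain ⟨i, rfl⟩ := this
      show MvPolynomial.constantCoeff (q i) = 0
      rw [MvPolynomial.constantCoeff_eq, (hq i).coeff_eq_zero (by simp)]
    have h8 : (1 : MvPolynomial (Fin 3) K) ∈ RingHom.ker (MvPolynomial.constantCoeff (R := K)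
        (σ := Fin 3)) := hle (h ▸ trivial)
    rw [RingHom.mem_ker, map_one] at h8
    exact one_ne_zero h8

end RegularSequence

/-! ### Trivial extensions of complete intersections -/

theorem exists_basis_zero_eq {K V : Type*} [Field K] [AddCommGroup V] [Module K V] {k : ℕ}
    (hV : Module.finrank K V = k + 1) {u : V} (hu : u ≠ 0) :
    ∃ b : Module.Basis (Fin (k + 1)) K V, b 0 = u := by
  have : Module.Finite K V := Module.finite_of_finrank_pos (by omega)
  obtain ⟨N, hN⟩ := (K ∙ u).exists_isCompl
  have hf := Submodule.finrank_add_eq_of_isCompl hN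
  rw [finrank_span_singleton hu] at hf
  refine ⟨Module.Basis.mkFinCons u (Module.finBasisOfFinrankEq K N (n := k) (by omega)) ?_ ?_, ?_⟩
  · intro c x hx hcx
    have h1 : c • u ∈ N := by
      rw [eq_neg_of_add_eq_zero_left hcx]
      exact neg_mem hx
    have h2 := Submodule.disjoint_def.1 hN.disjoint _
      (Submodule.smul_mem _ c (Submodule.mem_span_singleton_self u)) h1
    exact (smul_eq_zero.1 h2).resolve_right hu
  · intro z
    have hz : z ∈ K ∙ u ⊔ N := hN.sup_eq_top ▸ trivial
    obtain ⟨_, h1, y, hy, rfl⟩ := Submodule.mem_sup.1 hz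
    obtain ⟨c, rfl⟩ := Submodule.mem_span_singleton.1 h1
    refine ⟨-c, ?_⟩
    have : c • u + y + -c • u = y := by module
    rwa [this]
  · rw [Module.Basis.coe_mkFinCons, Fin.cons_zero]

section Exceptional

variable {K : Type*} [Field K] {n : ℕ} {I : Ideal (MvPolynomial (Fin n) K)}

/-- If the annihilator of `R₁` has codimension three and contains all square-zero linear forms, then
`R` is a trivial extension of a general complete intersection. -/
theorem exists_isGeneralCompleteIntersection [IsAlgClosed K] (hI : IsQuadraticIdeal I)
    [IsArtinianRing (MvPolynomial (Fin n) K ⧸ I)] (h3 : Module.finrank K (gradedPiece I 2) = 3)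
    (hT : Module.finrank K (LinearMap.ker (linMul I)) + 3 = n)
    (hsq : ∀ x, linMul I x x = 0 → x ∈ LinearMap.ker (linMul I)) :
    ∃ q : Fin 3 → MvPolynomial (Fin 3) K, IsGeneralCompleteIntersection q ∧
      IsTrivialExtensionOf I (Ideal.span (Set.range q)) := by
  have : Module.Finite K (gradedPiece I 2) := Module.finite_of_finrank_pos (by omega)
  obtain ⟨P, hP⟩ := (LinearMap.ker (linMul I)).exists_isCompl
  have hf := Submodule.finrank_add_eq_of_isCompl hP
  rw [Module.finrank_fin_fun] at hf
  have hP3 : Module.finrank K P = 3 := by omega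
  -- A relation `uv = 0` exists by the pencil argument. With `u` as first coordinate it becomes a
  -- quadric divisible by `X₀`, as the regularity criterion will need.
  obtain ⟨u, huP, hu0, v, hvP, hv0, huv⟩ := exists_mul_mem (μ := linMul I) (P := P) (Q := P)
    (D := ⊥) (by omega) (by rw [finrank_bot]; omega) (by
      rintro rfl
      rw [finrank_bot] at hP3
      omega)
  rw [Submodule.mem_bot] at huv
  obtain ⟨p, hp⟩ := exists_basis_zero_eq (k := 2) hP3 (u := ⟨u, huP⟩)
    fun h => hu0 (congrArg Subtype.val h)
  obtain ⟨r, b, hbp, hb⟩ := exists_basis_sum hP.symm p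
  have hA : ∀ w : Fin 3 → K, MvPolynomial.aeval (fun i => linPoly (b (Sum.inl i))) (linPoly w) =
      linPoly (p.equivFun.symm w : Fin n → K) := by
    intro w
    rw [linPoly_apply, map_sum, Module.Basis.equivFun_symm_apply, Submodule.coe_sum, map_sum]
    refine Finset.sum_congr rfl fun i _ => ?_
    rw [map_mul, MvPolynomial.aeval_X, MvPolynomial.aeval_C, Submodule.coe_smul, map_smul,
      Algebra.smul_def, hbp]
  set J := restrictIdeal I b with hJdef
  have hJ : IsQuadraticIdeal J := isQuadraticIdeal_restrictIdeal b hI hb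
  have hJ3 := finrank_quadricsOf ((finrank_gradedPiece_restrictIdeal b hb).trans h3)
  set w := p.equivFun ⟨v, hvP⟩ with hw
  have hw0 : w ≠ 0 := fun h => hv0 (congrArg Subtype.val ((map_eq_zero_iff _
    p.equivFun.injective).1 h))
  have hXw : MvPolynomial.X 0 * linPoly w ∈ quadricsOf J := by
    refine ⟨(MvPolynomial.isHomogeneous_X K _).mul (linPoly_isHomogeneous w), ?_⟩
    show MvPolynomial.aeval (fun i => linPoly (b (Sum.inl i))) (MvPolynomial.X 0 * linPoly w) ∈ I
    rw [map_mul, MvPolynomial.aeval_X, hA, hbp, hp, hw, LinearEquiv.symm_apply_apply]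
    exact linMul_eq_zero_iff.1 huv
  obtain ⟨c, hc⟩ := exists_basis_zero_eq (k := 2) hJ3 (u := ⟨_, hXw⟩) fun h => by
    have h1 : MvPolynomial.X 0 * linPoly w = 0 := congrArg Subtype.val h
    refine hw0 (linPoly_injective (K := K) (σ := Fin 3) ?_)
    rw [map_zero]
    exact (mul_eq_zero.1 h1).resolve_left (MvPolynomial.X_ne_zero 0)
  -- The cyclic shift puts the distinguished quadric, the basis vector of index zero, in the last
  -- position.
  let q : Fin 3 → MvPolynomial (Fin 3) K := fun i => c (i + 1)
  have hqJ : J = Ideal.span (Set.range q) := by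
    rw [hJ.eq_span_range_basis c]
    exact congrArg _ ((Equiv.addRight (1 : Fin 3)).surjective.range_comp
      fun i => (c i : MvPolynomial (Fin 3) K)).symm
  have hq : ∀ i, (q i).IsHomogeneous 2 := fun i => (c (i + 1)).2.1
  have hq2 : q 2 = MvPolynomial.X 0 * linPoly w := congrArg Subtype.val hc
  obtain ⟨N, hN⟩ := hI.exists_homogeneous_mem
  have hNJ : ∀ j, N ≤ j → ∀ f : MvPolynomial (Fin 3) K, f.IsHomogeneous j →
      f ∈ Ideal.span (Set.range q) := fun j hj f hf => by
    rw [← hqJ]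
    exact hN j hj _ (IsHomogeneous.aeval_linear (fun i => linPoly_isHomogeneous _) hf)
  refine ⟨q, ⟨hq, isRegular_of_eventually hq (N := N) (fun j hj f hf => ?_) hNJ, ?_⟩,
    r, coordChange b, coordChange_X_isHomogeneous b, ?_⟩
  -- Since `q 2` is a multiple of `X₀`, the whole ideal lies in `(q 0, q 1) + (X₀)`.
  · refine (Ideal.span_le.2 ?_ : Ideal.span (Set.range q) ≤ _) (hNJ j hj f hf)
    rintro _ ⟨i, rfl⟩
    fin_cases i
    · exact Ideal.mem_sup_left (Ideal.subset_span (Set.mem_insert _ _))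
    · exact Ideal.mem_sup_left (Ideal.subset_span (Set.mem_insert_of_mem _ rfl))
    · refine Ideal.mem_sup_right (Ideal.mem_span_singleton.2 ?_)
      exact ⟨_, hq2⟩
  · intro l hl hl0 hmem
    have hl' : l ∈ LinearMap.range (linPoly (K := K) (σ := Fin 3)) := by
      rw [range_linPoly]
      exact hl
    obtain ⟨z, rfl⟩ := hl'
    have h1 : linMul I (p.equivFun.symm z : Fin n → K) (p.equivFun.symm z : Fin n → K) = 0 := by
      rw [linMul_eq_zero_iff, ← hA, ← map_mul, ← sq]
      rw [← hqJ] at hmem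
      exact hmem
    have h2 := Submodule.disjoint_def.1 hP.disjoint _ (hsq _ h1) (p.equivFun.symm z).2
    have h4 : p.equivFun.symm z = 0 := Subtype.ext h2
    rw [(map_eq_zero_iff _ p.equivFun.symm.injective).1 h4, map_zero] at hl0
    exact hl0 rfl
  · rw [← hqJ]
    exact map_coordChange_eq_trivialExtensionIdeal b hI hb

end Exceptional

/-! ### Failure of G-quadraticity -/

section NotGQuadratic

variable {K : Type*} [Field K]

theorem isHomogeneous_algEquiv {σ τ : Type*} {φ : MvPolynomial σ K ≃ₐ[K] MvPolynomial τ K}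
    (hφ : ∀ i, (φ (MvPolynomial.X i)).IsHomogeneous 1) {f : MvPolynomial σ K} {d : ℕ}
    (hf : f.IsHomogeneous d) : (φ f).IsHomogeneous d := by
  have h : (φ : MvPolynomial σ K →ₐ[K] MvPolynomial τ K) =
      MvPolynomial.aeval fun i => φ (MvPolynomial.X i) := by
    apply MvPolynomial.algHom_ext
    intro i
    rw [MvPolynomial.aeval_X]
    rfl
  have := IsHomogeneous.aeval_linear hφ hf
  rwa [← h] at this

theorem exists_isHomogeneous_one_eq {n : ℕ}
    (φ : MvPolynomial (Fin n) K ≃ₐ[K] MvPolynomial (Fin n) K)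
    (hφ : ∀ i, (φ (MvPolynomial.X i)).IsHomogeneous 1) {f : MvPolynomial (Fin n) K}
    (hf : f.IsHomogeneous 1) : ∃ g : MvPolynomial (Fin n) K, g.IsHomogeneous 1 ∧ φ g = f := by
  set M := MvPolynomial.homogeneousSubmodule (Fin n) K 1
  have : Module.Finite K M := Module.Finite.iff_fg.2 (MvPolynomial.homogeneousSubmodule_fg (Fin n) K
      1)
  have hle : M.map φ.toLinearMap ≤ M := by
    rintro _ ⟨g, hg, rfl⟩
    exact isHomogeneous_algEquiv hφ hg
  have heq := Submodule.eq_of_le_of_finrank_le hle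
    (Submodule.equivMapOfInjective φ.toLinearMap φ.injective M).finrank_eq.le
  have hf' : f ∈ M.map φ.toLinearMap := heq.ge hf
  exact hf'

theorem finsupp_eq_single_of_le {n N : ℕ} {d : Fin n →₀ ℕ} {i : Fin n}
    (h : d ≤ Finsupp.single i N) : d = Finsupp.single i d.degree := by
  obtain ⟨k, rfl⟩ : ∃ k, d = Finsupp.single i k :=
    Finsupp.support_subset_singleton'.1 fun j hj => by
      by_contra hji
      rw [Finset.mem_singleton] at hji
      have := h j
      rw [Finsupp.single_eq_of_ne hji] at this
      exact (Finsupp.mem_support_iff.1 hj) (by omega)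
  rw [Finsupp.degree_single]

/-- If every square-zero linear form annihilates all linear forms, then a quadratic Gröbner basis
with squares of the variables as leading terms only exists if all products vanish. -/
theorem X_mul_mem_of_isGroebnerBasisOf {n : ℕ} {J : Ideal (MvPolynomial (Fin n) K)}
    {m : MonomialOrder (Fin n)} {G : Set (MvPolynomial (Fin n) K)}
    (hG : ∀ g ∈ G, g.IsHomogeneous 2) (hGB : IsGroebnerBasisOf m G J)
    (hJ : ∀ f : MvPolynomial (Fin n) K, f.IsHomogeneous 1 → f * f ∈ J →
      ∀ g : MvPolynomial (Fin n) K, g.IsHomogeneous 1 → f * g ∈ J)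
    {N : ℕ} (hN : ∀ i, MvPolynomial.X i ^ N ∈ J) (i : Fin n) {g : MvPolynomial (Fin n) K}
    (hg : g.IsHomogeneous 1) : MvPolynomial.X i * g ∈ J := by
  induction hs : m.toSyn (Finsupp.single i 1) using WellFoundedLT.induction generalizing i g with
  | ind s ih =>
  subst hs
  refine hJ _ (MvPolynomial.isHomogeneous_X K i) ?_ g hg
  -- The leading monomial of some quadric in `G` divides `Xᵢ ^ N`, so it is `Xᵢ²`.
  obtain ⟨f, hfG, hf0, hfd⟩ := hGB.2 _ (hN i) (pow_ne_zero N (MvPolynomial.X_ne_zero i))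
  have hXd : m.degree (MvPolynomial.X i ^ N : MvPolynomial (Fin n) K) = Finsupp.single i N := by
    classical
    rw [MvPolynomial.X_pow_eq_monomial, MonomialOrder.degree_monomial, if_neg one_ne_zero]
  rw [hXd] at hfd
  have hdeg2 : ∀ d ∈ f.support, d.degree = 2 := fun d hd => by
    have := hG f hfG (MvPolynomial.mem_support_iff.1 hd)
    rwa [Finsupp.degree_eq_weight_one]
  have hlead : m.degree f = Finsupp.single i 2 := by
    have := finsupp_eq_single_of_le hfd
    rwa [hdeg2 _ (m.degree_mem_support hf0)] at this
  have hrest : ∀ d ∈ f.support.erase (Finsupp.single i 2),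
      MvPolynomial.monomial d (f.coeff d) ∈ J := by
    intro d hd
    obtain ⟨hdi, hd⟩ := Finset.mem_erase.1 hd
    -- A quadratic monomial in variables none of which is smaller than `Xᵢ` cannot lie below `Xᵢ²`.
    -- Every other term of `f` therefore contains a smaller variable, and it is in `J` by induction.
    obtain ⟨a, ha, hai⟩ : ∃ a ∈ d.support,
        m.toSyn (Finsupp.single a 1) < m.toSyn (Finsupp.single i 1) := by
      by_contra! hcon
      have h1 : m.toSyn (Finsupp.single i 2) ≤ m.toSyn d := by
        have h2 : (Finsupp.single i 2 : Fin n →₀ ℕ) = 2 • Finsupp.single i 1 := by simp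
        have h3 : d = ∑ a ∈ d.support, d a • Finsupp.single a 1 := by
          conv_lhs => rw [← Finsupp.sum_single d, Finsupp.sum]
          refine Finset.sum_congr rfl fun a _ => ?_
          rw [Finsupp.smul_single, smul_eq_mul, mul_one]
        have h4 : 2 = ∑ a ∈ d.support, d a := by
          rw [← hdeg2 d hd, Finsupp.degree_apply]
        rw [h2, map_nsmul, h4, Finset.sum_smul]
        conv_rhs => rw [h3, map_sum]
        refine Finset.sum_le_sum fun a ha => ?_
        rw [map_nsmul]
        exact nsmul_le_nsmul_right (hcon a ha) _
      refine hdi (m.toSyn.injective (le_antisymm ?_ h1))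
      rw [← hlead]
      exact m.le_degree hd
    have hle : Finsupp.single a 1 ≤ d := by
      rw [Finsupp.single_le_iff]
      have := Finsupp.mem_support_iff.1 ha
      omega
    have hmon : MvPolynomial.monomial d (f.coeff d) = MvPolynomial.X a *
        MvPolynomial.monomial (d - Finsupp.single a 1) (f.coeff d) := by
      rw [MvPolynomial.X, MvPolynomial.monomial_mul, one_mul, add_tsub_cancel_of_le hle]
    rw [hmon]
    refine ih _ hai a (MvPolynomial.isHomogeneous_monomial _ ?_) rfl
    have h5 : d = Finsupp.single a 1 + (d - Finsupp.single a 1) := (add_tsub_cancel_of_le hle).symm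
    have h6 := hdeg2 d hd
    rw [h5, map_add, Finsupp.degree_single] at h6
    omega
  have hc : f.coeff (Finsupp.single i 2) ≠ 0 := by
    rw [← hlead]
    exact MvPolynomial.mem_support_iff.1 (m.degree_mem_support hf0)
  have hsum := f.support_sum_monomial_coeff
  rw [← Finset.add_sum_erase _ _ (MvPolynomial.mem_support_iff.2 hc)] at hsum
  have hmem : MvPolynomial.monomial (Finsupp.single i 2) (f.coeff (Finsupp.single i 2)) ∈ J := by
    rw [eq_sub_of_add_eq hsum]
    exact sub_mem (hGB.1 hfG) (sum_mem hrest)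
  have h7 := J.mul_mem_left (MvPolynomial.C (f.coeff (Finsupp.single i 2))⁻¹) hmem
  rwa [MvPolynomial.C_mul_monomial, inv_mul_cancel₀ hc, ← MvPolynomial.X_pow_eq_monomial, sq] at h7

theorem killInr_mem_of_mem_trivialExtensionIdeal {k r : ℕ} {J : Ideal (MvPolynomial (Fin k) K)}
    {f : MvPolynomial (Fin k ⊕ Fin r) K} (hf : f ∈ trivialExtensionIdeal J r) :
    killInr K k r f ∈ J := by
  have hle : trivialExtensionIdeal J r ≤ J.comap (killInr K k r) := by
    refine sup_le (Ideal.map_le_iff_le_comap.2 fun g hg => ?_) (Ideal.span_le.2 ?_)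
    · show killInr K k r (MvPolynomial.rename Sum.inl g) ∈ J
      rwa [killInr_rename]
    · rintro _ ⟨i, j, rfl⟩
      show killInr K k r _ ∈ J
      simp [killInr]
  exact hle hf

/-- A trivial extension of a general complete intersection is not G-quadratic. -/
theorem not_isGQuadratic_of_isTrivialExtensionOf {n : ℕ} {I : Ideal (MvPolynomial (Fin n) K)}
    (hI : IsQuadraticIdeal I) [IsArtinianRing (MvPolynomial (Fin n) K ⧸ I)]
    (h3 : gradedPiece I 2 ≠ ⊥) {q : Fin 3 → MvPolynomial (Fin 3) K}
    (hq : IsGeneralCompleteIntersection q)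
    (hext : IsTrivialExtensionOf I (Ideal.span (Set.range q))) : ¬ IsGQuadratic I := by
  obtain ⟨r, ψ, hψ, hIψ⟩ := hext
  rintro ⟨φ, m, G, hφ, hG, hGB⟩
  have hmemψ : ∀ f, f ∈ I ↔ ψ f ∈ trivialExtensionIdeal (Ideal.span (Set.range q)) r := fun f => by
    rw [← hIψ, mem_map_algEquiv_iff, AlgEquiv.symm_apply_apply]
  have hmemφ : ∀ f, φ f ∈ I.map (φ : MvPolynomial (Fin n) K →+* MvPolynomial (Fin n) K) ↔ f ∈ I :=
    fun f => by rw [mem_map_algEquiv_iff, AlgEquiv.symm_apply_apply]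
  have hsq : ∀ f : MvPolynomial (Fin n) K, f.IsHomogeneous 1 → f * f ∈ I →
      ∀ g : MvPolynomial (Fin n) K, g.IsHomogeneous 1 → f * g ∈ I := by
    intro f hf hff g hg
    rw [hmemψ, map_mul] at hff ⊢
    have hfψ : ψ f ∈ LinearMap.range (linPoly (K := K) (σ := Fin 3 ⊕ Fin r)) := by
      rw [range_linPoly]
      exact isHomogeneous_algEquiv hψ hf
    have hgψ : ψ g ∈ LinearMap.range (linPoly (K := K) (σ := Fin 3 ⊕ Fin r)) := by
      rw [range_linPoly]
      exact isHomogeneous_algEquiv hψ hg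
    obtain ⟨v, hv⟩ := hfψ
    obtain ⟨w, hw⟩ := hgψ
    rw [← hv] at hff ⊢
    rw [← hw]
    have hkill : killInr K 3 r (linPoly v) = linPoly fun i => v (Sum.inl i) := by
      rw [linPoly_apply, linPoly_apply, map_sum, Fintype.sum_sum_type]
      simp [killInr]
    -- Setting the new variables to zero gives the square of a linear form in the complete
    -- intersection ideal, so that form is zero. Hence `ψ f` involves only the new variables, which
    -- annihilate all linear forms.
    have h1 := killInr_mem_of_mem_trivialExtensionIdeal hff
    rw [map_mul, hkill, ← sq] at h1
    have h2 : linPoly (fun i => v (Sum.inl i)) = 0 := by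
      by_contra hne
      exact hq.no_square _ (linPoly_isHomogeneous _) hne h1
    have h3 : (fun i => v (Sum.inl i)) = 0 := linPoly_injective (K := K) (σ := Fin 3) (by
      rw [h2, map_zero])
    rw [linPoly_apply, Fintype.sum_sum_type, linPoly_apply]
    have h4 : ∀ i, v (Sum.inl i) = 0 := fun i => congrFun h3 i
    simp only [h4, map_zero, zero_mul, Finset.sum_const_zero, zero_add]
    rw [Finset.sum_mul_sum]
    refine sum_mem fun i _ => sum_mem fun j _ => ?_
    rw [mul_mul_mul_comm]
    exact Ideal.mul_mem_left _ _ (Ideal.mem_sup_right (Ideal.subset_span ⟨i, j, rfl⟩))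
  obtain ⟨N, hN⟩ := hI.exists_homogeneous_mem
  have key : ∀ i j, MvPolynomial.X i * MvPolynomial.X j ∈
      I.map (φ : MvPolynomial (Fin n) K →+* MvPolynomial (Fin n) K) := fun i j => by
    refine X_mul_mem_of_isGroebnerBasisOf hG hGB (N := N) ?_ ?_ i (MvPolynomial.isHomogeneous_X K j)
    · intro f hf hff g hg
      obtain ⟨f, hf', rfl⟩ := exists_isHomogeneous_one_eq φ hφ hf
      obtain ⟨g, hg', rfl⟩ := exists_isHomogeneous_one_eq φ hφ hg
      rw [← map_mul, hmemφ] at hff ⊢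
      exact hsq f hf' hff g hg'
    · intro i
      obtain ⟨f, hf, hfi⟩ := exists_isHomogeneous_one_eq φ hφ (MvPolynomial.isHomogeneous_X K i)
      rw [← hfi, ← map_pow, hmemφ]
      exact hN N le_rfl _ (by simpa using hf.pow N)
  refine h3 (eq_bot_iff.2 ?_)
  rintro _ ⟨f, hf, rfl⟩
  rw [Submodule.mem_bot]
  refine Ideal.Quotient.eq_zero_iff_mem.2 ((hmemφ f).1 ?_)
  have h5 : (φ f).IsHomogeneous 2 := isHomogeneous_algEquiv hφ hf
  exact homogeneousSubmodule_two_induction (M := (I.map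
    (φ : MvPolynomial (Fin n) K →+* MvPolynomial (Fin n) K)).restrictScalars K)
    key h5

end NotGQuadratic

/-- An Artinian quadratic algebra with `dim R₂ = 3` is G-quadratic if and only if it is not a
trivial extension of a general complete intersection. -/
theorem isGQuadratic_iff {K : Type*} [Field K] [IsAlgClosed K] (h2 : (2 : K) ≠ 0) {n : ℕ}
    {I : Ideal (MvPolynomial (Fin n) K)} (hI : IsQuadraticIdeal I)
    [IsArtinianRing (MvPolynomial (Fin n) K ⧸ I)] (h3 : Module.finrank K (gradedPiece I 2) = 3) :
    IsGQuadratic I ↔ ¬ ∃ q : Fin 3 → MvPolynomial (Fin 3) K,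
      IsGeneralCompleteIntersection q ∧ IsTrivialExtensionOf I (Ideal.span (Set.range q)) := by
  have hμ := isThreeMul_linMul hI h3
  have : Module.Finite K (gradedPiece I 2) := Module.finite_of_finrank_pos (by omega)
  constructor
  · rintro hG ⟨q, hq, hext⟩
    refine not_isGQuadratic_of_isTrivialExtensionOf hI ?_ hq hext hG
    intro hbot
    rw [hbot, finrank_bot] at h3
    omega
  · intro hne
    have hle := hμ.finrank_ker_add_three_le
    rw [Module.finrank_fin_fun] at hle
    rcases hle.eq_or_lt with hT | hT
    · by_cases hsq : ∀ x, linMul I x x = 0 → x ∈ LinearMap.ker (linMul I)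
      · exact absurd (exists_isGeneralCompleteIntersection hI h3 hT hsq) hne
      · push Not at hsq
        obtain ⟨x, hxx, hx⟩ := hsq
        exact isGQuadratic_of_sq_eq_zero hI hμ hT hx hxx
    · exact isGQuadratic_of_four_le h2 hI hμ hT

/-! ### Generic quadrics -/

section Macaulay

noncomputable instance fintypeDegreeEq (k d : ℕ) : Fintype {e : Fin k →₀ ℕ // e.degree = d} :=
  Fintype.subtype (Finset.univ.finsuppAntidiag d) fun e => by
    rw [Finset.mem_finsuppAntidiag, Finsupp.degree_eq_sum]
    simp

/-- The first variable, if any, whose square divides the given monomial. -/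
noncomputable def largeIndex (e : Fin 3 →₀ ℕ) : Fin 3 :=
  if 2 ≤ e 0 then 0 else if 2 ≤ e 1 then 1 else 2

/-- Pigeonhole: with all three exponents at most one, the degree would be at most three. This is why
degree four is used below. -/
theorem single_largeIndex_le {e : Fin 3 →₀ ℕ} (he : e.degree = 4) :
    Finsupp.single (largeIndex e) 2 ≤ e := by
  rw [Finsupp.degree_eq_sum, Fin.sum_univ_three] at he
  rw [Finsupp.single_le_iff, largeIndex]
  split_ifs with h1 h2
  · exact h1
  · exact h2
  · omega

/-- The coefficients in degree four of selected multiples of three quadrics. -/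
noncomputable def macaulayMatrix {R : Type*} [CommRing R] (q : Fin 3 → MvPolynomial (Fin 3) R) :
    Matrix {e : Fin 3 →₀ ℕ // e.degree = 4} {e : Fin 3 →₀ ℕ // e.degree = 4} R :=
  Matrix.of fun e e' => (q (largeIndex e) *
    MvPolynomial.monomial (e.1 - Finsupp.single (largeIndex e) 2) 1).coeff e'

open scoped Classical in
/-- A polynomial in the coefficients of three ternary quadrics whose nonvanishing implies that they
have no nontrivial common zero. -/
noncomputable def macaulayDet {R : Type*} [CommRing R] (q : Fin 3 → MvPolynomial (Fin 3) R) : R :=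
  (macaulayMatrix q).det

/-- Lets the determinant for indeterminate coefficients be specialised to any given triple. -/
theorem macaulayDet_map {R S : Type*} [CommRing R] [CommRing S] (f : R →+* S)
    (q : Fin 3 → MvPolynomial (Fin 3) R) :
    macaulayDet (fun k => MvPolynomial.map f (q k)) = f (macaulayDet q) := by
  classical
  rw [macaulayDet, macaulayDet, RingHom.map_det]
  congr 1
  ext e e'
  rw [RingHom.mapMatrix_apply, Matrix.map_apply, macaulayMatrix, macaulayMatrix, Matrix.of_apply,
    Matrix.of_apply, ← MvPolynomial.coeff_map, map_mul, MvPolynomial.map_monomial, map_one f]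

/-- For squares of the variables each selected multiple is the monomial indexing its row, so the
matrix is the identity. This specialisation shows that the generic determinants do not vanish. -/
theorem macaulayDet_X_sq {R : Type*} [CommRing R] :
    macaulayDet (fun k => (MvPolynomial.X k ^ 2 : MvPolynomial (Fin 3) R)) = 1 := by
  classical
  have : macaulayMatrix (fun k => (MvPolynomial.X k ^ 2 : MvPolynomial (Fin 3) R)) = 1 := by
    ext e e'
    rw [macaulayMatrix, Matrix.of_apply, MvPolynomial.X_pow_eq_monomial, MvPolynomial.monomial_mul,
      add_tsub_cancel_of_le (single_largeIndex_le e.2), MvPolynomial.coeff_monomial, one_mul,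
      Matrix.one_apply]
    simp only [Subtype.ext_iff]
  rw [macaulayDet, this, Matrix.det_one]

variable {K : Type*} [Field K]

/-- The rows are multiples of the given quadrics. An invertible matrix expresses every monomial of
degree four through them. -/
theorem monomial_mem_of_macaulayDet_ne_zero {q : Fin 3 → MvPolynomial (Fin 3) K}
    (hq : ∀ k, (q k).IsHomogeneous 2) (h : macaulayDet q ≠ 0)
    (e : {e : Fin 3 →₀ ℕ // e.degree = 4}) :
    MvPolynomial.monomial e.1 1 ∈ Ideal.span (Set.range q) := by
  classical
  have hinv : (macaulayMatrix q)⁻¹ * macaulayMatrix q = 1 :=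
    Matrix.nonsing_inv_mul _ (isUnit_iff_ne_zero.2 h)
  have hsum : MvPolynomial.monomial e.1 1 = ∑ m : {e : Fin 3 →₀ ℕ // e.degree = 4},
      MvPolynomial.C ((macaulayMatrix q)⁻¹ e m) * (q (largeIndex m) *
        MvPolynomial.monomial (m.1 - Finsupp.single (largeIndex m) 2) 1) := by
    ext d
    simp only [MvPolynomial.coeff_sum, MvPolynomial.coeff_C_mul, MvPolynomial.coeff_monomial]
    by_cases hd : d.degree = 4
    · have := congrFun (congrFun hinv e) ⟨d, hd⟩
      rw [Matrix.mul_apply, Matrix.one_apply] at this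
      simp only [Subtype.ext_iff] at this
      exact this.symm
    · rw [if_neg (by rintro rfl; exact hd e.2)]
      refine (Finset.sum_eq_zero fun m _ => ?_).symm
      have hm : (q (largeIndex m) * MvPolynomial.monomial
          (m.1 - Finsupp.single (largeIndex m) 2) 1).IsHomogeneous 4 := by
        refine (hq _).mul (n := 2) (MvPolynomial.isHomogeneous_monomial _ ?_)
        have h1 := congrArg Finsupp.degree (add_tsub_cancel_of_le (single_largeIndex_le m.2))
        rw [map_add, Finsupp.degree_single, m.2] at h1
        omega
      rw [hm.coeff_eq_zero hd, mul_zero]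
  rw [hsum]
  exact sum_mem fun m _ => Ideal.mul_mem_left _ _ (Ideal.mul_mem_right _ _
    (Ideal.subset_span ⟨_, rfl⟩))

theorem mem_of_macaulayDet_ne_zero {q : Fin 3 → MvPolynomial (Fin 3) K}
    (hq : ∀ k, (q k).IsHomogeneous 2) (h : macaulayDet q ≠ 0) {j : ℕ} (hj : 4 ≤ j)
    {f : MvPolynomial (Fin 3) K} (hf : f.IsHomogeneous j) : f ∈ Ideal.span (Set.range q) := by
  have h4 : MvPolynomial.homogeneousSubmodule (Fin 3) K 4 ≤
      (Ideal.span (Set.range q)).restrictScalars K := by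
    intro f hf
    rw [Submodule.restrictScalars_mem, ← f.support_sum_monomial_coeff]
    refine sum_mem fun d hd => ?_
    have hd4 : d.degree = 4 := by
      have := hf (MvPolynomial.mem_support_iff.1 hd)
      rwa [Finsupp.degree_eq_weight_one]
    have := Ideal.mul_mem_left _ (MvPolynomial.C (f.coeff d))
      (monomial_mem_of_macaulayDet_ne_zero hq h ⟨d, hd4⟩)
    rwa [MvPolynomial.C_mul_monomial, mul_one] at this
  obtain ⟨i, rfl⟩ := Nat.exists_eq_add_of_le hj
  have hf' : f ∈ MvPolynomial.homogeneousSubmodule (Fin 3) K (4 + i) := hf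
  rw [homogeneousSubmodule_add] at hf'
  have hle : MvPolynomial.homogeneousSubmodule (Fin 3) K 4 *
      MvPolynomial.homogeneousSubmodule (Fin 3) K i ≤
        (Ideal.span (Set.range q)).restrictScalars K :=
    Submodule.mul_le.2 fun a ha b _ => Ideal.mul_mem_right b _ (h4 ha)
  exact hle hf'

/-- The exponents of the product of the variables other than the `j`-th one. -/
noncomputable def offDiag (j : Fin 3) : Fin 3 →₀ ℕ :=
  Finsupp.single (j + 1) 1 + Finsupp.single (j + 2) 1

theorem degree_offDiag (j : Fin 3) : (offDiag j).degree = 2 := by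
  rw [offDiag, map_add, Finsupp.degree_single, Finsupp.degree_single]

theorem offDiag_injective : Function.Injective offDiag := by
  intro i j h
  have h1 := DFunLike.congr_fun h j
  fin_cases i <;> fin_cases j <;> simp [offDiag] at h1 ⊢

theorem offDiag_ne_single (i j : Fin 3) : offDiag j ≠ Finsupp.single i 2 := by
  intro h
  have h1 := DFunLike.congr_fun h i
  fin_cases i <;> fin_cases j <;> simp [offDiag] at h1

/-- The coefficients of three quadrics at products of distinct variables. -/
noncomputable def offDiagMatrix {R : Type*} [CommRing R] (q : Fin 3 → MvPolynomial (Fin 3) R) :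
    Matrix (Fin 3) (Fin 3) R :=
  Matrix.of fun k j => (q k).coeff (offDiag j)

/-- The coefficients of three quadrics at squares of variables. -/
noncomputable def diagMatrix {R : Type*} [CommRing R] (q : Fin 3 → MvPolynomial (Fin 3) R) :
    Matrix (Fin 3) (Fin 3) R :=
  Matrix.of fun k i => (q k).coeff (Finsupp.single i 2)

theorem offDiagMatrix_map {R S : Type*} [CommRing R] [CommRing S] (f : R →+* S)
    (q : Fin 3 → MvPolynomial (Fin 3) R) :
    offDiagMatrix (fun k => MvPolynomial.map f (q k)) = f.mapMatrix (offDiagMatrix q) := by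
  ext k j
  rw [offDiagMatrix, Matrix.of_apply, MvPolynomial.coeff_map]
  rfl

theorem diagMatrix_map {R S : Type*} [CommRing R] [CommRing S] (f : R →+* S)
    (q : Fin 3 → MvPolynomial (Fin 3) R) :
    diagMatrix (fun k => MvPolynomial.map f (q k)) = f.mapMatrix (diagMatrix q) := by
  ext k j
  rw [diagMatrix, Matrix.of_apply, MvPolynomial.coeff_map]
  rfl

/-- Quadrics vanishing at the coefficients of each linear form whose square is a combination of
the given quadrics. -/
noncomputable def squareQuadrics {R : Type*} [CommRing R] (q : Fin 3 → MvPolynomial (Fin 3) R)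
    (i : Fin 3) : MvPolynomial (Fin 3) R :=
  MvPolynomial.monomial (Finsupp.single i 2) (offDiagMatrix q).det -
    ∑ j, MvPolynomial.monomial (offDiag j) (2 * ((offDiagMatrix q).adjugate * diagMatrix q) j i)

theorem squareQuadrics_map {R S : Type*} [CommRing R] [CommRing S] (f : R →+* S)
    (q : Fin 3 → MvPolynomial (Fin 3) R) (i : Fin 3) :
    squareQuadrics (fun k => MvPolynomial.map f (q k)) i =
      MvPolynomial.map f (squareQuadrics q i) := by
  rw [squareQuadrics, squareQuadrics, map_sub, map_sum, MvPolynomial.map_monomial,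
      offDiagMatrix_map,
    diagMatrix_map, ← RingHom.map_det, ← RingHom.map_adjugate, ← map_mul]
  refine congrArg _ (Finset.sum_congr rfl fun j _ => ?_)
  rw [MvPolynomial.map_monomial, map_mul f, map_ofNat]
  rfl

theorem squareQuadrics_isHomogeneous {R : Type*} [CommRing R] (q : Fin 3 → MvPolynomial (Fin 3) R)
    (i : Fin 3) : (squareQuadrics q i).IsHomogeneous 2 := by
  refine (MvPolynomial.isHomogeneous_monomial _ (Finsupp.degree_single _ _)).sub ?_
  exact MvPolynomial.IsHomogeneous.sum _ _ _ fun j _ =>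
    MvPolynomial.isHomogeneous_monomial _ (degree_offDiag j)

theorem offDiagMatrix_monomial {R : Type*} [CommRing R] :
    offDiagMatrix (fun k => (MvPolynomial.monomial (offDiag k) 1 : MvPolynomial (Fin 3) R)) = 1 :=
      by
  ext k j
  rw [offDiagMatrix, Matrix.of_apply, MvPolynomial.coeff_monomial, Matrix.one_apply]
  simp only [offDiag_injective.eq_iff]

theorem diagMatrix_monomial {R : Type*} [CommRing R] :
    diagMatrix (fun k => (MvPolynomial.monomial (offDiag k) 1 : MvPolynomial (Fin 3) R)) = 0 := by
  ext k j
  rw [diagMatrix, Matrix.of_apply, MvPolynomial.coeff_monomial, if_neg (offDiag_ne_single _ _)]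
  rfl

/-- For products of distinct variables the off-diagonal coefficient matrix is the identity and the
diagonal one is zero. This is the triple at which the third factor of the generic polynomial is seen
to be nonzero. -/
theorem squareQuadrics_monomial {R : Type*} [CommRing R] (i : Fin 3) :
    squareQuadrics (fun k => (MvPolynomial.monomial (offDiag k) 1 : MvPolynomial (Fin 3) R)) i =
      MvPolynomial.X i ^ 2 := by
  simp [squareQuadrics, offDiagMatrix_monomial, diagMatrix_monomial, MvPolynomial.X_pow_eq_monomial]

theorem coeff_linPoly_sq (a : Fin 3 → K) (i : Fin 3) :
    (linPoly a ^ 2).coeff (Finsupp.single i 2) = a i ^ 2 ∧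
      (linPoly a ^ 2).coeff (offDiag i) = 2 * (a (i + 1) * a (i + 2)) := by
  have h : linPoly a ^ 2 = ∑ k, ∑ l, MvPolynomial.monomial
      (Finsupp.single k 1 + Finsupp.single l 1) (a k * a l) := by
    rw [sq, linPoly_apply, Finset.sum_mul_sum]
    refine Finset.sum_congr rfl fun k _ => Finset.sum_congr rfl fun l _ => ?_
    rw [MvPolynomial.C_mul_X_eq_monomial, MvPolynomial.C_mul_X_eq_monomial,
      MvPolynomial.monomial_mul]
  rw [h]
  have h3 : ∀ x y : Fin 3 →₀ ℕ, x = y ↔ x 0 = y 0 ∧ x 1 = y 1 ∧ x 2 = y 2 := fun x y => by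
    rw [DFunLike.ext_iff, Fin.forall_fin_succ, Fin.forall_fin_two]
    rfl
  simp only [MvPolynomial.coeff_add, MvPolynomial.coeff_monomial, Fin.sum_univ_three, offDiag, h3,
    Finsupp.add_apply]
  fin_cases i <;> constructor <;> simp <;> ring

/-- If no nonzero linear form is annihilated by the associated quadrics, then the span of three
quadrics contains no square. -/
theorem sq_notMem_of_macaulayDet_ne_zero {q : Fin 3 → MvPolynomial (Fin 3) K}
    (hq : ∀ k, (q k).IsHomogeneous 2) (h : macaulayDet (squareQuadrics q) ≠ 0)
    {l : MvPolynomial (Fin 3) K} (hl : l.IsHomogeneous 1) (hl0 : l ≠ 0) :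
    l ^ 2 ∉ Ideal.span (Set.range q) := by
  intro hmem
  obtain ⟨a, rfl⟩ : l ∈ LinearMap.range (linPoly (K := K) (σ := Fin 3)) := by
    rw [range_linPoly]
    exact hl
  obtain ⟨g, hg⟩ := Ideal.mem_span_range_iff_exists_fun.1 hmem
  obtain ⟨c, hc⟩ : ∃ c : Fin 3 → K, ∑ k, MvPolynomial.C (c k) * q k = linPoly a ^ 2 := by
    refine ⟨fun k => (g k).coeff 0, ?_⟩
    have h2 := congrArg (MvPolynomial.homogeneousComponent (2 + 0)) hg
    have hl2 : (linPoly a ^ 2).IsHomogeneous (2 + 0) := hl.pow 2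
    rw [MvPolynomial.homogeneousComponent_eq_self hl2, map_sum] at h2
    rw [← h2]
    refine Finset.sum_congr rfl fun k _ => ?_
    rw [mul_comm (g k), MvPolynomial.homogeneousComponent_add_mul (hq k),
      MvPolynomial.homogeneousComponent_zero, mul_comm]
  have hB : Matrix.vecMul c (offDiagMatrix q) = fun j => 2 * (a (j + 1) * a (j + 2)) := by
    ext j
    rw [← (coeff_linPoly_sq a j).2, ← hc, MvPolynomial.coeff_sum]
    simp only [MvPolynomial.coeff_C_mul]
    rfl
  have hA : Matrix.vecMul c (diagMatrix q) = fun i => a i ^ 2 := by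
    ext i
    rw [← (coeff_linPoly_sq a i).1, ← hc, MvPolynomial.coeff_sum]
    simp only [MvPolynomial.coeff_C_mul]
    rfl
  -- Write `B` and `A` for the off-diagonal and diagonal coefficient matrices. Eliminating `c` by
  -- means of `c B adj(B) A = det(B) c A` leaves quadratic equations in `a` alone.
  have hmat : Matrix.vecMul (fun j => 2 * (a (j + 1) * a (j + 2)))
      ((offDiagMatrix q).adjugate * diagMatrix q) =
        fun i => (offDiagMatrix q).det * a i ^ 2 := by
    rw [← hB, Matrix.vecMul_vecMul, ← mul_assoc, Matrix.mul_adjugate, smul_mul_assoc, one_mul,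
      Matrix.vecMul_smul, hA]
    rfl
  have heval : ∀ i, MvPolynomial.eval a (squareQuadrics q i) = 0 := by
    intro i
    have h3 := congrFun hmat i
    have h1 : ∀ (d : ℕ) (k : Fin 3), (Finsupp.single k d).prod (fun n e => a n ^ e) = a k ^ d :=
      fun d k => Finsupp.prod_single_index (h := fun n e => a n ^ e) (pow_zero _)
    have h2 : ∀ j, (offDiag j).prod (fun n e => a n ^ e) = a (j + 1) * a (j + 2) := fun j => by
      have := Finsupp.prod_add_index' (f := Finsupp.single (j + 1) 1)
        (g := Finsupp.single (j + 2) 1) (h := fun n e => a n ^ e) (fun _ => pow_zero _)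
        (fun _ _ _ => pow_add _ _ _)
      rwa [h1, h1, pow_one, pow_one] at this
    simp only [squareQuadrics, map_sub, map_sum, MvPolynomial.eval_monomial, h1, h2]
    rw [← h3, sub_eq_zero, Matrix.vecMul, dotProduct]
    refine Finset.sum_congr rfl fun j _ => ?_
    ring
  refine hl0 ?_
  have ha : a = 0 := by
    ext i
    have h4 := mem_of_macaulayDet_ne_zero (squareQuadrics_isHomogeneous q) h le_rfl
      (f := MvPolynomial.X i ^ 4) (by simpa using (MvPolynomial.isHomogeneous_X K i).pow 4)
    have h5 : Ideal.span (Set.range (squareQuadrics q)) ≤ RingHom.ker (MvPolynomial.eval a) := by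
      rw [Ideal.span_le]
      rintro _ ⟨k, rfl⟩
      exact heval k
    have h6 := h5 h4
    rw [RingHom.mem_ker, map_pow, MvPolynomial.eval_X] at h6
    exact eq_zero_of_pow_eq_zero h6
  rw [ha, map_zero]

/-- Three quadrics with indeterminate coefficients. -/
noncomputable def genericQuadrics (K : Type*) [Field K] (k : Fin 3) :
    MvPolynomial (Fin 3) (MvPolynomial (Fin 3 × {e : Fin 3 →₀ ℕ // e.degree = 2}) K) :=
  ∑ e : {e : Fin 3 →₀ ℕ // e.degree = 2}, MvPolynomial.monomial e.1 (MvPolynomial.X (k, e))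

theorem genericQuadrics_map {q : Fin 3 → MvPolynomial (Fin 3) K}
    (hq : ∀ k, (q k).IsHomogeneous 2) (k : Fin 3) :
    MvPolynomial.map (MvPolynomial.eval fun c : Fin 3 × {e : Fin 3 →₀ ℕ // e.degree = 2} =>
      (q c.1).coeff c.2.1) (genericQuadrics K k) = q k := by
  classical
  ext d
  rw [genericQuadrics, map_sum, MvPolynomial.coeff_sum]
  simp only [MvPolynomial.map_monomial, MvPolynomial.eval_X, MvPolynomial.coeff_monomial]
  by_cases hd : d.degree = 2
  · rw [Finset.sum_eq_single ⟨d, hd⟩, if_pos rfl]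
    · exact fun e _ he => if_neg fun h => he (Subtype.ext h)
    · exact fun h => absurd (Finset.mem_univ _) h
  · rw [(hq k).coeff_eq_zero hd]
    refine Finset.sum_eq_zero fun e _ => if_neg ?_
    rintro rfl
    exact hd e.2

/-- General triples of ternary quadrics are complete intersections containing no squares. -/
theorem exists_forall_isGeneralCompleteIntersection (K : Type*) [Field K] :
    ∃ F : MvPolynomial (Fin 3 × {e : Fin 3 →₀ ℕ // e.degree = 2}) K, F ≠ 0 ∧
      ∀ q : Fin 3 → MvPolynomial (Fin 3) K, (∀ k, (q k).IsHomogeneous 2) →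
        MvPolynomial.eval (fun c => (q c.1).coeff c.2.1) F ≠ 0 →
          IsGeneralCompleteIntersection q := by
  let Q := genericQuadrics K
  let C (q : Fin 3 → MvPolynomial (Fin 3) K) :=
    MvPolynomial.eval fun c : Fin 3 × {e : Fin 3 →₀ ℕ // e.degree = 2} => (q c.1).coeff c.2.1
  have hQ : ∀ q : Fin 3 → MvPolynomial (Fin 3) K, (∀ k, (q k).IsHomogeneous 2) →
      (fun k => MvPolynomial.map (C q) (Q k)) = q := fun q hq => funext (genericQuadrics_map hq)
  have h1 : ∀ q : Fin 3 → MvPolynomial (Fin 3) K, (∀ k, (q k).IsHomogeneous 2) →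
      C q (macaulayDet Q) = macaulayDet q := fun q hq => by
    rw [← macaulayDet_map, hQ q hq]
  have h2 : ∀ q : Fin 3 → MvPolynomial (Fin 3) K, (∀ k, (q k).IsHomogeneous 2) →
      C q (macaulayDet ![MvPolynomial.X 0 ^ 2, Q 0, Q 1]) =
        macaulayDet ![MvPolynomial.X 0 ^ 2, q 0, q 1] := fun q hq => by
    rw [← macaulayDet_map]
    congr 1
    funext k
    fin_cases k
    · simp
    · exact congrFun (hQ q hq) 0
    · exact congrFun (hQ q hq) 1
  have h3 : ∀ q : Fin 3 → MvPolynomial (Fin 3) K, (∀ k, (q k).IsHomogeneous 2) →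
      C q (macaulayDet (squareQuadrics Q)) = macaulayDet (squareQuadrics q) := fun q hq => by
    rw [← macaulayDet_map]
    congr 1
    funext k
    rw [← squareQuadrics_map, hQ q hq]
  have hX : ∀ k : Fin 3, (MvPolynomial.X k ^ 2 : MvPolynomial (Fin 3) K).IsHomogeneous 2 :=
    fun k => by simpa using (MvPolynomial.isHomogeneous_X K k).pow 2
  -- The first factor makes the three quadrics contain all forms of degree at least four. The second
  -- does the same for `X₀²` and two of the quadrics, which gives the hyperplane condition in the
  -- regularity criterion. The third excludes squares of linear forms.
  refine ⟨macaulayDet Q * macaulayDet ![MvPolynomial.X 0 ^ 2, Q 0, Q 1] *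
    macaulayDet (squareQuadrics Q), mul_ne_zero (mul_ne_zero ?_ ?_) ?_, fun q hq hF => ?_⟩
  · intro h
    have := h1 (fun k => MvPolynomial.X k ^ 2) hX
    rw [h, map_zero, macaulayDet_X_sq] at this
    exact zero_ne_one this
  · intro h
    have := h2 (fun k => MvPolynomial.X (k + 1) ^ 2) fun k => hX _
    have hv : (![MvPolynomial.X 0 ^ 2, MvPolynomial.X (0 + 1) ^ 2, MvPolynomial.X (1 + 1) ^ 2] :
        Fin 3 → MvPolynomial (Fin 3) K) = fun k => MvPolynomial.X k ^ 2 := by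
      funext k
      fin_cases k <;> rfl
    rw [h, map_zero, hv, macaulayDet_X_sq] at this
    exact zero_ne_one this
  · intro h
    have := h3 (fun k => MvPolynomial.monomial (offDiag k) 1) fun k =>
      MvPolynomial.isHomogeneous_monomial _ (degree_offDiag k)
    have hv : squareQuadrics (fun k => (MvPolynomial.monomial (offDiag k) 1 :
        MvPolynomial (Fin 3) K)) = fun k => MvPolynomial.X k ^ 2 := funext squareQuadrics_monomial
    rw [h, map_zero, hv, macaulayDet_X_sq] at this
    exact zero_ne_one this
  · change C q _ ≠ 0 at hF
    rw [map_mul, map_mul, h1 q hq, h2 q hq, h3 q hq, mul_ne_zero_iff, mul_ne_zero_iff] at hF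
    obtain ⟨⟨hF1, hF2⟩, hF3⟩ := hF
    refine ⟨hq, isRegular_of_eventually hq (N := 4) (fun j hj f hf => ?_)
      (fun j hj f hf => mem_of_macaulayDet_ne_zero hq hF1 hj hf),
      fun l hl hl0 => sq_notMem_of_macaulayDet_ne_zero hq hF3 hl hl0⟩
    have hmem := mem_of_macaulayDet_ne_zero (q := ![MvPolynomial.X 0 ^ 2, q 0, q 1])
      (by intro k; fin_cases k; exacts [hX 0, hq 0, hq 1]) hF2 hj hf
    refine (Ideal.span_le.2 ?_ : Ideal.span (Set.range _) ≤ _) hmem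
    rintro _ ⟨k, rfl⟩
    fin_cases k
    · exact Ideal.mem_sup_right (Ideal.mem_span_singleton.2 (dvd_pow_self _ two_ne_zero))
    · exact Ideal.mem_sup_left (Ideal.subset_span (Set.mem_insert _ _))
    · exact Ideal.mem_sup_left (Ideal.subset_span (Set.mem_insert_of_mem _ rfl))

end Macaulay

theorem mainTheorem9 (K : Type*) [Field K] :
    -- every Artinian quadratic algebra with `dim R₂ = 3` is Koszul
    (∀ (n : ℕ) (I : Ideal (MvPolynomial (Fin n) K)), IsQuadraticIdeal I →
      IsArtinianRing (MvPolynomial (Fin n) K ⧸ I) → Module.finrank K (gradedPiece I 2) = 3 →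
      IsKoszul I) ∧
    (IsAlgClosed K → (2 : K) ≠ 0 →
      -- it is G-quadratic exactly when it is not a trivial extension of an exceptional algebra
      (∀ (n : ℕ) (I : Ideal (MvPolynomial (Fin n) K)), IsQuadraticIdeal I →
        IsArtinianRing (MvPolynomial (Fin n) K ⧸ I) → Module.finrank K (gradedPiece I 2) = 3 →
        (IsGQuadratic I ↔ ¬ ∃ q : Fin 3 → MvPolynomial (Fin 3) K,
          IsGeneralCompleteIntersection q ∧
            IsTrivialExtensionOf I (Ideal.span (Set.range q)))) ∧
      -- three general quadrics in three variables (outside the zero locus of a nonzero polynomial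
      -- `F` in their 18 coefficients) do define an exceptional algebra
      ∃ F : MvPolynomial (Fin 3 × {e : Fin 3 →₀ ℕ // e.degree = 2}) K, F ≠ 0 ∧
        ∀ q : Fin 3 → MvPolynomial (Fin 3) K, (∀ k, (q k).IsHomogeneous 2) →
          MvPolynomial.eval (fun c => (q c.1).coeff c.2.1) F ≠ 0 →
            IsGeneralCompleteIntersection q) := by
  refine ⟨fun n I hI _ h3 => isKoszul_of_finrank_eq_three hI h3, fun _ h2 =>
    ⟨fun n I hI _ h3 => isGQuadratic_iff h2 hI h3, exists_forall_isGeneralCompleteIntersection K⟩⟩
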